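/- Let $A,R,S$ be real $r\times r$ matrices with $S$ symmetric positive semi-definite, $R$ symmetric positive definite and $AR=RA'$ (the reversible case), such that the block matrices $[R^{1/2},AR^{1/2},\ldots,A^{r-1}R^{1/2}]$ and $[S^{1/2},A'S^{1/2},\ldots,(A')^{r-1}S^{1/2}]$ both have rank $r$. Then the Riccati equation $A'Q+QA-QRQ+S=0$ has a unique symmetric positive definite solution $Q_\infty$, there exist $\alpha_h,\beta_h>0$ such that $$\Vert e^{(A-RQ_\infty)t}\Vert\le \alpha_h\,e^{-\beta_h t}\qquad\text{for all } t\ge 0, \tag{1}$$ where $\Vert\cdot\Vert$ is the spectral norm, and the integral $\iota_h:=\int_0^\infty\Vert e^{(A-RQ_\infty)t}\Vert^2\,dt$ converges. Let $B$ be an $r\times r_1$ matrix with $BB'=R$, let $W$ be an $r_1$-dimensional Brownian motion, and let $X^h$ be a continuous solution of $$dX^h_t=(A-RQ_\infty)X^h_t\,dt+B\,dW_t$$ whose initial state $X^h_0$ is independent of $W$ and has an arbitrary law. Denote by $\eta^h_t$ the law of $X^h_t$, and let $\eta^h_\infty$ be the centred Gaussian law with covariance matrix $\int_0^\infty e^{(A-RQ_\infty)s}R\,e^{(A-RQ_\infty)'s}\,ds$.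 For probability measures $\nu,\mu$ on $\mathbb{R}^r$, with $\mu$ having the same null sets as Lebesgue measure, put $\mathrm{Ent}(\nu|\mu)=\int\log\frac{d\nu}{d\mu}\,d\nu$ if $\nu\ll\mu$ and $+\infty$ otherwise, and $$\mathcal J(\nu|\mu)=\int\Big\Vert\nabla\log\frac{d\nu}{d\mu}\Big\Vert^2d\nu=\int\frac{\Vert\nabla f\Vert^2}{f}\,d\mu,\qquad f=\frac{d\nu}{d\mu},$$ with the weak gradient of $f$ and the Euclidean norm, and $\mathcal J(\nu|\mu)=+\infty$ if $\nu\not\ll\mu$ or if $f$ has no locally integrable weak gradient. Then for every $t\ge 0$ and every pair $\alpha_h,\beta_h>0$ satisfying (1), $$\mathcal J(\eta^h_t|\eta^h_\infty)\le \alpha_h^2\,e^{-2\beta_h t}\,\mathcal J(\eta^h_0|\eta^h_\infty) \qquad\text{and}\qquad \mathrm{Ent}(\eta^h_t|\eta^h_\infty)\le e^{-t/\iota_h}\,\mathrm{Ent}(\eta^h_0|\eta^h_\infty),$$ as inequalities in $[0,+\infty]$. -/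

import Mathlib

open MeasureTheory ProbabilityTheory Set
open scoped NNReal ENNReal Matrix

namespace OscHTransform

noncomputable section

/-- The pair `(A, C)` is controllable: the block matrix `[C, A C, …, A ^ (r-1) C]` has rank `r`. -/
def Controllable {r : ℕ} (A C : Matrix (Fin r) (Fin r) ℝ) : Prop :=
  (Matrix.of fun (i : Fin r) (p : Fin r × Fin r) => (A ^ (p.1 : ℕ) * C) i p.2).rank = r

section

open scoped MatrixOrder Matrix.Norms.L2Operator

/-- The rank condition: `(A, R^{1/2})` and `(Aᵀ, S^{1/2})` are both controllable, with the
positive semidefinite square roots. -/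
def RankCondition {r : ℕ} (A R S : Matrix (Fin r) (Fin r) ℝ) : Prop :=
  Controllable A (CFC.sqrt R) ∧ Controllable Aᵀ (CFC.sqrt S)

end

/-- `Q` is a positive definite solution of the algebraic Riccati equation
`A' Q + Q A - Q R Q + S = 0`. -/
def IsPosRiccatiSol {r : ℕ} (A R S Q : Matrix (Fin r) (Fin r) ℝ) : Prop :=
  Q.PosDef ∧ Aᵀ * Q + Q * A - Q * R * Q + S = 0

/-- The matrix exponential `e^{t (A - R Q)}`. -/
def expDrift {r : ℕ} (A R Q : Matrix (Fin r) (Fin r) ℝ) (t : ℝ) : Matrix (Fin r) (Fin r) ℝ :=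
  NormedSpace.exp (t • (A - R * Q))

/-- The spectral norm of a square matrix: its operator norm for the Euclidean norm. -/
def specNorm {r : ℕ} (M : Matrix (Fin r) (Fin r) ℝ) : ℝ :=
  ‖Matrix.toEuclideanCLM (n := Fin r) (𝕜 := ℝ) M‖

/-- `ι_h = ∫_0^∞ ‖e^{t (A - R Q)}‖² dt`. -/
def iotaH {r : ℕ} (A R Q : Matrix (Fin r) (Fin r) ℝ) : ℝ :=
  ∫ t in Ioi (0 : ℝ), specNorm (expDrift A R Q t) ^ 2

/-- The limiting covariance `∫_0^∞ e^{s (A - R Q)} R e^{s (A - R Q)'} ds` of the `h`-process. -/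
def covLimit {r : ℕ} (A R Q : Matrix (Fin r) (Fin r) ℝ) : Matrix (Fin r) (Fin r) ℝ :=
  Matrix.of fun i j =>
    ∫ s in Ioi (0 : ℝ), (expDrift A R Q s * R * (expDrift A R Q s)ᵀ) i j

/-- The limiting law of the `h`-process: the centred Gaussian with covariance `covLimit`. -/
def etaInf {r : ℕ} (A R Q : Matrix (Fin r) (Fin r) ℝ) : Measure (EuclideanSpace ℝ (Fin r)) :=
  multivariateGaussian 0 (covLimit A R Q)

/-- `X` is a solution, driven by the `m`-dimensional Brownian motion `W` (which is independent
of `X 0`), of the stochastic differential equation `dX_t = (A - R Q) X_t dt + B dW_t`.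
The noise is additive, so that the integrated form involves no stochastic integral. -/
structure IsHDiffusion {r m : ℕ} (A R Q : Matrix (Fin r) (Fin r) ℝ)
    (B : Matrix (Fin r) (Fin m) ℝ) {Ω : Type*} [MeasurableSpace Ω] (P : Measure Ω)
    (W : Fin m → ℝ≥0 → Ω → ℝ) (X : ℝ≥0 → Ω → EuclideanSpace ℝ (Fin r)) : Prop where
  brownian : ∀ k, IsBrownianReal (W k) P
  indep_coord : iIndepFun (fun (k : Fin m) (ω : Ω) (t : ℝ≥0) => W k t ω) P
  indep_init : IndepFun (X 0) (fun (ω : Ω) (p : Fin m × ℝ≥0) => W p.1 p.2 ω) P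
  aemeasurable : ∀ t, AEMeasurable (X t) P
  continuous : ∀ᵐ ω ∂P, Continuous fun t => X t ω
  equation : ∀ᵐ ω ∂P, ∀ t : ℝ≥0,
    X t ω = X 0 ω
      + (∫ s in (0 : ℝ)..t, Matrix.toEuclideanCLM (n := Fin r) (𝕜 := ℝ) (A - R * Q)
          (X s.toNNReal ω))
      + WithLp.toLp 2 (B *ᵥ fun k => W k t ω)

/-- `g` is the weak (distributional) gradient of `f` with respect to Lebesgue measure. -/
def HasWeakGradient {r : ℕ} (f : EuclideanSpace ℝ (Fin r) → ℝ)
    (g : EuclideanSpace ℝ (Fin r) → EuclideanSpace ℝ (Fin r)) : Prop :=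
  LocallyIntegrable f volume ∧ LocallyIntegrable g volume ∧
    ∀ φ : EuclideanSpace ℝ (Fin r) → ℝ, ContDiff ℝ (⊤ : ℕ∞) φ → HasCompactSupport φ →
      ∀ v : EuclideanSpace ℝ (Fin r),
        ∫ x, f x * fderiv ℝ φ x v = - ∫ x, φ x * inner ℝ (g x) v

/-- The Fisher information `J(ν | μ) = ∫ ‖∇ log f‖² dν = ∫ ‖∇ f‖² / f dμ`, with `f = dν/dμ`,
of `ν` relative to a measure `μ` equivalent to Lebesgue measure. It is `∞` when `ν` is not
absolutely continuous or when `f` has no weak gradient. The weak gradient is unique up to null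
sets, so that all the terms of the infimum are equal; `0 / 0 = 0` and `c / 0 = ∞` for `c ≠ 0`. -/
def fisherInfo {r : ℕ} (ν μ : Measure (EuclideanSpace ℝ (Fin r))) : ℝ≥0∞ :=
  ⨅ (_ : ν ≪ μ) (g : EuclideanSpace ℝ (Fin r) → EuclideanSpace ℝ (Fin r))
    (_ : HasWeakGradient (fun x => (ν.rnDeriv μ x).toReal) g),
    ∫⁻ x, ‖g x‖ₑ ^ 2 / ν.rnDeriv μ x ∂μ

/-- The relative entropy `Ent(ν | μ) = ∫ log (dν/dμ) dν` of probability measures, with value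
`∞` when `ν` is not absolutely continuous or the integral diverges. -/
def relEnt {r : ℕ} (ν μ : Measure (EuclideanSpace ℝ (Fin r))) : ℝ≥0∞ :=
  InformationTheory.klDiv ν μ

end

end OscHTransform

/-! Reversibility diagonalizes the whole problem. With C = R^{1/2} the matrix a = C⁻¹AC is
symmetric, and in the unknown q = CQC the Riccati equation reads (q - a)² = a² + CSC. A Lyapunov
identity forces q - a to be positive definite (`posDef_of_mul_self_eq`), so it is the positive
square root of a² + CSC, whence uniqueness; conversely, a plus that root is positive definite by the
rank condition on S (`posDef_add_of_mul_self_eq`). Since A - RQ = -C(q - a)C⁻¹, the drift F = A - RQ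
has a basis of eigenvectors v_i with eigenvalues -l_i < 0 and ∑ v_i v_i' = R
(`IsPosRiccatiSol.exists_diagonalization`).

Variation of constants, read as a pathwise limit of sums over Brownian increments, shows that X_t
has the law of e^{tF} X_0 plus independent Gaussian noise (`IsHDiffusion.charFun_map_eq`). With e_i
= v_i / √(2 l_i) the limiting covariance is ∑ e_i e_i', and the transition is a Mehler kernel P,
reversible for the limiting law, with correlations ρ_i = e^{-l_i t} (`IsMehlerPair`).

Fisher information: by reversibility densities evolve by f ↦ Pf, and ∇Pf = M' P∇f with M = e^{tF}.
Cauchy–Schwarz in the form of joint convexity of |a|²/b, followed by invariance, costs only ‖M‖²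
(`IsMehlerPair.fisherInfo_affineLaw_le`).

Entropy: the bound Ent(Pf) ≤ c Ent(f), where c ≥ ρ_i² for all i, is proved without differentiating
in time. Its dual form `EntropyContracts` is stable under convolution and weak limits, so by the
central limit theorem it reduces to two ρ-correlated signs, where it compares power series term by
term (`twoPoint_entropy_contract`). The Donsker–Varadhan formula `klDiv_le_of_forall_bcf` converts
it back to relative entropies. Finally ‖e^{sF}‖ ≥ e^{-l_i s} gives ι_h ≥ 1/(2 l_i), that is, ρ_i² ≤
e^{-t/ι_h}. -/

open Filter Topology BoundedContinuousFunction

namespace OscHTransform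

/-! ### Dual entropy contraction: stability under weak limits and convolution. -/

section EntropyContraction

variable {H E : Type*}

/-- Dual form of the contraction of the relative entropy by a coupling `π` seen through `p, q`. -/
def EntropyContracts [TopologicalSpace E] [MeasurableSpace H] (p q : H → E) (c : ℝ)
    (π : Measure H) : Prop :=
  ∀ (f g : E →ᵇ ℝ) (a : ℝ), 0 < a → (∀ x, a ≤ f x) →
    ∫ z, f (p z) * g (q z) ∂π ≤
      c * (∫ z, f (p z) * Real.log (f (p z)) ∂π
        - (∫ z, f (p z) ∂π) * Real.log (∫ z, f (p z) ∂π))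
      + (∫ z, f (p z) ∂π) * Real.log (∫ z, Real.exp (g (q z)) ∂π)

lemma abs_bcf_le [TopologicalSpace E] (f : E →ᵇ ℝ) (x : E) : |f x| ≤ ‖f‖ :=
  f.norm_coe_le_norm x

/-- Composition of a bounded continuous function with a continuous function. -/
lemma exists_bcf_comp [TopologicalSpace E] (f : E →ᵇ ℝ) {F : ℝ → ℝ} {s : Set ℝ}
    (hF : ContinuousOn F s) (hs : IsCompact s) (hfs : ∀ x, f x ∈ s) :
    ∃ h : E →ᵇ ℝ, ∀ x, h x = F (f x) := by
  obtain ⟨C, hC⟩ := hs.exists_bound_of_continuousOn hF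
  exact ⟨.ofNormedAddCommGroup (fun x => F (f x)) (hF.comp_continuous f.continuous hfs) C
    fun x => hC _ (hfs x), fun _ => rfl⟩

lemma exists_bcf_exp [TopologicalSpace E] (g : E →ᵇ ℝ) :
    ∃ h : E →ᵇ ℝ, ∀ x, h x = Real.exp (g x) :=
  exists_bcf_comp g (s := Icc (-‖g‖) ‖g‖) Real.continuous_exp.continuousOn isCompact_Icc
    fun x => abs_le.1 (abs_bcf_le g x)

lemma exists_bcf_mul_log [TopologicalSpace E] (g : E →ᵇ ℝ) :
    ∃ h : E →ᵇ ℝ, ∀ x, h x = g x * Real.log (g x) :=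
  exists_bcf_comp g (F := fun x => x * Real.log x) (s := Icc (-‖g‖) ‖g‖)
    Real.continuous_mul_log.continuousOn isCompact_Icc
    fun x => abs_le.1 (abs_bcf_le g x)

/-- Every integrand in the inequality is bounded and continuous, and the two means inside logarithms
have positive limits, so each term converges. -/
lemma EntropyContracts.of_tendsto [TopologicalSpace E] [TopologicalSpace H] [MeasurableSpace H]
    [OpensMeasurableSpace H]
    {p q : H → E} (hp : Continuous p) (hq : Continuous q) {c : ℝ} {π : ℕ → Measure H}
    {π₀ : Measure H} [IsProbabilityMeasure π₀]
    (hlim : ∀ h : H →ᵇ ℝ, Tendsto (fun n => ∫ z, h z ∂(π n)) atTop (𝓝 (∫ z, h z ∂π₀)))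
    (h : ∀ n, EntropyContracts p q c (π n)) : EntropyContracts p q c π₀ := by
  intro f g a ha hf
  obtain ⟨ge, hge⟩ := exists_bcf_exp g
  obtain ⟨fl, hfl⟩ := exists_bcf_mul_log f
  have l1 := hlim (f.compContinuous ⟨p, hp⟩ * g.compContinuous ⟨q, hq⟩)
  have l2 := hlim (f.compContinuous ⟨p, hp⟩)
  have l3 := hlim (fl.compContinuous ⟨p, hp⟩)
  have l4 := hlim (ge.compContinuous ⟨q, hq⟩)
  simp only [BoundedContinuousFunction.coe_mul, Pi.mul_apply,
    BoundedContinuousFunction.compContinuous_apply, ContinuousMap.coe_mk, hge, hfl] at l1 l2 l3 l4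
  have hI : Integrable (fun z => f (p z)) π₀ := (f.compContinuous ⟨p, hp⟩).integrable π₀
  have hIe : Integrable (fun z => Real.exp (g (q z))) π₀ := by
    simp_rw [← hge]
    exact (ge.compContinuous ⟨q, hq⟩).integrable π₀
  have hpos : 0 < ∫ z, f (p z) ∂π₀ := by
    refine ha.trans_le ?_
    have := integral_mono (integrable_const a) hI (fun z => hf (p z))
    simpa using this
  have hpos2 : 0 < ∫ z, Real.exp (g (q z)) ∂π₀ := integral_exp_pos hIe
  refine le_of_tendsto_of_tendsto' l1 ?_ fun n => h n f g a ha hf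
  exact ((l3.sub (l2.mul (l2.log hpos.ne'))).const_mul c).add (l2.mul (l4.log hpos2.ne'))

variable [NormedAddCommGroup E] [NormedAddCommGroup H] [MeasurableSpace H] [BorelSpace H]
  [SecondCountableTopology H]

omit [SecondCountableTopology H] in
lemma exists_bcf_integral_shift (F : E →ᵇ ℝ) {p : H → E} (hp : Continuous p) (π : Measure H)
    [IsProbabilityMeasure π] : ∃ G : E →ᵇ ℝ, ∀ x, G x = ∫ z, F (x + p z) ∂π := by
  have hc : Continuous fun x => ∫ z, F (x + p z) ∂π := by
    refine continuous_of_dominated (bound := fun _ => ‖F‖) (fun x => ?_)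
      (fun x => ae_of_all _ fun z => F.norm_coe_le_norm _) (integrable_const _)
      (ae_of_all _ fun z => by fun_prop)
    exact Continuous.aestronglyMeasurable (by fun_prop)
  refine ⟨.ofNormedAddCommGroup _ hc ‖F‖ fun x => ?_, fun _ => rfl⟩
  simpa using norm_integral_le_of_norm_le_const (μ := π)
    (ae_of_all _ fun z => F.norm_coe_le_norm (x + p z))

lemma integral_conv_bcf (F : H → ℝ) (hF : Continuous F) {C : ℝ} (hC : ∀ z, |F z| ≤ C)
    (π₁ π₂ : Measure H)
    [IsProbabilityMeasure π₁] [IsProbabilityMeasure π₂] :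
    ∫ z, F z ∂(π₁ ∗ π₂) = ∫ z, ∫ w, F (z + w) ∂π₂ ∂π₁ := by
  rw [Measure.conv, integral_map (by fun_prop) hF.aestronglyMeasurable, integral_prod]
  refine Integrable.of_bound (C := C) ?_ (ae_of_all _ fun z => hC _)
  exact Continuous.aestronglyMeasurable (by fun_prop)

/-- Tensorization. Freeze the first summand and use the inequality for π₂ on translated functions,
then use the one for π₁ on the average of f and the log-Laplace transform of g. The two entropy
terms add up by the chain rule for entropy. -/
lemma EntropyContracts.conv {p q : H → E} (hp : Continuous p) (hq : Continuous q)
    (hpa : ∀ x y, p (x + y) = p x + p y) (hqa : ∀ x y, q (x + y) = q x + q y)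
    {c : ℝ} {π₁ π₂ : Measure H}
    [IsProbabilityMeasure π₁] [IsProbabilityMeasure π₂]
    (h₁ : EntropyContracts p q c π₁) (h₂ : EntropyContracts p q c π₂) :
    EntropyContracts p q c (π₁ ∗ π₂) := by
  intro f g a ha hf
  obtain ⟨ge, hge⟩ := exists_bcf_exp g
  obtain ⟨fl, hfl⟩ := exists_bcf_mul_log f
  obtain ⟨f₁, hf₁⟩ := exists_bcf_integral_shift f hp π₂
  obtain ⟨fl₁, hfl₁⟩ := exists_bcf_integral_shift fl hp π₂
  obtain ⟨ge₁, hge₁⟩ := exists_bcf_integral_shift ge hq π₂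
  have hIf (x) : Integrable (fun w => f (x + p w)) π₂ :=
    (f.compContinuous ⟨fun w => x + p w, by fun_prop⟩).integrable π₂
  have hIge (x) : Integrable (fun w => ge (x + q w)) π₂ :=
    (ge.compContinuous ⟨fun w => x + q w, by fun_prop⟩).integrable π₂
  have hf₁a (x) : a ≤ f₁ x := by
    rw [hf₁]
    simpa using integral_mono (μ := π₂) (integrable_const a) (hIf x) (fun z => hf (x + p z))
  have hge₁a (x) : Real.exp (-‖g‖) ≤ ge₁ x := by
    rw [hge₁]
    have : ∀ y, Real.exp (-‖g‖) ≤ ge y := fun y => by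
      rw [hge]; exact Real.exp_le_exp.2 (abs_le.1 (abs_bcf_le g y)).1
    simpa using integral_mono (μ := π₂) (integrable_const _) (hIge x) (fun z => this (x + q z))
  obtain ⟨f₁l, hf₁l⟩ := exists_bcf_mul_log f₁
  -- The new dual test function is the logarithm of the averaged exponential, bounded because `ge₁`
  -- is bounded away from 0.
  obtain ⟨g₁, hg₁⟩ := exists_bcf_comp ge₁ (F := Real.log) (s := Icc (Real.exp (-‖g‖)) ‖ge₁‖)
    (Real.continuousOn_log.mono fun x hx => by
      simpa using ((Real.exp_pos _).trans_le hx.1).ne') isCompact_Icc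
    (fun x => ⟨hge₁a x, (abs_le.1 (abs_bcf_le ge₁ x)).2⟩)
  have key₂ (z : H) : ∫ w, f (p (z + w)) * g (q (z + w)) ∂π₂ ≤
      c * (fl₁ (p z) - f₁l (p z)) + f₁ (p z) * g₁ (q z) := by
    have := h₂ (f.compContinuous ⟨fun x => p z + x, by fun_prop⟩)
      (g.compContinuous ⟨fun x => q z + x, by fun_prop⟩) a ha (fun x => hf _)
    simp only [BoundedContinuousFunction.compContinuous_apply, ContinuousMap.coe_mk, ← hfl,
      ← hge, ← hf₁, ← hfl₁, ← hge₁, ← hf₁l, ← hg₁] at this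
    simpa only [hpa, hqa] using this
  have hI (F : E →ᵇ ℝ) {s : H → E} (hs : Continuous s) : Integrable (fun z => F (s z)) π₁ :=
    (F.compContinuous ⟨s, hs⟩).integrable π₁
  have hI2 : Integrable (fun z => f₁ (p z) * g₁ (q z)) π₁ :=
    (f₁.compContinuous ⟨p, hp⟩ * g₁.compContinuous ⟨q, hq⟩).integrable π₁
  have hI3 : Integrable (fun z => c * (fl₁ (p z) - f₁l (p z)) + f₁ (p z) * g₁ (q z)) π₁ :=
    (((hI fl₁ hp).sub (hI f₁l hp)).const_mul c).add hI2
  have e1 : ∫ z, f (p z) * g (q z) ∂(π₁ ∗ π₂) =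
      ∫ z, ∫ w, f (p (z + w)) * g (q (z + w)) ∂π₂ ∂π₁ := by
    refine integral_conv_bcf (fun z => f (p z) * g (q z)) (by fun_prop) (C := ‖f‖ * ‖g‖)
      (fun z => ?_) _ _
    rw [abs_mul]
    exact mul_le_mul (abs_bcf_le f _) (abs_bcf_le g _) (abs_nonneg _) (norm_nonneg _)
  have e2 : ∫ z, f (p z) ∂(π₁ ∗ π₂) = ∫ z, f₁ (p z) ∂π₁ := by
    rw [integral_conv_bcf (fun z => f (p z)) (by fun_prop) (fun z => abs_bcf_le f _)]
    simp [hpa, hf₁]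
  have e3 : ∫ z, f (p z) * Real.log (f (p z)) ∂(π₁ ∗ π₂) = ∫ z, fl₁ (p z) ∂π₁ := by
    simp_rw [← hfl]
    rw [integral_conv_bcf (fun z => fl (p z)) (by fun_prop) (fun z => abs_bcf_le fl _)]
    simp [hpa, hfl₁]
  have e4 : ∫ z, Real.exp (g (q z)) ∂(π₁ ∗ π₂) = ∫ z, ge₁ (q z) ∂π₁ := by
    simp_rw [← hge]
    rw [integral_conv_bcf (fun z => ge (q z)) (by fun_prop) (fun z => abs_bcf_le ge _)]
    simp [hqa, hge₁]
  have e5 (x) : Real.exp (g₁ x) = ge₁ x := by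
    rw [hg₁, Real.exp_log ((Real.exp_pos _).trans_le (hge₁a x))]
  have key₁ := h₁ f₁ g₁ a ha hf₁a
  simp_rw [e5, ← hf₁l] at key₁
  rw [e1, e2, e3, e4]
  calc _ ≤ ∫ z, c * (fl₁ (p z) - f₁l (p z)) + f₁ (p z) * g₁ (q z) ∂π₁ := by
        refine integral_mono ?_ hI3 key₂
        have : Integrable (fun x : H × H => f (p (x.1 + x.2)) * g (q (x.1 + x.2)))
            (π₁.prod π₂) := by
          refine Integrable.of_bound (C := ‖f‖ * ‖g‖)
            (Continuous.aestronglyMeasurable (by fun_prop)) (ae_of_all _ fun z => ?_)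
          rw [norm_mul]
          exact mul_le_mul (abs_bcf_le f _) (abs_bcf_le g _) (norm_nonneg _) (norm_nonneg _)
        exact this.integral_prod_left
    _ = c * (∫ z, fl₁ (p z) ∂π₁ - ∫ z, f₁l (p z) ∂π₁) + ∫ z, f₁ (p z) * g₁ (q z) ∂π₁ := by
        rw [← integral_sub (hI fl₁ hp) (hI f₁l hp), ← integral_const_mul]
        exact integral_add (((hI fl₁ hp).sub (hI f₁l hp)).const_mul c) hI2
    _ ≤ _ := by linarith

lemma EntropyContracts.dirac_zero {p q : H → E} {c : ℝ} :
    EntropyContracts p q c (Measure.dirac (0 : H)) := by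
  intro f g a ha hf
  simp

end EntropyContraction

end OscHTransform

open Filter Topology BoundedContinuousFunction

namespace OscHTransform

/-! ### The two-point inequality for correlated signs. -/

section TwoPoint

/-- The left side of the rearrangement is u (log(1+u) - log(1-u)) + log(1-u²), and both logarithmic
series are known. -/
lemma hasSum_twoPoint_entropy {u : ℝ} (hu : |u| < 1) :
    HasSum (fun k : ℕ => (u ^ 2) ^ (k + 1) * (2 / (2 * k + 1) - 1 / (k + 1)))
      ((1 + u) * Real.log (1 + u) + (1 - u) * Real.log (1 - u)) := by
  have hu' := abs_lt.1 hu
  have h2 : |u ^ 2| < 1 := by rw [abs_pow]; exact pow_lt_one₀ (abs_nonneg _) hu two_ne_zero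
  have h := ((Real.hasSum_log_sub_log_of_abs_lt_one hu).mul_left u).sub
    (Real.hasSum_pow_div_log_of_abs_lt_one h2)
  have hl : Real.log (1 - u ^ 2) = Real.log (1 + u) + Real.log (1 - u) := by
    rw [← Real.log_mul (by linarith) (by linarith)]; ring_nf
  rw [hl] at h
  have e : (1 + u) * Real.log (1 + u) + (1 - u) * Real.log (1 - u) =
      u * (Real.log (1 + u) - Real.log (1 - u)) - -(Real.log (1 + u) + Real.log (1 - u)) := by
    generalize Real.log (1 + u) = a
    generalize Real.log (1 - u) = b
    ring
  have e' : (fun k : ℕ => (u ^ 2) ^ (k + 1) * (2 / (2 * (k : ℝ) + 1) - 1 / (k + 1))) =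
      fun k : ℕ => u * (2 * (1 / (2 * (k : ℝ) + 1)) * u ^ (2 * k + 1))
        - (u ^ 2) ^ (k + 1) / (k + 1) := by
    funext k; ring
  rw [e, e']
  exact h

/-- The series has only even powers u^{2k+2}, with nonnegative coefficients 1/((k+1)(2k+1)).
Replacing u by ρu multiplies each term by ρ^{2k+2} ≤ ρ² ≤ c. -/
lemma twoPoint_entropy_contract {u ρ c : ℝ} (hu : |u| < 1) (hρ : |ρ| ≤ 1) (hc : ρ ^ 2 ≤ c) :
    (1 + ρ * u) * Real.log (1 + ρ * u) + (1 - ρ * u) * Real.log (1 - ρ * u) ≤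
      c * ((1 + u) * Real.log (1 + u) + (1 - u) * Real.log (1 - u)) := by
  have hρu : |ρ * u| < 1 := by
    rw [abs_mul]
    exact (mul_le_of_le_one_left (abs_nonneg _) hρ).trans_lt hu
  refine hasSum_le (fun k => ?_) (hasSum_twoPoint_entropy hρu)
    ((hasSum_twoPoint_entropy hu).mul_left c)
  rw [← mul_assoc]
  refine mul_le_mul_of_nonneg_right ?_ ?_
  · rw [mul_pow, mul_pow]
    refine mul_le_mul_of_nonneg_right ?_ (by positivity)
    rw [pow_succ]
    refine (mul_le_of_le_one_left (sq_nonneg _) (pow_le_one₀ (sq_nonneg _) ?_)).trans hc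
    rw [← sq_abs]
    exact pow_le_one₀ (abs_nonneg _) hρ
  · rw [sub_nonneg, div_le_div_iff₀ (by positivity) (by positivity)]
    linarith

/-- Jensen's inequality for the exponential with weights (1 ± w)/2, after subtracting the
log-densities. -/
lemma gibbs_twoPoint {w : ℝ} (hw : |w| < 1) (s t : ℝ) :
    (1 + w) / 2 * s + (1 - w) / 2 * t ≤
      ((1 + w) * Real.log (1 + w) + (1 - w) * Real.log (1 - w)) / 2
        + Real.log ((Real.exp s + Real.exp t) / 2) := by
  have hw' := abs_lt.1 hw
  have h1 : 0 < 1 + w := by linarith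
  have h2 : 0 < 1 - w := by linarith
  have h := convexOn_exp.2 (mem_univ (s - Real.log (1 + w))) (mem_univ (t - Real.log (1 - w)))
    (by positivity : 0 ≤ (1 + w) / 2) (by positivity : 0 ≤ (1 - w) / 2) (by ring)
  simp only [smul_eq_mul, Real.exp_sub, Real.exp_log h1, Real.exp_log h2] at h
  have e : (1 + w) / 2 * (Real.exp s / (1 + w)) + (1 - w) / 2 * (Real.exp t / (1 - w)) =
      (Real.exp s + Real.exp t) / 2 := by field_simp
  rw [e, ← Real.le_log_iff_exp_le (by positivity)] at h
  linarith

/-- Conditioning on the second sign turns the values m(1 ± u) into m(1 ± ρu). The Gibbs inequality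
then leaves the entropy at ρu, which is compared with that at u. -/
lemma twoPoint_contracts {ρ c x y : ℝ} (hρ : |ρ| ≤ 1) (hc : ρ ^ 2 ≤ c) (hx : 0 < x) (hy : 0 < y)
    (s t : ℝ) :
    (1 + ρ) / 4 * (x * s + y * t) + (1 - ρ) / 4 * (x * t + y * s) ≤
      c * ((x * Real.log x + y * Real.log y) / 2 - (x + y) / 2 * Real.log ((x + y) / 2))
        + (x + y) / 2 * Real.log ((Real.exp s + Real.exp t) / 2) := by
  -- Mean and relative deviation: x = m(1 + u) and y = m(1 - u).
  obtain ⟨m, hm⟩ : ∃ m, m = (x + y) / 2 := ⟨_, rfl⟩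
  obtain ⟨u, hu⟩ : ∃ u, u = (x - y) / (x + y) := ⟨_, rfl⟩
  have hm0 : 0 < m := by rw [hm]; positivity
  have hxy : x + y ≠ 0 := by positivity
  have hx' : x = m * (1 + u) := by rw [hm, hu]; field_simp; ring
  have hy' : y = m * (1 - u) := by rw [hm, hu]; field_simp; ring
  have hu1 : |u| < 1 := by
    rw [hu, abs_div, abs_of_pos (add_pos hx hy), div_lt_one (by positivity), abs_lt]
    constructor <;> linarith
  have hu' := abs_lt.1 hu1
  have hρu : |ρ * u| < 1 := by
    rw [abs_mul]
    exact (mul_le_of_le_one_left (abs_nonneg _) hρ).trans_lt hu1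
  have h1 := mul_le_mul_of_nonneg_left (gibbs_twoPoint hρu s t) hm0.le
  have h2 := mul_le_mul_of_nonneg_left (twoPoint_entropy_contract hu1 hρ hc) hm0.le
  have e1 : Real.log x = Real.log m + Real.log (1 + u) := by
    rw [hx', Real.log_mul hm0.ne' (by linarith)]
  have e2 : Real.log y = Real.log m + Real.log (1 - u) := by
    rw [hy', Real.log_mul hm0.ne' (by linarith)]
  rw [← hm, e1, e2, hx', hy']
  nlinarith [h1, h2]

variable {H E : Type*} [NormedAddCommGroup H] [MeasurableSpace H]

/-- The law of the pair of `ρ`-correlated random signs, on the four points `± u`, `± v`. -/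
noncomputable def signPair (ρ : ℝ) (u v : H) : Measure H :=
  ENNReal.ofReal ((1 + ρ) / 4) • (Measure.dirac u + Measure.dirac (-u))
    + ENNReal.ofReal ((1 - ρ) / 4) • (Measure.dirac v + Measure.dirac (-v))

lemma isProbabilityMeasure_signPair {ρ : ℝ} (hρ : |ρ| ≤ 1) (u v : H) :
    IsProbabilityMeasure (signPair ρ u v) := by
  have := abs_le.1 hρ
  constructor
  simp only [signPair, Measure.coe_add, Measure.coe_smul, Pi.add_apply, Pi.smul_apply,
    measure_univ, smul_eq_mul]
  rw [← add_mul, ← ENNReal.ofReal_add (by linarith) (by linarith),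
    show (1 + 1 : ℝ≥0∞) = ENNReal.ofReal 2 by norm_num, ← ENNReal.ofReal_mul (by linarith)]
  rw [← ENNReal.ofReal_one]
  congr 1
  ring

lemma integral_signPair [MeasurableSingletonClass H] {G : Type*} [NormedAddCommGroup G]
    [NormedSpace ℝ G] [CompleteSpace G] {ρ : ℝ} (hρ : |ρ| ≤ 1) (u v : H) (F : H → G) :
    ∫ z, F z ∂(signPair ρ u v) =
      ((1 + ρ) / 4) • (F u + F (-u)) + ((1 - ρ) / 4) • (F v + F (-v)) := by
  have := abs_le.1 hρ
  have hI (x : H) : Integrable F (Measure.dirac x) := integrable_dirac (by simp)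
  rw [signPair, integral_add_measure, integral_smul_measure, integral_smul_measure,
    integral_add_measure (hI _) (hI _), integral_add_measure (hI _) (hI _)]
  · simp only [integral_dirac]
    rw [ENNReal.toReal_ofReal (by linarith), ENNReal.toReal_ofReal (by linarith)]
  · exact ((hI _).add_measure (hI _)).smul_measure ENNReal.ofReal_ne_top
  · exact ((hI _).add_measure (hI _)).smul_measure ENNReal.ofReal_ne_top

lemma entropyContracts_signPair [MeasurableSingletonClass H] [NormedAddCommGroup E] {p q : H → E}
    (hp : ∀ x, p (-x) = -p x) (hq : ∀ x, q (-x) = -q x) {ρ c : ℝ} (hρ : |ρ| ≤ 1)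
    (hc : ρ ^ 2 ≤ c) {u v : H} {e : E} (hpu : p u = e) (hpv : p v = e) (hqu : q u = e)
    (hqv : q v = -e) : EntropyContracts p q c (signPair ρ u v) := by
  intro f g a ha hf
  have h := twoPoint_contracts hρ hc (ha.trans_le (hf e)) (ha.trans_le (hf (-e))) (g e) (g (-e))
  simp only [integral_signPair hρ, hp, hq, hpu, hpv, hqu, hqv, smul_eq_mul, neg_neg]
  convert h using 2 <;> ring_nf

end TwoPoint

end OscHTransform

open Filter Topology BoundedContinuousFunction

namespace OscHTransform

/-! ### From correlated signs to correlated Gaussian vectors. -/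

section CentralLimit

lemma tendsto_nat_mul_cos_sub_one (x : ℝ) :
    Tendsto (fun n : ℕ => (n : ℝ) * (Real.cos (x / √n) - 1)) atTop (𝓝 (-(x ^ 2) / 2)) := by
  rw [tendsto_iff_norm_sub_tendsto_zero]
  -- The constant 5/96 is that of the fourth-order remainder in `Real.cos_bound`, valid once |x/√n|
  -- ≤ 1.
  have h0 : Tendsto (fun n : ℕ => x ^ 4 * (5 / 96) / (n : ℝ)) atTop (𝓝 0) :=
    tendsto_const_div_atTop_nhds_zero_nat _
  refine squeeze_zero' (Eventually.of_forall fun n => norm_nonneg _) ?_ h0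
  filter_upwards [eventually_ge_atTop (⌈x ^ 2⌉₊ + 1)] with n hn
  have hn1 : x ^ 2 ≤ n := (Nat.le_ceil _).trans (by exact_mod_cast (Nat.le_succ _).trans hn)
  have hn0 : (0 : ℝ) < n := by exact_mod_cast (Nat.succ_pos _).trans_le hn
  have hs : 0 < √(n : ℝ) := Real.sqrt_pos.2 hn0
  have hsq : √(n : ℝ) ^ 2 = n := Real.sq_sqrt hn0.le
  have hx : |x / √n| ≤ 1 := by
    rw [abs_div, abs_of_pos hs, div_le_one hs]
    exact Real.abs_le_sqrt hn1
  have hb := mul_le_mul_of_nonneg_left (Real.cos_bound hx) hn0.le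
  have e2 : (x / √n) ^ 2 = x ^ 2 / n := by rw [div_pow, hsq]
  have e4 : |x / √n| ^ 4 = x ^ 4 / n ^ 2 := by
    rw [show |x / √n| ^ 4 = (|x / √n| ^ 2) ^ 2 by ring, sq_abs, e2, div_pow]; ring
  rw [e2, e4, ← abs_of_pos hn0, ← abs_mul, abs_of_pos hn0] at hb
  rw [Real.norm_eq_abs]
  refine (le_of_eq ?_).trans (hb.trans (le_of_eq ?_))
  · congr 1; field_simp; ring
  · field_simp

variable {H E ι : Type*} [NormedAddCommGroup H] [InnerProductSpace ℝ H] [MeasurableSpace H]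

lemma charFun_signPair [MeasurableSingletonClass H] {ρ : ℝ} (hρ : |ρ| ≤ 1) (u v t : H) :
    charFun (signPair ρ u v) t =
      (((1 + ρ) / 2 * Real.cos (inner ℝ u t) + (1 - ρ) / 2 * Real.cos (inner ℝ v t) : ℝ) : ℂ) := by
  rw [charFun_apply, integral_signPair hρ]
  simp only [inner_neg_left, Complex.real_smul]
  push_cast
  rw [Complex.cos, Complex.cos]
  ring_nf

/-- The sum of n independent copies; its characteristic function is recorded because it is what
identifies the limit. -/
lemma exists_conv_pow [NormedAddCommGroup E] [BorelSpace H] [SecondCountableTopology H]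
    (p q : H → E) (hp : Continuous p) (hq : Continuous q)
    (hpa : ∀ x y, p (x + y) = p x + p y) (hqa : ∀ x y, q (x + y) = q x + q y) {c : ℝ}
    (π : Measure H) [IsProbabilityMeasure π] (hπ : EntropyContracts p q c π) (n : ℕ) :
    ∃ π' : Measure H, IsProbabilityMeasure π' ∧ EntropyContracts p q c π' ∧
      ∀ t, charFun π' t = charFun π t ^ n := by
  induction n with
  | zero => exact ⟨Measure.dirac 0, inferInstance, .dirac_zero, fun t => by simp [charFun_apply]⟩
  | succ n ih =>
    obtain ⟨π', h1, h2, h3⟩ := ih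
    exact ⟨π' ∗ π, inferInstance, h2.conv hp hq hpa hqa hπ, fun t => by
      rw [charFun_conv, h3, pow_succ]⟩

lemma exists_conv_prod [NormedAddCommGroup E] [BorelSpace H] [SecondCountableTopology H]
    (p q : H → E) (hp : Continuous p) (hq : Continuous q)
    (hpa : ∀ x y, p (x + y) = p x + p y) (hqa : ∀ x y, q (x + y) = q x + q y) {c : ℝ}
    (π : ι → Measure H) [∀ i, IsProbabilityMeasure (π i)]
    (hπ : ∀ i, EntropyContracts p q c (π i)) (s : Finset ι) :
    ∃ π' : Measure H, IsProbabilityMeasure π' ∧ EntropyContracts p q c π' ∧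
      ∀ t, charFun π' t = ∏ i ∈ s, charFun (π i) t := by
  classical
  induction s using Finset.induction_on with
  | empty => exact ⟨Measure.dirac 0, inferInstance, .dirac_zero, fun t => by simp [charFun_apply]⟩
  | insert i s hi ih =>
    obtain ⟨π', h1, h2, h3⟩ := ih
    exact ⟨π i ∗ π', inferInstance, (hπ i).conv hp hq hpa hqa h2, fun t => by
      rw [charFun_conv, h3, Finset.prod_insert hi]⟩

/-- Entropy contraction for a Gaussian pair with canonical correlations `ρ i`. -/
theorem entropyContracts_of_charFun [NormedAddCommGroup E] [NormedSpace ℝ E] [BorelSpace H] [FiniteDimensional ℝ H]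
    [Fintype ι] (p q : H → E) (hp : Continuous p) (hq : Continuous q)
    (hpa : ∀ x y, p (x + y) = p x + p y) (hqa : ∀ x y, q (x + y) = q x + q y)
    (hps : ∀ (a : ℝ) x, p (a • x) = a • p x) (hqs : ∀ (a : ℝ) x, q (a • x) = a • q x)
    {c : ℝ} (ρ : ι → ℝ)
    (hρ : ∀ i, |ρ i| ≤ 1) (hc : ∀ i, ρ i ^ 2 ≤ c) (u v : ι → H)
    (hpuv : ∀ i, p (u i) = p (v i)) (hqu : ∀ i, q (u i) = p (u i)) (hqv : ∀ i, q (v i) = -p (u i))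
    (π : Measure H) [IsProbabilityMeasure π]
    (hπ : ∀ t, charFun π t = Complex.exp ((∑ i, ((1 + ρ i) / 2 * (-(inner ℝ (u i) t) ^ 2 / 2) +
      (1 - ρ i) / 2 * (-(inner ℝ (v i) t) ^ 2 / 2)) : ℝ) : ℂ)) :
    EntropyContracts p q c π := by
  have : ProperSpace H := FiniteDimensional.proper ℝ H
  have hneg {s : H → E} (hs : ∀ (a : ℝ) x, s (a • x) = a • s x) (x : H) : s (-x) = -s x := by
    simpa using hs (-1) x
  -- Steps of size n^{-1/2}, summed n times below. At n = 0 the inverse is 0 and the pair is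
  -- degenerate, which does not affect the limit.
  have hP (i : ι) (n : ℕ) := isProbabilityMeasure_signPair (H := H) (hρ i)
    ((√(n : ℝ))⁻¹ • u i) ((√(n : ℝ))⁻¹ • v i)
  have hC (i : ι) (n : ℕ) : EntropyContracts p q c
      (signPair (ρ i) ((√(n : ℝ))⁻¹ • u i) ((√(n : ℝ))⁻¹ • v i)) :=
    entropyContracts_signPair (hneg hps) (hneg hqs) (hρ i) (hc i)
      (e := (√(n : ℝ))⁻¹ • p (u i)) (hps _ _) (by rw [hps, hpuv]) (by rw [hqs, hqu])
      (by rw [hqs, hqv, smul_neg])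
  choose π₁ hπ₁ hπ₁c hπ₁f using fun i n => exists_conv_pow p q hp hq hpa hqa _ (hC i n) n
  choose π₂ hπ₂ hπ₂c hπ₂f using fun n => exists_conv_prod p q hp hq hpa hqa
    (fun i => π₁ i n) (fun i => hπ₁c i n) Finset.univ
  obtain ⟨μs, hμs⟩ : ∃ μs : ℕ → ProbabilityMeasure H, ∀ n, (μs n : Measure H) = π₂ n :=
    ⟨fun n => ⟨π₂ n, hπ₂ n⟩, fun n => rfl⟩
  obtain ⟨μ₀, hμ₀⟩ : ∃ μ₀ : ProbabilityMeasure H, (μ₀ : Measure H) = π :=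
    ⟨⟨π, inferInstance⟩, rfl⟩
  have hlim : Tendsto μs atTop (𝓝 μ₀) := by
    refine ProbabilityMeasure.tendsto_of_tendsto_charFun fun t => ?_
    rw [hμ₀, hπ t]
    simp_rw [hμs, hπ₂f, hπ₁f]
    rw [Complex.ofReal_sum, Complex.exp_sum]
    refine tendsto_finsetProd _ fun i _ => ?_
    rw [← Complex.ofReal_exp]
    simp_rw [charFun_signPair (hρ i), ← Complex.ofReal_pow]
    refine (Complex.continuous_ofReal.tendsto _).comp ?_
    -- A factor of the characteristic function is (1 + g n)^n, with n g(n) tending to the Gaussian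
    -- exponent.
    have hcos := ((tendsto_nat_mul_cos_sub_one (inner ℝ (u i) t)).const_mul ((1 + ρ i) / 2)).add
      ((tendsto_nat_mul_cos_sub_one (inner ℝ (v i) t)).const_mul ((1 - ρ i) / 2))
    refine (Real.tendsto_one_add_pow_exp_of_tendsto
      (g := fun n : ℕ => (1 + ρ i) / 2 * (Real.cos (inner ℝ (u i) t / √n) - 1) +
        (1 - ρ i) / 2 * (Real.cos (inner ℝ (v i) t / √n) - 1)) ?_).congr fun n => ?_
    · refine hcos.congr fun n => ?_
      ring
    · congr 1
      rw [real_inner_smul_left, real_inner_smul_left, ← div_eq_inv_mul, ← div_eq_inv_mul]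
      ring
  rw [ProbabilityMeasure.tendsto_iff_forall_integral_tendsto, hμ₀] at hlim
  simp_rw [hμs] at hlim
  exact EntropyContracts.of_tendsto hp hq hlim hπ₂c

end CentralLimit

end OscHTransform

open Filter Topology BoundedContinuousFunction InformationTheory

namespace OscHTransform

/-! ### The Donsker–Varadhan bound for relative entropy. -/

section RelativeEntropy

variable {H E : Type*}

/-- Bounded continuous functions are dense in L¹; an L¹-convergent sequence has an a.e. convergent
subsequence, and clipping to [l, u] keeps the bounds without moving the limit. -/
lemma exists_bcf_tendsto_ae [TopologicalSpace E] [NormalSpace E] [MeasurableSpace E] [BorelSpace E]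
    (μ : Measure E) [IsFiniteMeasure μ] [μ.WeaklyRegular] {f : E → ℝ} (hf : Measurable f)
    {l u : ℝ} (hl : ∀ x, l ≤ f x) (hu : ∀ x, f x ≤ u) (hlu : l ≤ u) :
    ∃ F : ℕ → E →ᵇ ℝ, (∀ n x, l ≤ F n x ∧ F n x ≤ u) ∧
      ∀ᵐ x ∂μ, Tendsto (fun n => F n x) atTop (𝓝 (f x)) := by
  have hfm : MemLp f 1 μ := by
    refine MemLp.of_bound hf.aestronglyMeasurable (max |l| |u|) (ae_of_all _ fun x => ?_)
    exact abs_le_max_abs_abs (hl x) (hu x)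
  choose G hG _ using fun n : ℕ => hfm.exists_boundedContinuous_eLpNorm_sub_le (by simp)
    (ε := ((n : ℝ≥0∞) + 1)⁻¹) (by simp)
  have hlim : Tendsto (fun n => eLpNorm ((G n : E → ℝ) - f) 1 μ) atTop (𝓝 0) := by
    refine tendsto_of_tendsto_of_tendsto_of_le_of_le tendsto_const_nhds
      (h := fun n : ℕ => ((n : ℝ≥0∞) + 1)⁻¹) ?_
      (fun n => zero_le) fun n => ?_
    · have := ENNReal.tendsto_inv_nat_nhds_zero.comp (tendsto_add_atTop_nat 1)
      refine this.congr fun n => by simp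
    · rw [eLpNorm_sub_comm]; exact hG n
  obtain ⟨ns, -, hns⟩ := (tendstoInMeasure_of_tendsto_eLpNorm one_ne_zero
    (fun n => (G n).continuous.aestronglyMeasurable) hf.aestronglyMeasurable
    hlim).exists_seq_tendsto_ae
  have hex (n : ℕ) := exists_bcf_comp (G (ns n)) (F := fun y => max l (min y u))
    (s := Icc (-‖G (ns n)‖) ‖G (ns n)‖) (by fun_prop) isCompact_Icc
    (fun x => abs_le.1 (abs_bcf_le _ x))
  choose F hF using hex
  refine ⟨F, fun n x => ?_, ?_⟩
  · rw [hF]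
    exact ⟨le_max_left _ _, max_le hlu (min_le_right _ _)⟩
  · filter_upwards [hns] with x hx
    simp_rw [hF]
    have : Tendsto (fun y : ℝ => max l (min y u)) (𝓝 (f x)) (𝓝 (max l (min (f x) u))) :=
      Continuous.tendsto (by fun_prop) _
    rw [min_eq_left (hu x), max_eq_right (hl x)] at this
    exact this.comp hx

/-- Bounded measurable functions are limits of bounded continuous ones in the Gibbs inequality. -/
lemma integral_le_of_forall_bcf [TopologicalSpace E] [NormalSpace E] [MeasurableSpace E]
    [BorelSpace E] (μ ν : Measure E) [IsProbabilityMeasure μ] [IsProbabilityMeasure ν]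
    [(μ + ν).WeaklyRegular] {C : ℝ}
    (h : ∀ g : E →ᵇ ℝ, ∫ x, g x ∂ν ≤ C + Real.log (∫ x, Real.exp (g x) ∂μ))
    {g : E → ℝ} (hg : Measurable g) {K : ℝ} (hK : ∀ x, |g x| ≤ K) :
    ∫ x, g x ∂ν ≤ C + Real.log (∫ x, Real.exp (g x) ∂μ) := by
  rcases isEmpty_or_nonempty E with hE | ⟨⟨x₀⟩⟩
  · exact absurd (measure_univ (μ := μ)) (by simp [Set.eq_empty_of_isEmpty])
  have hK0 : 0 ≤ K := (abs_nonneg _).trans (hK x₀)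
  obtain ⟨F, hF, hFt⟩ := exists_bcf_tendsto_ae (μ + ν) hg (fun x => (abs_le.1 (hK x)).1)
    (fun x => (abs_le.1 (hK x)).2) (by linarith)
  rw [ae_add_measure_iff] at hFt
  have hFK (n x) : ‖F n x‖ ≤ K := abs_le.2 (hF n x)
  have l1 : Tendsto (fun n => ∫ x, F n x ∂ν) atTop (𝓝 (∫ x, g x ∂ν)) :=
    tendsto_integral_of_dominated_convergence (fun _ => K)
      (fun n => (F n).continuous.aestronglyMeasurable) (integrable_const _)
      (fun n => ae_of_all _ (hFK n)) hFt.2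
  have l2 : Tendsto (fun n => ∫ x, Real.exp (F n x) ∂μ) atTop (𝓝 (∫ x, Real.exp (g x) ∂μ)) := by
    refine tendsto_integral_of_dominated_convergence (fun _ => Real.exp K)
      (fun n => (Real.continuous_exp.comp (F n).continuous).aestronglyMeasurable)
      (integrable_const _) (fun n => ae_of_all _ fun x => ?_) ?_
    · rw [Real.norm_eq_abs, Real.abs_exp]
      exact Real.exp_le_exp.2 (hF n x).2
    · filter_upwards [hFt.1] with x hx using (Real.continuous_exp.tendsto _).comp hx
  have hpos : 0 < ∫ x, Real.exp (g x) ∂μ := by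
    refine integral_exp_pos (Integrable.of_bound (C := Real.exp K) (by fun_prop)
      (ae_of_all _ fun x => ?_))
    rw [Real.norm_eq_abs, Real.abs_exp]
    exact Real.exp_le_exp.2 (abs_le.1 (hK x)).2
  exact le_of_tendsto_of_tendsto' l1 ((l2.log hpos.ne').const_add C) fun n => h (F n)

/-- Testing with n times the indicator of a μ-null set leaves the exponential integral equal to 1,
so n ν(s) ≤ C for every n. -/
lemma absolutelyContinuous_of_forall_integral_le [MeasurableSpace E] (μ ν : Measure E)
    [IsProbabilityMeasure μ] [IsProbabilityMeasure ν] {C : ℝ}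
    (h : ∀ g : E → ℝ, Measurable g → (∃ K, ∀ x, |g x| ≤ K) →
      ∫ x, g x ∂ν ≤ C + Real.log (∫ x, Real.exp (g x) ∂μ)) : ν ≪ μ := by
  refine Measure.AbsolutelyContinuous.mk fun s hs hμs => ?_
  have key (n : ℕ) : n * ν.real s ≤ C := by
    have := h (s.indicator fun _ => (n : ℝ)) (measurable_const.indicator hs)
      ⟨n, fun x => by by_cases hx : x ∈ s <;> simp [hx]⟩
    have e : (fun x => Real.exp (s.indicator (fun _ => (n : ℝ)) x)) =ᵐ[μ] fun _ => 1 := by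
      have : ∀ᵐ x ∂μ, x ∉ s := measure_eq_zero_iff_ae_notMem.1 hμs
      filter_upwards [this] with x hx
      simp [hx]
    rw [integral_congr_ae e, integral_indicator_const _ hs] at this
    simpa [mul_comm] using this
  have : ν.real s = 0 := by
    by_contra hne
    have hpos : 0 < ν.real s := lt_of_le_of_ne measureReal_nonneg (Ne.symm hne)
    obtain ⟨n, hn⟩ := exists_nat_gt (C / ν.real s)
    rw [div_lt_iff₀ hpos] at hn
    exact absurd (key n) (not_le.2 hn)
  simpa [measureReal_def, ENNReal.toReal_eq_zero_iff] using this

/-- Clamping of a nonnegative number to `[e^{-n}, e^n]`. -/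
noncomputable def clampExp (n : ℕ) (x : ℝ) : ℝ :=
  max (Real.exp (-(n : ℝ))) (min x (Real.exp n))

lemma clampExp_pos (n : ℕ) (x : ℝ) : 0 < clampExp n x :=
  (Real.exp_pos _).trans_le (le_max_left _ _)

lemma clampExp_mem (n : ℕ) (x : ℝ) :
    Real.exp (-(n : ℝ)) ≤ clampExp n x ∧ clampExp n x ≤ Real.exp n :=
  ⟨le_max_left _ _, max_le (Real.exp_le_exp.2 (by linarith [n.cast_nonneg (α := ℝ)]))
    (min_le_right _ _)⟩

@[fun_prop]
lemma continuous_clampExp (n : ℕ) : Continuous (clampExp n) := by unfold clampExp; fun_prop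

lemma clampExp_le (n : ℕ) {x : ℝ} (hx : 0 ≤ x) : clampExp n x ≤ x + 1 := by
  refine max_le ?_ ((min_le_left _ _).trans (by linarith))
  have : Real.exp (-(n : ℝ)) ≤ 1 := Real.exp_le_one_iff.2 (by simp)
  linarith

lemma clampExp_cases (n : ℕ) (x : ℝ) :
    (x < Real.exp (-(n : ℝ)) ∧ clampExp n x = Real.exp (-(n : ℝ))) ∨
      (Real.exp n < x ∧ clampExp n x = Real.exp n) ∨ clampExp n x = x := by
  have h : Real.exp (-(n : ℝ)) ≤ Real.exp n :=
    Real.exp_le_exp.2 (by linarith [n.cast_nonneg (α := ℝ)])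
  unfold clampExp
  rcases lt_or_ge x (Real.exp (-(n : ℝ))) with h1 | h1
  · left
    exact ⟨h1, by rw [min_eq_left (h1.le.trans h), max_eq_left h1.le]⟩
  · rcases lt_or_ge (Real.exp n) x with h2 | h2
    · right; left
      exact ⟨h2, by rw [min_eq_right h2.le, max_eq_right h]⟩
    · right; right
      rw [min_eq_left h2, max_eq_right h1]

lemma tendsto_clampExp {x : ℝ} (hx : 0 ≤ x) : Tendsto (fun n => clampExp n x) atTop (𝓝 x) := by
  have h1 : Tendsto (fun n : ℕ => Real.exp (-(n : ℝ))) atTop (𝓝 0) :=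
    Real.tendsto_exp_neg_atTop_nhds_zero.comp tendsto_natCast_atTop_atTop
  have h2 : Tendsto (fun n : ℕ => min x (Real.exp n)) atTop (𝓝 x) := by
    refine tendsto_const_nhds.congr' ?_
    have := (Real.tendsto_exp_atTop.comp tendsto_natCast_atTop_atTop).eventually_ge_atTop x
    filter_upwards [this] with n hn
    exact (min_eq_left hn).symm
  simpa [clampExp, max_eq_right hx] using h1.max h2

/-- This sign is what allows Fatou's lemma. For x < e^{-n} it follows from e^{-n}(n + 1) ≤ 1; for x
> e^n it needs n ≥ 1. -/
lemma mul_log_clampExp_nonneg (n : ℕ) (hn : 1 ≤ n) {x : ℝ} (hx : 0 ≤ x) :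
    0 ≤ x * Real.log (clampExp n x) + 1 - x := by
  have hn' : (1 : ℝ) ≤ n := by exact_mod_cast hn
  rcases clampExp_cases n x with ⟨h1, h2⟩ | ⟨h1, h2⟩ | h2
  · rw [h2, Real.log_exp]
    have h3 := Real.add_one_le_exp (n : ℝ)
    have h4 : Real.exp (-(n : ℝ)) * Real.exp n = 1 := by rw [← Real.exp_add]; simp
    nlinarith [Real.exp_pos (n : ℝ), Real.exp_pos (-(n : ℝ))]
  · rw [h2, Real.log_exp]
    nlinarith
  · rw [h2]
    exact klFun_nonneg hx

lemma tendsto_mul_log_clampExp {x : ℝ} (hx : 0 ≤ x) :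
    Tendsto (fun n => x * Real.log (clampExp n x) + 1 - x) atTop (𝓝 (klFun x)) := by
  rcases hx.eq_or_lt with rfl | hx'
  · simp [klFun_zero]
  · exact ((((tendsto_clampExp hx).log hx'.ne').const_mul x).add_const 1).sub_const x

/-- The relative entropy is the least constant in the Gibbs inequality (the Donsker–Varadhan
formula). -/
theorem klDiv_le_of_forall_bcf [TopologicalSpace E] [NormalSpace E] [MeasurableSpace E]
    [BorelSpace E] (μ ν : Measure E) [IsProbabilityMeasure μ] [IsProbabilityMeasure ν]
    [(μ + ν).WeaklyRegular] {C : ℝ}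
    (h : ∀ g : E →ᵇ ℝ, ∫ x, g x ∂ν ≤ C + Real.log (∫ x, Real.exp (g x) ∂μ)) :
    klDiv ν μ ≤ ENNReal.ofReal C := by
  have h' (g : E → ℝ) (hg : Measurable g) (hK : ∃ K, ∀ x, |g x| ≤ K) :
      ∫ x, g x ∂ν ≤ C + Real.log (∫ x, Real.exp (g x) ∂μ) := by
    obtain ⟨K, hK⟩ := hK
    exact integral_le_of_forall_bcf μ ν h hg hK
  have hac := absolutelyContinuous_of_forall_integral_le μ ν h'
  obtain ⟨f, hf⟩ : ∃ f : E → ℝ, f = fun x => (ν.rnDeriv μ x).toReal := ⟨_, rfl⟩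
  have hfm : Measurable f := by rw [hf]; fun_prop
  have hf0 (x) : 0 ≤ f x := by rw [hf]; exact ENNReal.toReal_nonneg
  have hfi : Integrable f μ := by rw [hf]; exact Measure.integrable_toReal_rnDeriv
  have hf1 : ∫ x, f x ∂μ = 1 := by
    rw [hf, Measure.integral_toReal_rnDeriv hac]; simp
  have hclm (n : ℕ) : Measurable fun x => clampExp n (f x) :=
    (continuous_clampExp n).measurable.comp hfm
  have hlog (n : ℕ) (x) : |Real.log (clampExp n (f x))| ≤ n := by
    have := clampExp_mem n (f x)
    rw [abs_le]
    constructor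
    · rw [← Real.log_exp (-(n : ℝ))]; exact Real.log_le_log (Real.exp_pos _) this.1
    · rw [← Real.log_exp (n : ℝ)]; exact Real.log_le_log (clampExp_pos _ _) this.2
  have hbd (n : ℕ) : Integrable (fun x => f x * Real.log (clampExp n (f x))) μ := by
    refine hfi.mul_bdd (c := n) ((hclm n).log.aestronglyMeasurable)
      (ae_of_all _ fun x => hlog n x)
  have hbd₁ (n : ℕ) : Integrable (fun x => f x * Real.log (clampExp n (f x)) + 1) μ :=
    (hbd n).add (integrable_const 1)
  have hbd₂ (n : ℕ) : Integrable (fun x => f x * Real.log (clampExp n (f x)) + 1 - f x) μ :=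
    (hbd₁ n).sub hfi
  have hint (n : ℕ) : ∫ x, (f x * Real.log (clampExp n (f x)) + 1 - f x) ∂μ ≤
      C + Real.log (∫ x, clampExp n (f x) ∂μ) := by
    -- The optimal dual function is log f; its truncation is admissible and has exponential integral
    -- tending to 1.
    have h1 := h' (fun x => Real.log (clampExp n (f x))) (hclm n).log ⟨n, hlog n⟩
    simp_rw [Real.exp_log (clampExp_pos n _)] at h1
    rw [integral_sub (hbd₁ n) hfi,
      integral_add (hbd n) (integrable_const _), hf1]
    have h2 : ∫ x, f x * Real.log (clampExp n (f x)) ∂μ =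
        ∫ x, Real.log (clampExp n (f x)) ∂ν := by
      rw [← integral_rnDeriv_smul hac]
      simp [hf]
    rw [h2]
    simpa using h1
  have hlim : Tendsto (fun n => C + Real.log (∫ x, clampExp n (f x) ∂μ)) atTop (𝓝 C) := by
    have : Tendsto (fun n => ∫ x, clampExp n (f x) ∂μ) atTop (𝓝 1) := by
      rw [← hf1]
      refine tendsto_integral_of_dominated_convergence (fun x => f x + 1)
        (fun n => (hclm n).aestronglyMeasurable) (hfi.add (integrable_const _))
        (fun n => ae_of_all _ fun x => ?_) (ae_of_all _ fun x => tendsto_clampExp (hf0 x))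
      rw [Real.norm_eq_abs, abs_of_pos (clampExp_pos _ _)]
      exact clampExp_le n (hf0 x)
    simpa using (this.log one_ne_zero).const_add C
  rw [klDiv_eq_lintegral_klFun_of_ac hac]
  calc ∫⁻ x, ENNReal.ofReal (klFun (ν.rnDeriv μ x).toReal) ∂μ
      = ∫⁻ x, liminf (fun n => ENNReal.ofReal
          (f x * Real.log (clampExp n (f x)) + 1 - f x)) atTop ∂μ := by
        refine lintegral_congr fun x => ?_
        have := (ENNReal.continuous_ofReal.tendsto _).comp (tendsto_mul_log_clampExp (hf0 x))
        rw [show (ν.rnDeriv μ x).toReal = f x by rw [hf]]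
        exact this.liminf_eq.symm
    _ ≤ liminf (fun n => ∫⁻ x, ENNReal.ofReal
          (f x * Real.log (clampExp n (f x)) + 1 - f x) ∂μ) atTop := by
        refine lintegral_liminf_le fun n => ?_
        exact ((((hfm.mul (hclm n).log).add_const 1).sub hfm)).ennreal_ofReal
    _ ≤ liminf (fun n => ENNReal.ofReal (C + Real.log (∫ x, clampExp n (f x) ∂μ))) atTop := by
        refine liminf_le_liminf ?_
        filter_upwards [eventually_ge_atTop 1] with n hn
        rw [← ofReal_integral_eq_lintegral_ofReal (hbd₂ n)
          (ae_of_all _ fun x => mul_log_clampExp_nonneg n hn (hf0 x))]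
        exact ENNReal.ofReal_le_ofReal (hint n)
    _ = ENNReal.ofReal C :=
        ((ENNReal.continuous_ofReal.tendsto _).comp hlim).liminf_eq

end RelativeEntropy

end OscHTransform

open Filter Topology BoundedContinuousFunction InformationTheory

namespace OscHTransform

/-! ### Contraction for arbitrary initial densities. -/

section EntropyOfDensity

variable {H E : Type*}

lemma abs_mul_log_le_one {x : ℝ} (h0 : 0 ≤ x) (h1 : x ≤ 1) : |x * Real.log x| ≤ 1 := by
  have h := klFun_nonneg h0
  rw [klFun_apply] at h
  rw [abs_le]
  exact ⟨by linarith, by nlinarith [Real.log_nonpos h0 h1]⟩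

/-- A dominating function, uniform in n, for the truncated entropies: truncation from above
decreases x log x, and truncation from below produces values of modulus at most 1. -/
lemma abs_clampExp_mul_log_le (n : ℕ) {x : ℝ} (hx : 0 ≤ x) :
    |clampExp n x * Real.log (clampExp n x)| ≤ |x * Real.log x| + 1 := by
  rcases clampExp_cases n x with ⟨h1, h2⟩ | ⟨h1, h2⟩ | h2
  · rw [h2]
    have := abs_mul_log_le_one (Real.exp_pos (-(n : ℝ))).le (Real.exp_le_one_iff.2 (by simp))
    linarith [abs_nonneg (x * Real.log x)]
  · rw [h2]
    have h3 : (n : ℝ) ≤ Real.log x := by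
      rw [← Real.log_exp (n : ℝ)]; exact Real.log_le_log (Real.exp_pos _) h1.le
    rw [Real.log_exp, abs_of_nonneg (by positivity)]
    have h4 : Real.exp n * n ≤ x * Real.log x :=
      mul_le_mul h1.le h3 n.cast_nonneg hx
    linarith [le_abs_self (x * Real.log x)]
  · rw [h2]; linarith

variable [TopologicalSpace H] [MeasurableSpace H] [BorelSpace H] [TopologicalSpace E]
  [NormalSpace E] [MeasurableSpace E] [BorelSpace E] {p q : H → E} {c : ℝ} {π : Measure H}
  [IsProbabilityMeasure π]

/-- Approximation by continuous functions with the same bounds, a.e. for the law of p; x log x is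
bounded on [a, b], so dominated convergence applies. -/
lemma EntropyContracts.of_measurable_bounded (h : EntropyContracts p q c π) (hp : Continuous p)
    (hq : Continuous q) [(π.map p).WeaklyRegular] {f : E → ℝ} (hf : Measurable f) {a b : ℝ}
    (ha : 0 < a) (hab : a ≤ b) (hfa : ∀ x, a ≤ f x) (hfb : ∀ x, f x ≤ b) (g : E →ᵇ ℝ) :
    ∫ z, f (p z) * g (q z) ∂π ≤
      c * (∫ z, f (p z) * Real.log (f (p z)) ∂π
        - (∫ z, f (p z) ∂π) * Real.log (∫ z, f (p z) ∂π))
      + (∫ z, f (p z) ∂π) * Real.log (∫ z, Real.exp (g (q z)) ∂π) := by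
  have hpm : Measurable p := hp.measurable
  have := Measure.isProbabilityMeasure_map (μ := π) hpm.aemeasurable
  obtain ⟨F, hF, hFt⟩ := exists_bcf_tendsto_ae (π.map p) hf hfa hfb hab
  have hFt' := ae_of_ae_map hpm.aemeasurable hFt
  have hb : 0 < b := ha.trans_le hab
  have hFb (n x) : ‖F n x‖ ≤ b := abs_le.2 ⟨by linarith [(hF n x).1], (hF n x).2⟩
  have l1 : Tendsto (fun n => ∫ z, F n (p z) * g (q z) ∂π) atTop
      (𝓝 (∫ z, f (p z) * g (q z) ∂π)) := by
    refine tendsto_integral_of_dominated_convergence (fun _ => b * ‖g‖)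
      (fun n => Continuous.aestronglyMeasurable (by fun_prop)) (integrable_const _)
      (fun n => ae_of_all _ fun z => ?_) ?_
    · rw [norm_mul]
      exact mul_le_mul (hFb _ _) (abs_bcf_le g _) (norm_nonneg _) hb.le
    · filter_upwards [hFt'] with z hz using hz.mul_const _
  have l2 : Tendsto (fun n => ∫ z, F n (p z) ∂π) atTop (𝓝 (∫ z, f (p z) ∂π)) :=
    tendsto_integral_of_dominated_convergence (fun _ => b)
      (fun n => Continuous.aestronglyMeasurable (by fun_prop)) (integrable_const _)
      (fun n => ae_of_all _ fun z => hFb _ _) hFt'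
  obtain ⟨K, hK⟩ := (isCompact_Icc (a := a) (b := b)).exists_bound_of_continuousOn
    (f := fun x : ℝ => x * Real.log x) Real.continuous_mul_log.continuousOn
  have l3 : Tendsto (fun n => ∫ z, F n (p z) * Real.log (F n (p z)) ∂π) atTop
      (𝓝 (∫ z, f (p z) * Real.log (f (p z)) ∂π)) := by
    refine tendsto_integral_of_dominated_convergence (fun _ => K)
      (fun n => (Real.continuous_mul_log.comp
        ((F n).continuous.comp hp)).aestronglyMeasurable) (integrable_const _)
      (fun n => ae_of_all _ fun z => hK _ (hF n _)) ?_
    filter_upwards [hFt'] with z hz using (Real.continuous_mul_log.tendsto _).comp hz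
  have hpos : 0 < ∫ z, f (p z) ∂π := by
    refine ha.trans_le ?_
    have hI : Integrable (fun z => f (p z)) π :=
      Integrable.of_bound (C := b) (hf.comp hpm).aestronglyMeasurable
        (ae_of_all _ fun z => abs_le.2 ⟨by linarith [hfa (p z)], hfb _⟩)
    simpa using integral_mono (integrable_const a) hI fun z => hfa (p z)
  refine le_of_tendsto_of_tendsto' l1 ?_ fun n => h (F n) g a ha fun x => (hF n x).1
  exact ((l3.sub (l2.mul (l2.log hpos.ne'))).const_mul c).add (l2.mul_const _)

/-- Clamp f to [e^{-n}, e^n] and let n tend to infinity; since f has mean 1, the term with the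
logarithm of the mean disappears. -/
lemma EntropyContracts.of_density (h : EntropyContracts p q c π) (hp : Continuous p)
    (hq : Continuous q) [(π.map p).WeaklyRegular] {f : E → ℝ} (hf : Measurable f)
    (hf0 : ∀ x, 0 ≤ f x) (hfi : Integrable (fun z => f (p z)) π) (hf1 : ∫ z, f (p z) ∂π = 1)
    (hfl : Integrable (fun z => f (p z) * Real.log (f (p z))) π) (g : E →ᵇ ℝ) :
    ∫ z, f (p z) * g (q z) ∂π ≤ c * ∫ z, f (p z) * Real.log (f (p z)) ∂π
      + Real.log (∫ z, Real.exp (g (q z)) ∂π) := by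
  have hfc (n : ℕ) : Measurable fun x => clampExp n (f x) :=
    (continuous_clampExp n).measurable.comp hf
  have hpm : Measurable p := hp.measurable
  have hcf (n : ℕ) (z : H) : ‖clampExp n (f (p z))‖ ≤ f (p z) + 1 := by
    rw [Real.norm_eq_abs, abs_of_pos (clampExp_pos _ _)]
    exact clampExp_le n (hf0 _)
  have l1 : Tendsto (fun n => ∫ z, clampExp n (f (p z)) * g (q z) ∂π) atTop
      (𝓝 (∫ z, f (p z) * g (q z) ∂π)) := by
    refine tendsto_integral_of_dominated_convergence (fun z => (f (p z) + 1) * ‖g‖)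
      (fun n => ((hfc n).comp hpm).aestronglyMeasurable.mul
        (Continuous.aestronglyMeasurable (by fun_prop)))
      ((hfi.add (integrable_const _)).mul_const _)
      (fun n => ae_of_all _ fun z => ?_)
      (ae_of_all _ fun z => (tendsto_clampExp (hf0 _)).mul_const _)
    rw [norm_mul]
    exact mul_le_mul (hcf _ _) (abs_bcf_le g _) (norm_nonneg _) (by linarith [hf0 (p z)])
  have l2 : Tendsto (fun n => ∫ z, clampExp n (f (p z)) ∂π) atTop (𝓝 1) := by
    rw [← hf1]
    exact tendsto_integral_of_dominated_convergence (fun z => f (p z) + 1)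
      (fun n => ((hfc n).comp hpm).aestronglyMeasurable) (hfi.add (integrable_const _))
      (fun n => ae_of_all _ fun z => hcf _ _) (ae_of_all _ fun z => tendsto_clampExp (hf0 _))
  have l3 : Tendsto (fun n => ∫ z, clampExp n (f (p z)) * Real.log (clampExp n (f (p z))) ∂π)
      atTop (𝓝 (∫ z, f (p z) * Real.log (f (p z)) ∂π)) :=
    tendsto_integral_of_dominated_convergence (fun z => |f (p z) * Real.log (f (p z))| + 1)
      (fun n => (Real.continuous_mul_log.measurable.comp
        ((hfc n).comp hpm)).aestronglyMeasurable) (hfl.abs.add (integrable_const _))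
      (fun n => ae_of_all _ fun z => abs_clampExp_mul_log_le n (hf0 _))
      (ae_of_all _ fun z => (Real.continuous_mul_log.tendsto _).comp (tendsto_clampExp (hf0 _)))
  have l4 := ((l3.sub (l2.mul (l2.log one_ne_zero))).const_mul c).add
    (l2.mul_const (Real.log (∫ z, Real.exp (g (q z)) ∂π)))
  have l5 := le_of_tendsto_of_tendsto' l1 l4 fun n => h.of_measurable_bounded hp hq (hfc n)
    (Real.exp_pos (-(n : ℝ))) (Real.exp_le_exp.2 (by linarith [n.cast_nonneg (α := ℝ)]))
    (fun x => (clampExp_mem n _).1) (fun x => (clampExp_mem n _).2) g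
  simpa using l5

/-- A pair whose law contracts entropy contracts the relative entropy of every initial law. -/
theorem EntropyContracts.klDiv_le (h : EntropyContracts p q c π) (hp : Continuous p)
    (hq : Continuous q) (hc : 0 < c) {μ ν ν' : Measure E} [IsProbabilityMeasure μ]
    [IsProbabilityMeasure ν] [IsProbabilityMeasure ν'] [μ.WeaklyRegular] [(μ + ν').WeaklyRegular]
    (hπp : π.map p = μ) (hπq : π.map q = μ)
    (hν : ν ≪ μ → ∀ g : E →ᵇ ℝ, ∫ x, g x ∂ν' =
      ∫ z, (ν.rnDeriv μ (p z)).toReal * g (q z) ∂π) :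
    klDiv ν' μ ≤ ENNReal.ofReal c * klDiv ν μ := by
  by_cases hfin : klDiv ν μ = ∞
  -- Positivity of c matters here, since 0 * ∞ = 0 in `ℝ≥0∞`.
  · rw [hfin, ENNReal.mul_top (by simpa using hc)]
    exact le_top
  obtain ⟨hac, hint⟩ := klDiv_ne_top_iff.1 hfin
  obtain ⟨f, hf⟩ : ∃ f : E → ℝ, f = fun x => (ν.rnDeriv μ x).toReal := ⟨_, rfl⟩
  have hfm : Measurable f := by rw [hf]; fun_prop
  have hf0 (x) : 0 ≤ f x := by rw [hf]; exact ENNReal.toReal_nonneg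
  have hfi : Integrable f μ := by rw [hf]; exact Measure.integrable_toReal_rnDeriv
  have hf1 : ∫ x, f x ∂μ = 1 := by
    rw [hf, Measure.integral_toReal_rnDeriv hac]; simp
  have hkl : Integrable (fun x => klFun (f x)) μ := by
    rw [hf]; exact (integrable_klFun_rnDeriv_iff hac).2 hint
  have hfl : Integrable (fun x => f x * Real.log (f x)) μ := by
    refine ((hkl.sub (integrable_const 1)).add hfi).congr (ae_of_all _ fun x => ?_)
    simp only [Pi.add_apply, Pi.sub_apply, klFun_apply]
    ring
  have hkl1 : (klDiv ν μ).toReal = ∫ x, f x * Real.log (f x) ∂μ := by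
    rw [toReal_klDiv_eq_integral_klFun hac]
    have : ∀ x, klFun (ν.rnDeriv μ x).toReal = f x * Real.log (f x) + (1 - f x) := fun x => by
      rw [hf, klFun_apply]; ring
    have hi : Integrable (fun x => 1 - f x) μ := (integrable_const 1).sub hfi
    simp_rw [this]
    rw [integral_add hfl hi, integral_sub (integrable_const _) hfi, hf1]
    simp
  have hpm := hp.measurable
  have hqm := hq.measurable
  have tr {F : E → ℝ} (hF : Measurable F) : ∫ z, F (p z) ∂π = ∫ x, F x ∂μ := by
    rw [← hπp, integral_map hpm.aemeasurable hF.aestronglyMeasurable]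
  have tri {F : E → ℝ} (hF : Integrable F μ) : Integrable (fun z => F (p z)) π := by
    rw [← hπp] at hF
    exact hF.comp_measurable hpm
  have hflm : Measurable fun x => f x * Real.log (f x) := hfm.mul hfm.log
  rw [← ENNReal.ofReal_toReal hfin, ← ENNReal.ofReal_mul hc.le, hkl1]
  refine klDiv_le_of_forall_bcf μ ν' fun g => ?_
  have : (π.map p).WeaklyRegular := by rwa [hπp]
  have key := h.of_density hp hq hfm hf0 (tri hfi) (by rw [tr hfm, hf1]) (tri hfl) g
  rw [tr hflm] at key
  have e : ∫ z, Real.exp (g (q z)) ∂π = ∫ x, Real.exp (g x) ∂μ := by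
    rw [← hπq, integral_map hqm.aemeasurable
      (Continuous.aestronglyMeasurable (by fun_prop))]
  rw [e] at key
  rw [hν hac g]
  simpa only [hf] using key

end EntropyOfDensity

end OscHTransform

open Filter Topology BoundedContinuousFunction InformationTheory

namespace OscHTransform

/-! ### Reversible Gaussian kernels and their entropy decay. -/

section GaussianPair

variable {E ι : Type*} [NormedAddCommGroup E] [InnerProductSpace ℝ E] [FiniteDimensional ℝ E]
  [MeasurableSpace E] [BorelSpace E] [Fintype ι]

/-- The law of `∑ i, N i • e i` with independent standard Gaussian variables `N i`. -/
noncomputable def linGauss (e : ι → E) : Measure E :=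
  (Measure.pi fun _ : ι => gaussianReal 0 1).map fun x => ∑ i, x i • e i

instance isProbabilityMeasure_linGauss (e : ι → E) : IsProbabilityMeasure (linGauss e) :=
  Measure.isProbabilityMeasure_map (Measurable.aemeasurable (by fun_prop))

lemma charFun_linGauss (e : ι → E) (t : E) :
    charFun (linGauss e) t = Complex.exp ((∑ i, -(inner ℝ (e i) t) ^ 2 / 2 : ℝ) : ℂ) := by
  rw [charFun_apply, linGauss, integral_map (Measurable.aemeasurable (by fun_prop))
    (Measurable.aestronglyMeasurable (by fun_prop))]
  simp_rw [sum_inner, Complex.ofReal_sum, Finset.sum_mul, Complex.exp_sum,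
    integral_fintype_prod_eq_prod (f := fun i x => Complex.exp ((inner ℝ (x • e i) t : ℝ)
      * Complex.I)),
    real_inner_smul_left, mul_comm _ (inner ℝ (e _) t), Complex.ofReal_mul, ← charFun_apply_real,
    charFun_gaussianReal]
  refine Finset.prod_congr rfl fun i _ => ?_
  congr 1
  push_cast
  simp
  ring

/-- The law of `M X + Z` with independent `X ∼ ν` and `Z ∼ κ`. -/
noncomputable def affineLaw (M : E →L[ℝ] E) (κ ν : Measure E) : Measure E :=
  (ν.prod κ).map fun x => M x.1 + x.2

/-- The law of `(X, M X + Z)` with independent `X ∼ ν` and `Z ∼ κ`. -/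
noncomputable def pairLaw (M : E →L[ℝ] E) (κ ν : Measure E) : Measure (WithLp 2 (E × E)) :=
  (ν.prod κ).map fun x => WithLp.toLp 2 (x.1, M x.1 + x.2)

variable {M : E →L[ℝ] E} {κ μ ν : Measure E} [IsProbabilityMeasure κ] [IsProbabilityMeasure μ]
  [IsProbabilityMeasure ν] {e : ι → E} {ρ : ι → ℝ}

instance isProbabilityMeasure_affineLaw : IsProbabilityMeasure (affineLaw M κ ν) :=
  Measure.isProbabilityMeasure_map (Measurable.aemeasurable (by fun_prop))

lemma measurable_toLp_pair (M : E →L[ℝ] E) :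
    Measurable fun x : E × E => WithLp.toLp 2 (x.1, M x.1 + x.2) :=
  Continuous.measurable (by fun_prop)

instance isProbabilityMeasure_pairLaw : IsProbabilityMeasure (pairLaw M κ ν) :=
  Measure.isProbabilityMeasure_map (measurable_toLp_pair M).aemeasurable

lemma charFun_affineLaw (t : E) : charFun (affineLaw M κ ν) t =
    charFun ν (M.adjoint t) * charFun κ t := by
  simp_rw [charFun_apply]
  rw [affineLaw, integral_map (Measurable.aemeasurable (by fun_prop))
    (Measurable.aestronglyMeasurable (by fun_prop)), ← integral_prod_mul]
  refine integral_congr_ae (ae_of_all _ fun x => ?_)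
  simp only [inner_add_left, ContinuousLinearMap.adjoint_inner_right]
  rw [← Complex.exp_add]
  push_cast
  ring_nf

lemma charFun_pairLaw (t : WithLp 2 (E × E)) : charFun (pairLaw M κ ν) t =
    charFun ν (t.fst + M.adjoint t.snd) * charFun κ t.snd := by
  simp_rw [charFun_apply]
  rw [pairLaw, integral_map (measurable_toLp_pair M).aemeasurable
    (Continuous.aestronglyMeasurable (by fun_prop)), ← integral_prod_mul]
  refine integral_congr_ae (ae_of_all _ fun x => ?_)
  simp only [WithLp.prod_inner_apply, inner_add_left, inner_add_right,
    ContinuousLinearMap.adjoint_inner_right]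
  rw [← Complex.exp_add]
  push_cast
  congr 1
  simp only [WithLp.fst, WithLp.snd]
  ring

omit [IsProbabilityMeasure ν] in
lemma lintegral_pairLaw [SFinite ν] {F : WithLp 2 (E × E) → ℝ≥0∞} (hF : Measurable F) :
    ∫⁻ z, F z ∂(pairLaw M κ ν) = ∫⁻ x, ∫⁻ z, F (WithLp.toLp 2 (x, M x + z)) ∂κ ∂ν := by
  rw [pairLaw, lintegral_map hF (measurable_toLp_pair M), lintegral_prod]
  exact (hF.comp (measurable_toLp_pair M)).aemeasurable

/-- Hypotheses: `μ` is the centred Gaussian law with covariance `∑ e i ⊗ e i`, and `x ↦ M x + κ`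
the Gaussian transition kernel that is reversible for it, with eigenvalues `ρ i`. -/
structure IsMehlerPair (e : ι → E) (ρ : ι → ℝ) (M : E →L[ℝ] E) (κ μ : Measure E) : Prop where
  map_eq : ∀ i, M (e i) = ρ i • e i
  abs_le : ∀ i, |ρ i| ≤ 1
  charFun_stationary : ∀ t, charFun μ t =
    Complex.exp ((∑ i, -(inner ℝ (e i) t) ^ 2 / 2 : ℝ) : ℂ)
  charFun_noise : ∀ t, charFun κ t =
    Complex.exp ((∑ i, -((1 - ρ i ^ 2) * (inner ℝ (e i) t) ^ 2) / 2 : ℝ) : ℂ)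

namespace IsMehlerPair

variable (h : IsMehlerPair e ρ M κ μ)
include h

omit [BorelSpace E] [IsProbabilityMeasure κ] [IsProbabilityMeasure μ] in
lemma inner_adjoint (i : ι) (b : E) : inner ℝ (e i) (M.adjoint b) = ρ i * inner ℝ (e i) b := by
  rw [ContinuousLinearMap.adjoint_inner_right, h.map_eq, real_inner_smul_left]

lemma charFun_pair (t : WithLp 2 (E × E)) : charFun (pairLaw M κ μ) t =
    Complex.exp ((∑ i, -((inner ℝ (e i) t.fst) ^ 2 + (inner ℝ (e i) t.snd) ^ 2 +
      2 * ρ i * inner ℝ (e i) t.fst * inner ℝ (e i) t.snd) / 2 : ℝ) : ℂ) := by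
  rw [charFun_pairLaw, h.charFun_stationary, h.charFun_noise, ← Complex.exp_add,
    ← Complex.ofReal_add, ← Finset.sum_add_distrib]
  congr 3
  funext i
  rw [inner_add_right, h.inner_adjoint]
  ring

/-- The diagonal direction (e_i, e_i) with weight (1 + ρ_i)/2 and the antidiagonal direction (e_i,
-e_i) with weight (1 - ρ_i)/2 reproduce the joint covariance: e_i ⊗ e_i on each marginal and ρ_i e_i
⊗ e_i across. -/
lemma entropyContracts {c : ℝ} (hc : ∀ i, ρ i ^ 2 ≤ c) :
    EntropyContracts (fun z : WithLp 2 (E × E) => z.fst) (fun z => z.snd) c (pairLaw M κ μ) := by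
  refine entropyContracts_of_charFun (H := WithLp 2 (E × E)) (fun z => z.fst) (fun z => z.snd)
    (by fun_prop) (by fun_prop)
    (fun _ _ => rfl) (fun _ _ => rfl) (fun _ _ => rfl) (fun _ _ => rfl) ρ h.abs_le hc
    (fun i => WithLp.toLp 2 (e i, e i)) (fun i => WithLp.toLp 2 (e i, -e i))
    (fun _ => rfl) (fun _ => rfl) (fun _ => rfl) _ fun t => ?_
  rw [h.charFun_pair]
  congr 3
  funext i
  simp only [WithLp.prod_inner_apply, inner_neg_left, WithLp.fst, WithLp.snd]
  ring

lemma map_snd : (pairLaw M κ μ).map (fun z => z.snd) = μ := by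
  have hm : Measurable fun z : WithLp 2 (E × E) => z.snd := Continuous.measurable (by fun_prop)
  have := Measure.isProbabilityMeasure_map (μ := pairLaw M κ μ) hm.aemeasurable
  refine Measure.ext_of_charFun (funext fun t => ?_)
  have : charFun ((pairLaw M κ μ).map (fun z => z.snd)) t =
      charFun (pairLaw M κ μ) (WithLp.toLp 2 (0, t)) := by
    simp_rw [charFun_apply]
    rw [integral_map hm.aemeasurable (Continuous.aestronglyMeasurable (by fun_prop))]
    simp [WithLp.prod_inner_apply]
  rw [this, h.charFun_pair, h.charFun_stationary]
  simp

omit h [IsProbabilityMeasure μ] in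
lemma map_fst [IsProbabilityMeasure μ] : (pairLaw M κ μ).map (fun z => z.fst) = μ := by
  rw [pairLaw, Measure.map_map (Continuous.measurable (by fun_prop)) (measurable_toLp_pair M)]
  exact Measure.map_fst_prod.trans (by simp)

/-- Reversibility of the Gaussian transition kernel. -/
lemma lintegral_symm {F : E → E → ℝ≥0∞} (hF : Measurable (Function.uncurry F)) :
    ∫⁻ x, ∫⁻ z, F x (M x + z) ∂κ ∂μ = ∫⁻ x, ∫⁻ z, F (M x + z) x ∂κ ∂μ := by
  have hs : Measurable fun z : WithLp 2 (E × E) => WithLp.toLp 2 (z.snd, z.fst) :=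
    Continuous.measurable (by fun_prop)
  -- The joint characteristic function is symmetric in its two arguments, so the stationary pair is
  -- exchangeable.
  have hsw : (pairLaw M κ μ).map (fun z => WithLp.toLp 2 (z.snd, z.fst)) = pairLaw M κ μ := by
    have := Measure.isProbabilityMeasure_map (μ := pairLaw M κ μ) hs.aemeasurable
    refine Measure.ext_of_charFun (funext fun t => ?_)
    have : charFun ((pairLaw M κ μ).map (fun z => WithLp.toLp 2 (z.snd, z.fst))) t =
        charFun (pairLaw M κ μ) (WithLp.toLp 2 (t.snd, t.fst)) := by
      simp_rw [charFun_apply]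
      rw [integral_map hs.aemeasurable (Continuous.aestronglyMeasurable (by fun_prop))]
      refine integral_congr_ae (ae_of_all _ fun x => ?_)
      simp only [WithLp.prod_inner_apply, WithLp.fst, WithLp.snd]
      ring_nf
    rw [this, h.charFun_pair, h.charFun_pair]
    congr 3
    funext i
    simp only [WithLp.fst, WithLp.snd]
    ring
  have hm1 : Measurable fun z : WithLp 2 (E × E) => F z.fst z.snd :=
    hF.comp (Continuous.measurable (f := fun z : WithLp 2 (E × E) => (z.fst, z.snd))
      (by fun_prop))
  have hm2 : Measurable fun z : WithLp 2 (E × E) => F z.snd z.fst :=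
    hF.comp (Continuous.measurable (f := fun z : WithLp 2 (E × E) => (z.snd, z.fst))
      (by fun_prop))
  have h1 := lintegral_pairLaw (M := M) (κ := κ) (ν := μ) hm1
  have h2 := lintegral_pairLaw (M := M) (κ := κ) (ν := μ) hm2
  refine h1.symm.trans (Eq.trans ?_ h2)
  nth_rw 1 [← hsw]
  rw [lintegral_map hm1 hs]
  rfl

/-- The stationary law is invariant. -/
lemma lintegral_invariant {F : E → ℝ≥0∞} (hF : Measurable F) :
    ∫⁻ x, ∫⁻ z, F (M x + z) ∂κ ∂μ = ∫⁻ x, F x ∂μ := by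
  rw [h.lintegral_symm (F := fun _ y => F y) (by fun_prop)]
  simp

/-- Exponential decay of the relative entropy along a reversible Gaussian kernel. -/
theorem klDiv_affineLaw_le {c : ℝ} (hc0 : 0 < c) (hc : ∀ i, ρ i ^ 2 ≤ c) (ν : Measure E)
    [IsProbabilityMeasure ν] :
    klDiv (affineLaw M κ ν) μ ≤ ENNReal.ofReal c * klDiv ν μ := by
  refine (h.entropyContracts hc).klDiv_le (by fun_prop) (by fun_prop) hc0 map_fst h.map_snd
    fun hac g => ?_
  have hf : Integrable (fun x => (ν.rnDeriv μ x).toReal) μ := Measure.integrable_toReal_rnDeriv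
  rw [affineLaw, pairLaw, integral_map (Measurable.aemeasurable (by fun_prop))
    g.continuous.aestronglyMeasurable, integral_map (measurable_toLp_pair M).aemeasurable,
    integral_prod, integral_prod, ← integral_rnDeriv_smul hac]
  · simp only [smul_eq_mul, ← integral_const_mul]
    rfl
  · refine (hf.comp_fst κ).mul_bdd (c := ‖g‖) (Continuous.aestronglyMeasurable (by fun_prop))
      (ae_of_all _ fun x => g.norm_coe_le_norm _)
  · exact Integrable.of_bound (C := ‖g‖) (Continuous.aestronglyMeasurable (by fun_prop))
      (ae_of_all _ fun x => g.norm_coe_le_norm _)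
  · have hm : Measurable fun z : WithLp 2 (E × E) => z.fst := Continuous.measurable (by fun_prop)
    refine AEStronglyMeasurable.mul ?_ (Continuous.aestronglyMeasurable (by fun_prop))
    exact ((Measure.measurable_rnDeriv ν μ).ennreal_toReal.comp hm).aestronglyMeasurable

end IsMehlerPair

end GaussianPair

end OscHTransform

open Filter Topology

namespace OscHTransform

/-! ### Comparison of nondegenerate Gaussian laws with Lebesgue measure. -/

section GaussianDensity

variable {E ι : Type*} [Fintype ι]

/-- The density of the standard Gaussian law on `ι → ℝ`. -/
noncomputable def stdDensity (x : ι → ℝ) : ℝ := ∏ i, gaussianPDFReal 0 1 (x i)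

lemma continuous_stdDensity : Continuous (stdDensity : (ι → ℝ) → ℝ) := by
  unfold stdDensity gaussianPDFReal
  fun_prop

lemma stdDensity_pos (x : ι → ℝ) : 0 < stdDensity x :=
  Finset.prod_pos fun _ _ => gaussianPDFReal_pos _ _ _ one_ne_zero

lemma pi_gaussianReal_eq_withDensity :
    Measure.pi (fun _ : ι => gaussianReal 0 1) =
      (volume : Measure (ι → ℝ)).withDensity fun x => ENNReal.ofReal (stdDensity x) := by
  refine Measure.pi_eq fun s hs => ?_
  have hS : MeasurableSet (Set.univ.pi s) := MeasurableSet.univ_pi hs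
  have hint (i : ι) : Integrable ((s i).indicator (gaussianPDFReal 0 1)) :=
    (integrable_gaussianPDFReal 0 1).indicator (hs i)
  have hprod (x : ι → ℝ) : (Set.univ.pi s).indicator stdDensity x =
      ∏ i, (s i).indicator (gaussianPDFReal 0 1) (x i) := by
    by_cases hx : x ∈ Set.univ.pi s
    · rw [indicator_of_mem hx, stdDensity]
      exact Finset.prod_congr rfl fun i _ => (indicator_of_mem (hx i (mem_univ i)) _).symm
    · rw [indicator_of_notMem hx]
      simp only [mem_univ_pi, not_forall] at hx
      obtain ⟨i, hi⟩ := hx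
      exact (Finset.prod_eq_zero (Finset.mem_univ i) (indicator_of_notMem hi _)).symm
  have hI : Integrable ((Set.univ.pi s).indicator (stdDensity (ι := ι))) := by
    rw [funext hprod]
    exact Integrable.fintype_prod (f := fun i => (s i).indicator (gaussianPDFReal 0 1)) hint
  rw [withDensity_apply _ hS, ← ofReal_integral_eq_lintegral_ofReal
    ((integrable_indicator_iff hS).1 hI) (ae_of_all _ fun x => (stdDensity_pos x).le),
    ← integral_indicator hS, funext hprod,
    integral_fintype_prod_volume_eq_prod (fun i => (s i).indicator (gaussianPDFReal 0 1)),
    ENNReal.ofReal_prod_of_nonneg]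
  · refine Finset.prod_congr rfl fun i _ => ?_
    rw [integral_indicator (hs i), gaussianReal_apply_eq_integral _ one_ne_zero]
  · exact fun i _ => integral_nonneg fun x => indicator_nonneg
      (fun y _ => gaussianPDFReal_nonneg _ _ _) _

variable [NormedAddCommGroup E] [InnerProductSpace ℝ E] [FiniteDimensional ℝ E]
  [MeasurableSpace E] [BorelSpace E]

omit [FiniteDimensional ℝ E] [BorelSpace E] in
lemma linGauss_basis_eq_map (b : Module.Basis ι ℝ E) :
    linGauss b = (Measure.pi fun _ : ι => gaussianReal 0 1).map
      b.equivFun.symm.toContinuousLinearEquiv := by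
  rw [linGauss]
  congr 1
  funext x
  simp [Module.Basis.equivFun_symm_apply]

lemma exists_map_volume_eq_smul (T : (ι → ℝ) ≃L[ℝ] E) :
    ∃ c : ℝ≥0∞, c ≠ 0 ∧ c ≠ ∞ ∧ (volume : Measure (ι → ℝ)).map T = c • (volume : Measure E) := by
  have : ((volume : Measure (ι → ℝ)).map T).IsAddHaarMeasure := T.isAddHaarMeasure_map _
  have h := Measure.isAddLeftInvariant_eq_smul ((volume : Measure (ι → ℝ)).map T)
    (volume : Measure E)
  refine ⟨_, ?_, ENNReal.coe_ne_top, h⟩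
  rw [ENNReal.coe_ne_zero]
  exact (Measure.addHaarScalarFactor_pos_of_isAddHaarMeasure _ _).ne'

lemma linGauss_absolutelyContinuous (b : Module.Basis ι ℝ E) : linGauss b ≪ volume := by
  obtain ⟨c, hc0, hc, hT⟩ := exists_map_volume_eq_smul b.equivFun.symm.toContinuousLinearEquiv
  rw [linGauss_basis_eq_map, pi_gaussianReal_eq_withDensity]
  refine ((withDensity_absolutelyContinuous _ _).map
    (b.equivFun.symm.toContinuousLinearEquiv.continuous.measurable)).trans ?_
  rw [hT]
  exact Measure.smul_absolutelyContinuous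

/-- On compact sets the Lebesgue measure is dominated by a nondegenerate Gaussian law. -/
lemma exists_volume_restrict_le_linGauss (b : Module.Basis ι ℝ E) {K : Set E}
    (hK : IsCompact K) : ∃ C : ℝ≥0∞, C ≠ ∞ ∧ (volume : Measure E).restrict K ≤ C • linGauss b := by
  set T := b.equivFun.symm.toContinuousLinearEquiv with hTdef
  obtain ⟨c, hc0, hc, hT⟩ := exists_map_volume_eq_smul T
  have hTm : Measurable T := T.continuous.measurable
  -- The standard density is continuous and positive, hence bounded below on the compact preimage of
  -- K.
  obtain ⟨δ, hδ, hδK⟩ : ∃ δ : ℝ, 0 < δ ∧ ∀ x ∈ T ⁻¹' K, δ ≤ stdDensity x := by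
    have hK' : IsCompact (T ⁻¹' K) := T.toHomeomorph.isCompact_preimage.2 hK
    rcases (T ⁻¹' K).eq_empty_or_nonempty with h0 | h0
    · exact ⟨1, one_pos, by simp [h0]⟩
    · obtain ⟨x, hx, hmin⟩ := hK'.exists_isMinOn h0 continuous_stdDensity.continuousOn
      exact ⟨stdDensity x, stdDensity_pos x, fun y hy => hmin hy⟩
  have hδ0 : ENNReal.ofReal δ ≠ 0 := by simpa using hδ
  refine ⟨c⁻¹ * (ENNReal.ofReal δ)⁻¹, ENNReal.mul_ne_top (ENNReal.inv_ne_top.2 hc0)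
    (ENNReal.inv_ne_top.2 hδ0), Measure.le_intro fun s hs _ => ?_⟩
  have hKm := hK.measurableSet
  have hvol : (volume : Measure E) = c⁻¹ • (volume : Measure (ι → ℝ)).map T := by
    rw [hT, smul_smul, ENNReal.inv_mul_cancel hc0 hc, one_smul]
  rw [Measure.restrict_apply hs, Measure.smul_apply, smul_eq_mul, hvol, Measure.smul_apply,
    smul_eq_mul, Measure.map_apply hTm (hs.inter hKm), mul_assoc]
  gcongr
  rw [linGauss_basis_eq_map, Measure.map_apply hTm hs, pi_gaussianReal_eq_withDensity,
    withDensity_apply _ (hTm hs), mul_comm, ← div_eq_mul_inv,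
    ENNReal.le_div_iff_mul_le (Or.inl hδ0) (Or.inl ENNReal.ofReal_ne_top), mul_comm]
  calc ENNReal.ofReal δ * volume (T ⁻¹' (s ∩ K))
      = ∫⁻ _ in T ⁻¹' (s ∩ K), ENNReal.ofReal δ := by rw [setLIntegral_const]
    _ ≤ ∫⁻ x in T ⁻¹' (s ∩ K), ENNReal.ofReal (stdDensity x) :=
        setLIntegral_mono (continuous_stdDensity.measurable.ennreal_ofReal)
          fun x hx => ENNReal.ofReal_le_ofReal (hδK x hx.2)
    _ ≤ _ := lintegral_mono_set (preimage_mono inter_subset_left)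

end GaussianDensity

end OscHTransform

open Filter Topology

namespace OscHTransform

/-! ### An integrated Cauchy–Schwarz inequality. -/

section CauchySchwarz

/-- Joint convexity of `a ^ 2 / b` in integrated form. -/
lemma sq_lintegral_div_le {α : Type*} [MeasurableSpace α] {μ : Measure α} {a b : α → ℝ≥0∞}
    (ha : Measurable a) (hb : Measurable b) (hbt : ∀ x, b x ≠ ∞) :
    (∫⁻ x, a x ∂μ) ^ 2 / ∫⁻ x, b x ∂μ ≤ ∫⁻ x, a x ^ 2 / b x ∂μ := by
  by_cases htop : ∫⁻ x, a x ^ 2 / b x ∂μ = ∞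
  · rw [htop]; exact le_top
  refine ENNReal.div_le_of_le_mul ?_
  have hm : Measurable fun x => a x ^ 2 / b x := (ha.pow_const 2).div hb
  -- Where b vanishes, finiteness of the right side forces a = 0, since a nonzero number divided by
  -- 0 is infinite.
  have hae : ∀ᵐ x ∂μ, a x = (a x ^ 2 / b x) ^ (1 / 2 : ℝ) * b x ^ (1 / 2 : ℝ) := by
    filter_upwards [ae_lt_top hm htop] with x hx
    rw [← ENNReal.mul_rpow_of_nonneg _ _ (by norm_num)]
    by_cases h0 : b x = 0
    · have ha0 : a x = 0 := by
        by_contra hne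
        rw [h0, ENNReal.div_zero (pow_ne_zero 2 hne)] at hx
        exact lt_irrefl _ hx
      simp [ha0]
    · rw [ENNReal.div_mul_cancel h0 (hbt x), ← ENNReal.rpow_natCast, ← ENNReal.rpow_mul]
      norm_num
  have key := ENNReal.lintegral_mul_norm_pow_le (μ := μ) hm.aemeasurable hb.aemeasurable
    (p := 1 / 2) (q := 1 / 2) (by norm_num) (by norm_num) (by norm_num)
  rw [← lintegral_congr_ae hae] at key
  calc (∫⁻ x, a x ∂μ) ^ 2
      ≤ ((∫⁻ x, a x ^ 2 / b x ∂μ) ^ (1 / 2 : ℝ) * (∫⁻ x, b x ∂μ) ^ (1 / 2 : ℝ)) ^ 2 := by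
        gcongr
    _ = _ := by
        rw [mul_pow, ← ENNReal.rpow_natCast, ← ENNReal.rpow_natCast, ← ENNReal.rpow_mul,
          ← ENNReal.rpow_mul]
        norm_num

end CauchySchwarz

/-- The Euclidean space `ℝ ^ r`. -/
abbrev Euc (r : ℕ) := EuclideanSpace ℝ (Fin r)

/-! ### Weak gradients under affine changes of variables. -/

section WeakGradient

variable {r : ℕ}

/-- Only the independence of the Jacobian factor from z is needed: it occurs on both sides of the
weak identity. -/
lemma integral_comp_affine (M : Euc r ≃L[ℝ] Euc r) : ∃ c : ℝ, ∀ (z : Euc r) (F : Euc r → ℝ),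
    ∫ x, F (M x + z) = c * ∫ x, F x := by
  have hd : LinearMap.det (M : Euc r →ₗ[ℝ] Euc r) ≠ 0 := (LinearEquiv.isUnit_det' M.toLinearEquiv).ne_zero
  refine ⟨|(LinearMap.det (M : Euc r →ₗ[ℝ] Euc r))⁻¹|, fun z F => ?_⟩
  have h := Measure.map_linearMap_addHaar_eq_smul_addHaar (volume : Measure (Euc r)) hd
  have h1 : ∫ x, F (M x + z) = ∫ x, F (x + z) ∂((volume : Measure (Euc r)).map M) :=
    (M.toHomeomorph.measurableEmbedding.integral_map (fun x => F (x + z))).symm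
  have h2 : (volume : Measure (Euc r)).map M = ENNReal.ofReal
      |(LinearMap.det (M : Euc r →ₗ[ℝ] Euc r))⁻¹| • (volume : Measure (Euc r)) := h
  rw [h1, h2, integral_smul_measure, ENNReal.toReal_ofReal (abs_nonneg _),
    integral_add_right_eq_self]
  rfl

lemma HasWeakGradient.comp_affine {f : Euc r → ℝ} {g : Euc r → Euc r} (h : HasWeakGradient f g)
    (M : Euc r ≃L[ℝ] Euc r) (z : Euc r) {φ : Euc r → ℝ} (hφ : ContDiff ℝ (⊤ : ℕ∞) φ)
    (hφc : HasCompactSupport φ) (v : Euc r) :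
    ∫ x, f (M x + z) * fderiv ℝ φ x v = - ∫ x, φ x * inner ℝ (g (M x + z)) (M v) := by
  obtain ⟨c, hc⟩ := integral_comp_affine M
  -- Pull the test function back by the inverse affine map; its derivative in direction M v is that
  -- of φ in direction v.
  have hψ : ContDiff ℝ (⊤ : ℕ∞) fun y => φ (M.symm (y - z)) := by fun_prop
  have hψc : HasCompactSupport fun y => φ (M.symm (y - z)) :=
    hφc.comp_homeomorph ((Homeomorph.subRight z).trans M.symm.toHomeomorph)
  have key := h.2.2 _ hψ hψc (M v)
  have hd (y : Euc r) : fderiv ℝ (fun y => φ (M.symm (y - z))) y (M v) =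
      fderiv ℝ φ (M.symm (y - z)) v := by
    have h1 : HasFDerivAt (fun y => M.symm (y - z)) (M.symm : Euc r →L[ℝ] Euc r) y :=
      M.symm.hasFDerivAt.comp y ((hasFDerivAt_id y).sub_const z)
    have h2 : HasFDerivAt φ (fderiv ℝ φ (M.symm (y - z))) (M.symm (y - z)) :=
      (hφ.differentiable (by simp) _).hasFDerivAt
    have h3 := (h2.comp y h1).fderiv
    simp only [Function.comp_def] at h3
    rw [h3]
    simp
  simp_rw [hd] at key
  have e1 := hc z fun y => f y * fderiv ℝ φ (M.symm (y - z)) v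
  have e2 := hc z fun y => φ (M.symm (y - z)) * inner ℝ (g y) (M v)
  simp only [add_sub_cancel_right, ContinuousLinearEquiv.symm_apply_apply] at e1 e2
  rw [e1, e2, key]
  ring

lemma HasWeakGradient.congr_ae {f f' : Euc r → ℝ} {g g' : Euc r → Euc r} (h : HasWeakGradient f g)
    (hf : f =ᵐ[volume] f') (hg : g =ᵐ[volume] g') : HasWeakGradient f' g' := by
  refine ⟨h.1.congr hf, h.2.1.congr hg, fun φ hφ hφc v => ?_⟩
  have e1 : ∫ x, f x * fderiv ℝ φ x v = ∫ x, f' x * fderiv ℝ φ x v :=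
    integral_congr_ae (by filter_upwards [hf] with x hx; rw [hx])
  have e2 : ∫ x, φ x * inner ℝ (g x) v = ∫ x, φ x * inner ℝ (g' x) v :=
    integral_congr_ae (by filter_upwards [hg] with x hx; rw [hx])
  rw [← e1, ← e2, h.2.2 φ hφ hφc v]

end WeakGradient

end OscHTransform

open Filter Topology

namespace OscHTransform

/-! ### Fisher information along a reversible Gaussian kernel. -/

section FisherInformation

variable {r : ℕ} {ι : Type*} [Fintype ι]

variable {M : Euc r ≃L[ℝ] Euc r} {κ μ ν : Measure (Euc r)} [IsProbabilityMeasure κ] [IsProbabilityMeasure μ]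
  [IsProbabilityMeasure ν] {e : ι → Euc r} {ρ : ι → ℝ}

/-- Lebesgue measure is dominated by a multiple of `μ` on compact sets. -/
def LocallyDominates (μ : Measure (Euc r)) : Prop :=
  ∀ K : Set (Euc r), IsCompact K → ∃ C : ℝ≥0∞, C ≠ ∞ ∧ (volume : Measure (Euc r)).restrict K ≤ C • μ

omit [IsProbabilityMeasure μ] in
lemma LocallyDominates.absolutelyContinuous (h : LocallyDominates μ) :
    (volume : Measure (Euc r)) ≪ μ := by
  intro s hs
  refine measure_null_of_locally_null s fun x _ => ?_
  obtain ⟨K, hK, hxK⟩ := exists_compact_mem_nhds x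
  obtain ⟨C, -, hC⟩ := h K hK
  refine ⟨s ∩ K, inter_mem_nhdsWithin s hxK, ?_⟩
  have h1 := (Measure.le_iff'.1 hC) s
  rw [Measure.smul_apply, hs, smul_zero] at h1
  have h2 := Measure.le_restrict_apply (μ := (volume : Measure (Euc r))) K s
  exact le_antisymm (h2.trans h1) zero_le

omit [IsProbabilityMeasure μ] in
lemma LocallyDominates.locallyIntegrable (h : LocallyDominates μ) {F : Type*}
    [NormedAddCommGroup F] {u : Euc r → F} (hu : Integrable u μ) : LocallyIntegrable u volume := by
  rw [locallyIntegrable_iff]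
  intro K hK
  obtain ⟨C, hC, hle⟩ := h K hK
  exact (hu.smul_measure hC).mono_measure hle

-- Reversibility moves the kernel from the indicator of the target set onto the initial density, so
-- densities evolve by f ↦ Pf.
omit [IsProbabilityMeasure ν] in
lemma IsMehlerPair.affineLaw_eq_withDensity (h : IsMehlerPair e ρ (M : Euc r →L[ℝ] Euc r) κ μ)
    {F : Euc r → ℝ≥0∞} (hF : Measurable F) (hν : ν = μ.withDensity F) :
    affineLaw (M : Euc r →L[ℝ] Euc r) κ ν = μ.withDensity fun x => ∫⁻ z, F (M x + z) ∂κ := by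
  ext s hs
  have hm : Measurable fun x : Euc r × Euc r => M x.1 + x.2 := by fun_prop
  have hi : Measurable (s.indicator (1 : Euc r → ℝ≥0∞)) := measurable_one.indicator hs
  have e1 : affineLaw (M : Euc r →L[ℝ] Euc r) κ ν s =
      ∫⁻ x, ∫⁻ z, s.indicator 1 (M x + z) ∂κ ∂ν := by
    rw [← lintegral_indicator_one hs, affineLaw,
      lintegral_map hi (by fun_prop), lintegral_prod _ (by exact (hi.comp hm).aemeasurable)]
    rfl
  have e2 : ∫⁻ x, ∫⁻ z, s.indicator 1 (M x + z) ∂κ ∂ν =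
      ∫⁻ x, ∫⁻ z, F x * s.indicator 1 (M x + z) ∂κ ∂μ := by
    rw [hν, lintegral_withDensity_eq_lintegral_mul _ hF
      (Measurable.lintegral_prod_right (by exact hi.comp hm))]
    refine lintegral_congr fun x => ?_
    exact (lintegral_const_mul _ (hi.comp (by fun_prop : Measurable fun z => M x + z))).symm
  have e3 := h.lintegral_symm (F := fun x y => F x * s.indicator 1 y)
    ((hF.comp measurable_fst).mul (hi.comp measurable_snd))
  rw [e1, e2]
  refine e3.trans ?_
  rw [withDensity_apply _ hs, ← lintegral_indicator hs]
  refine lintegral_congr fun x => ?_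
  by_cases hx : x ∈ s <;> simp [hx]

/-- Integrability needed to apply Fubini's theorem to `∫ ψ(x) ∫ u(M x + z) κ(dz) dx`. -/
lemma IsMehlerPair.integrable_mul_comp (h : IsMehlerPair e ρ (M : Euc r →L[ℝ] Euc r) κ μ)
    (hμ : LocallyDominates μ) {u : Euc r → ℝ} (hum : Measurable u) (hu : Integrable u μ)
    {ψ : Euc r → ℝ} (hψ : Continuous ψ) (hψc : HasCompactSupport ψ) :
    Integrable (fun x : Euc r × Euc r => u (M x.1 + x.2) * ψ x.1) (volume.prod κ) := by
  obtain ⟨B, hB⟩ := hψc.exists_bound_of_continuous hψ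
  obtain ⟨C, hC, hle⟩ := hμ (tsupport ψ) hψc
  have hm : Measurable fun x : Euc r × Euc r => M x.1 + x.2 := by fun_prop
  have hme : Measurable fun y => ‖u y‖ₑ := hum.enorm
  refine ⟨((hum.comp hm).mul (hψ.measurable.comp measurable_fst)).aestronglyMeasurable, ?_⟩
  rw [hasFiniteIntegral_iff_enorm, lintegral_prod _
    (by exact ((hum.comp hm).mul (hψ.measurable.comp measurable_fst)).enorm.aemeasurable)]
  have hP : Measurable fun x => ∫⁻ z, ‖u (M x + z)‖ₑ ∂κ :=
    Measurable.lintegral_prod_right (by exact hme.comp hm)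
  calc ∫⁻ x, ∫⁻ z, ‖u (M x + z) * ψ x‖ₑ ∂κ
      ≤ ∫⁻ x, (tsupport ψ).indicator
          (fun x => ENNReal.ofReal B * ∫⁻ z, ‖u (M x + z)‖ₑ ∂κ) x := by
        refine lintegral_mono fun x => ?_
        by_cases hx : x ∈ tsupport ψ
        · rw [indicator_of_mem hx]
          refine le_trans ?_ (lintegral_const_mul _
            (hme.comp (by fun_prop : Measurable fun z => M x + z))).le
          refine lintegral_mono fun z => ?_
          simp only [Function.comp_apply]
          rw [enorm_mul, mul_comm]
          gcongr
          rw [← ofReal_norm]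
          exact ENNReal.ofReal_le_ofReal (hB x)
        · simp [image_eq_zero_of_notMem_tsupport hx]
    -- On the compact support Lebesgue measure is at most C μ, and invariance of μ then removes the
    -- kernel.
    _ = ∫⁻ x in tsupport ψ, ENNReal.ofReal B * ∫⁻ z, ‖u (M x + z)‖ₑ ∂κ :=
        lintegral_indicator (isClosed_tsupport ψ).measurableSet _
    _ ≤ ∫⁻ x, ENNReal.ofReal B * ∫⁻ z, ‖u (M x + z)‖ₑ ∂κ ∂(C • μ) := lintegral_mono' hle le_rfl
    _ = C * (ENNReal.ofReal B * ∫⁻ x, ‖u x‖ₑ ∂μ) := by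
        rw [lintegral_smul_measure, lintegral_const_mul _ hP]
        congr 2
        exact h.lintegral_invariant hme
    _ < ∞ := ENNReal.mul_lt_top hC.lt_top (ENNReal.mul_lt_top ENNReal.ofReal_lt_top hu.2)

/-- The Gaussian kernel transports weak gradients. -/
lemma IsMehlerPair.hasWeakGradient (h : IsMehlerPair e ρ (M : Euc r →L[ℝ] Euc r) κ μ)
    (hμ : LocallyDominates μ) {f : Euc r → ℝ} {g : Euc r → Euc r} (hf : Measurable f) (hg : Measurable g)
    (hfi : Integrable f μ) (hgi : Integrable g μ) (hfg : HasWeakGradient f g) :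
    HasWeakGradient (fun x => ∫ z, f (M x + z) ∂κ)
      (fun x => (M : Euc r →L[ℝ] Euc r).adjoint (∫ z, g (M x + z) ∂κ)) := by
  have hm : Measurable fun x : Euc r × Euc r => M x.1 + x.2 := by fun_prop
  -- Averaging over the noise contracts L¹(μ), by the triangle inequality and invariance.
  have hPi {F : Type} [NormedAddCommGroup F] [NormedSpace ℝ F] [MeasurableSpace F] [BorelSpace F]
      [SecondCountableTopology F] {u : Euc r → F} (hum : Measurable u) (hu : Integrable u μ) :
      Integrable (fun x => ∫ z, u (M x + z) ∂κ) μ := by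
    have hsm : StronglyMeasurable fun x : Euc r × Euc r => u (M x.1 + x.2) :=
      (hum.comp hm).stronglyMeasurable
    refine ⟨hsm.integral_prod_right'.aestronglyMeasurable, ?_⟩
    rw [hasFiniteIntegral_iff_enorm]
    calc ∫⁻ x, ‖∫ z, u (M x + z) ∂κ‖ₑ ∂μ ≤ ∫⁻ x, ∫⁻ z, ‖u (M x + z)‖ₑ ∂κ ∂μ :=
          lintegral_mono fun x => enorm_integral_le_lintegral_enorm _
      _ = ∫⁻ x, ‖u x‖ₑ ∂μ := h.lintegral_invariant hum.enorm
      _ < ∞ := hu.2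
  have hgae : ∀ᵐ x, Integrable (fun z => g (M x + z)) κ := by
    refine hμ.absolutelyContinuous ?_
    have hP : Measurable fun x => ∫⁻ z, ‖g (M x + z)‖ₑ ∂κ :=
      Measurable.lintegral_prod_right (by exact hg.enorm.comp hm)
    have hfin : ∫⁻ x, ∫⁻ z, ‖g (M x + z)‖ₑ ∂κ ∂μ ≠ ∞ :=
      ((h.lintegral_invariant hg.enorm).trans_lt hgi.2).ne
    filter_upwards [ae_lt_top hP hfin] with x hx
    exact ⟨(hg.comp (by fun_prop)).aestronglyMeasurable, hx⟩
  refine ⟨hμ.locallyIntegrable (hPi hf hfi), hμ.locallyIntegrable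
    ((M : Euc r →L[ℝ] Euc r).adjoint.integrable_comp (hPi hg hgi)), fun φ hφ hφc v => ?_⟩
  have hgv : Measurable fun x => inner ℝ (g x) (M v) := by fun_prop
  have hφd : Continuous fun x => fderiv ℝ φ x v :=
    (hφ.continuous_fderiv (by simp)).clm_apply continuous_const
  have hφdc : HasCompactSupport fun x => fderiv ℝ φ x v := hφc.fderiv_apply ℝ v
  have i1 := h.integrable_mul_comp hμ hf hfi hφd hφdc
  have i2 := h.integrable_mul_comp hμ hgv (hgi.inner_const (M v)) hφ.continuous hφc
  calc ∫ x, (∫ z, f (M x + z) ∂κ) * fderiv ℝ φ x v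
      = ∫ x, ∫ z, f (M x + z) * fderiv ℝ φ x v ∂κ := by simp_rw [integral_mul_const]
    _ = ∫ z, (∫ x, f (M x + z) * fderiv ℝ φ x v) ∂κ := integral_integral_swap i1
    _ = ∫ z, (-∫ x, inner ℝ (g (M x + z)) (M v) * φ x) ∂κ := by
        refine integral_congr_ae (ae_of_all _ fun z => ?_)
        simp only
        rw [hfg.comp_affine M z hφ hφc v]
        simp_rw [mul_comm]
    _ = -∫ x, ∫ z, inner ℝ (g (M x + z)) (M v) * φ x ∂κ := by
        rw [integral_neg, integral_integral_swap (f := fun x z => inner ℝ (g (M x + z)) (M v) * φ x) i2]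
    _ = _ := by
        congr 1
        refine integral_congr_ae ?_
        filter_upwards [hgae] with x hx
        rw [integral_mul_const, mul_comm, ContinuousLinearMap.adjoint_inner_left,
          real_inner_comm, ← integral_inner hx]
        simp_rw [real_inner_comm]
        rfl

/-- Decay of the Fisher information along a reversible Gaussian kernel. -/
theorem IsMehlerPair.fisherInfo_affineLaw_le (h : IsMehlerPair e ρ (M : Euc r →L[ℝ] Euc r) κ μ)
    (hμ : LocallyDominates μ) (hμv : μ ≪ volume) {L : ℝ} (hL : 0 < L)
    (hML : ‖(M : Euc r →L[ℝ] Euc r)‖ ≤ L) :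
    fisherInfo (affineLaw (M : Euc r →L[ℝ] Euc r) κ ν) μ ≤ ENNReal.ofReal (L ^ 2) * fisherInfo ν μ := by
  have hL0 : ENNReal.ofReal (L ^ 2) ≠ 0 := by simpa using hL.ne'
  have hm : Measurable fun x : Euc r × Euc r => M x.1 + x.2 := by fun_prop
  -- The constant goes to the left so that the infima on the right can be introduced; it returns
  -- once a candidate gradient is fixed.
  rw [mul_comm, ← ENNReal.div_le_iff_le_mul (Or.inl hL0) (Or.inl ENNReal.ofReal_ne_top)]
  refine le_iInf fun hac => le_iInf fun g => le_iInf fun hfg => ?_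
  rw [ENNReal.div_le_iff_le_mul (Or.inl hL0) (Or.inl ENNReal.ofReal_ne_top), mul_comm]
  by_cases htop : ∫⁻ x, ‖g x‖ₑ ^ 2 / ν.rnDeriv μ x ∂μ = ∞
  · rw [htop, ENNReal.mul_top hL0]; exact le_top
  obtain ⟨f, hf⟩ : ∃ f : Euc r → ℝ, f = fun x => (ν.rnDeriv μ x).toReal := ⟨_, rfl⟩
  have hfm : Measurable f := by rw [hf]; fun_prop
  have hfi : Integrable f μ := by rw [hf]; exact Measure.integrable_toReal_rnDeriv
  have hf0 (x) : 0 ≤ f x := by rw [hf]; exact ENNReal.toReal_nonneg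
  have hF : (fun x => ENNReal.ofReal (f x)) =ᵐ[μ] ν.rnDeriv μ := by
    filter_upwards [ν.rnDeriv_lt_top μ] with x hx
    rw [hf]
    exact ENNReal.ofReal_toReal hx.ne
  have hFm : Measurable fun x => ENNReal.ofReal (f x) := hfm.ennreal_ofReal
  have hνF : ν = μ.withDensity fun x => ENNReal.ofReal (f x) := by
    have := Measure.haveLebesgueDecomposition_of_sigmaFinite ν μ
    rw [withDensity_congr_ae hF, Measure.withDensity_rnDeriv_eq ν μ hac]
  have hF1 : ∫⁻ x, ENNReal.ofReal (f x) ∂μ = 1 := by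
    rw [← setLIntegral_univ, ← withDensity_apply _ MeasurableSet.univ, ← hνF, measure_univ]
  -- a measurable version of the weak gradient
  have hgs := hfg.2.1.aestronglyMeasurable
  obtain ⟨g', hg'⟩ : ∃ g', g' = hgs.mk g := ⟨_, rfl⟩
  have hg'm : Measurable g' := by rw [hg']; exact hgs.stronglyMeasurable_mk.measurable
  have hgg' : g =ᵐ[volume] g' := by rw [hg']; exact hgs.ae_eq_mk
  have hfg' : HasWeakGradient f g' := by
    rw [hf]; exact hfg.congr_ae (ae_eq_refl _) hgg'
  have hI : ∫⁻ x, ‖g x‖ₑ ^ 2 / ν.rnDeriv μ x ∂μ =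
      ∫⁻ x, ‖g' x‖ₑ ^ 2 / ENNReal.ofReal (f x) ∂μ := by
    refine lintegral_congr_ae ?_
    filter_upwards [hF, hμv.ae_le hgg'] with x h1 h2
    rw [h1, h2]
  rw [hI] at htop ⊢
  -- By Cauchy–Schwarz, (∫ |g'| dμ)² is at most the finite Fisher integral times ∫ f dμ = 1.
  have hgi : Integrable g' μ := by
    refine ⟨hg'm.aestronglyMeasurable, ?_⟩
    have := sq_lintegral_div_le (μ := μ) hg'm.enorm hFm (fun x => ENNReal.ofReal_ne_top)
    rw [hF1, div_one] at this
    rw [hasFiniteIntegral_iff_enorm]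
    by_contra hne
    rw [not_lt, top_le_iff] at hne
    rw [hne] at this
    exact htop (top_le_iff.1 (by simpa using this))
  -- the transported density and gradient
  have hlaw := h.affineLaw_eq_withDensity hFm hνF
  have hPm : Measurable fun x => ∫⁻ z, ENNReal.ofReal (f (M x + z)) ∂κ :=
    Measurable.lintegral_prod_right (by exact hFm.comp hm)
  have hrn : (affineLaw (M : Euc r →L[ℝ] Euc r) κ ν).rnDeriv μ =ᵐ[μ]
      fun x => ∫⁻ z, ENNReal.ofReal (f (M x + z)) ∂κ := by
    rw [hlaw]; exact Measure.rnDeriv_withDensity μ hPm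
  have hac' : affineLaw (M : Euc r →L[ℝ] Euc r) κ ν ≪ μ := by
    rw [hlaw]; exact withDensity_absolutelyContinuous _ _
  have hwg := h.hasWeakGradient hμ hfm hg'm hfi hgi hfg'
  have hwg' := hwg.congr_ae (f' := fun x => ((affineLaw (M : Euc r →L[ℝ] Euc r) κ ν).rnDeriv μ x).toReal)
    (by
      filter_upwards [hμ.absolutelyContinuous.ae_le hrn] with x hx
      rw [hx, integral_eq_lintegral_of_nonneg_ae (ae_of_all _ fun z => hf0 _)
        (hfm.comp (by fun_prop)).aestronglyMeasurable]) (ae_eq_refl _)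
  refine (iInf_le _ hac').trans ((iInf_le _ _).trans ((iInf_le _ hwg').trans ?_))
  have hLM (x : Euc r) : ‖(M : Euc r →L[ℝ] Euc r).adjoint x‖ₑ ≤ ENNReal.ofReal L * ‖x‖ₑ := by
    rw [← ofReal_norm, ← ofReal_norm, ← ENNReal.ofReal_mul hL.le]
    refine ENNReal.ofReal_le_ofReal (((M : Euc r →L[ℝ] Euc r).adjoint.le_opNorm x).trans ?_)
    rw [LinearIsometryEquiv.norm_map]
    gcongr
  have hQm : Measurable fun x => ‖g' x‖ₑ ^ 2 / ENNReal.ofReal (f x) :=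
    (hg'm.enorm.pow_const 2).div hFm
  calc _ = ∫⁻ x, ‖(M : Euc r →L[ℝ] Euc r).adjoint (∫ z, g' (M x + z) ∂κ)‖ₑ ^ 2 /
          ∫⁻ z, ENNReal.ofReal (f (M x + z)) ∂κ ∂μ := by
        refine lintegral_congr_ae ?_
        filter_upwards [hrn] with x hx
        rw [hx]
    _ ≤ ∫⁻ x, ENNReal.ofReal (L ^ 2) *
          ∫⁻ z, ‖g' (M x + z)‖ₑ ^ 2 / ENNReal.ofReal (f (M x + z)) ∂κ ∂μ := by
        refine lintegral_mono fun x => ?_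
        simp only
        have hmx : Measurable fun z => M x + z := by fun_prop
        -- Pointwise in x, |P g'|² / P f ≤ P(|g'|² / f).
        have hcs := sq_lintegral_div_le (μ := κ) (hg'm.comp hmx).enorm (hFm.comp hmx)
          (fun x => ENNReal.ofReal_ne_top)
        simp only [Function.comp_apply] at hcs
        refine le_trans ?_ (mul_le_mul_right hcs _)
        rw [← mul_div_assoc, ENNReal.ofReal_pow hL.le, ← mul_pow]
        gcongr
        exact (hLM _).trans (by gcongr; exact enorm_integral_le_lintegral_enorm _)
    _ = ENNReal.ofReal (L ^ 2) * ∫⁻ x, ‖g' x‖ₑ ^ 2 / ENNReal.ofReal (f x) ∂μ := by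
        rw [lintegral_const_mul _ (Measurable.lintegral_prod_right (by exact hQm.comp hm))]
        congr 1
        exact h.lintegral_invariant hQm

end FisherInformation

end OscHTransform

open Filter Topology

namespace OscHTransform

/-! ### Pathwise variation of constants for a continuous driving path. -/

section LinearEquation

variable {E : Type*} [NormedAddCommGroup E] [NormedSpace ℝ E] [CompleteSpace E]

lemma hasDerivAt_exp_sub_smul (F : E →L[ℝ] E) (t s : ℝ) :
    HasDerivAt (fun s : ℝ => NormedSpace.exp ((t - s) • F))
      (-(NormedSpace.exp ((t - s) • F) * F)) s := by
  have h := (hasDerivAt_exp_smul_const (𝕂 := ℝ) F (t - s)).scomp s ((hasDerivAt_id s).const_sub t)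
  simpa [Function.comp_def] using h

/-- Euler sums for the solution of a linear equation driven by a continuous path `n`. -/
theorem tendsto_sum_exp_smul (F : E →L[ℝ] E) {x n : ℝ → E} (hx : Continuous x)
    (hn : Continuous n) (heq : ∀ s, 0 ≤ s → x s = x 0 + (∫ u in (0 : ℝ)..s, F (x u)) + n s)
    {t : ℝ} (ht : 0 ≤ t) :
    Tendsto (fun N : ℕ => ∑ k ∈ Finset.range (N + 1),
      NormedSpace.exp ((t - (k + 1 : ℕ) * (t / (N + 1))) • F)
        (n ((k + 1 : ℕ) * (t / (N + 1))) - n (k * (t / (N + 1))))) atTop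
      (𝓝 (x t - NormedSpace.exp (t • F) (x 0))) := by
  set U : ℝ → E →L[ℝ] E := fun s => NormedSpace.exp ((t - s) • F) with hU
  have hUd (s : ℝ) : HasDerivAt U (-(U s * F)) s := hasDerivAt_exp_sub_smul F t s
  have hUc : Continuous U := continuous_iff_continuousAt.2 fun s => (hUd s).continuousAt
  obtain ⟨K, hK⟩ := (isCompact_Icc (a := (0 : ℝ)) (b := t)).exists_bound_of_continuousOn
    (f := fun s => U s * F) (hUc.mul continuous_const).continuousOn
  have hK0 : 0 ≤ K := (norm_nonneg _).trans (hK 0 ⟨le_rfl, ht⟩)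
  set y : ℝ → E := fun s => x 0 + ∫ u in (0 : ℝ)..s, F (x u) with hy
  have hyd (s : ℝ) : HasDerivAt y (F (x s)) s :=
    ((F.continuous.comp hx).integral_hasStrictDerivAt 0 s).hasDerivAt.const_add _
  have hyx (s : ℝ) (hs : 0 ≤ s) : x s = y s + n s := heq s hs
  have hun := (isCompact_Icc (a := (0 : ℝ)) (b := t)).uniformContinuousOn_of_continuous
    hn.continuousOn
  rw [Metric.uniformContinuousOn_iff] at hun
  rw [Metric.tendsto_atTop]
  intro ε hε
  -- The total error will be at most K t times this oscillation; the summand 1 keeps the denominator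
  -- positive and the final bound strict.
  obtain ⟨η, hη, hηn⟩ := hun (ε / (K * t + 1)) (by positivity)
  obtain ⟨N₀, hN₀⟩ := exists_nat_gt (t / η)
  refine ⟨N₀, fun N hN => ?_⟩
  set d : ℝ := t / (N + 1) with hd
  have hN1 : (0 : ℝ) < N + 1 := by positivity
  have hd0 : 0 ≤ d := by positivity
  have hNd : (N + 1) * d = t := by rw [hd]; field_simp
  have hdη : d < η := by
    rw [hd, div_lt_iff₀ hN1]
    rw [div_lt_iff₀ hη] at hN₀
    have : (N₀ : ℝ) ≤ N := by exact_mod_cast hN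
    nlinarith
  have htel : ∑ k ∈ Finset.range (N + 1),
      (U ((k + 1 : ℕ) * d) (x ((k + 1 : ℕ) * d)) - U (k * d) (x (k * d))) =
      x t - NormedSpace.exp (t • F) (x 0) := by
    rw [Finset.sum_range_sub (fun k : ℕ => U (k * d) (x (k * d)))]
    have : ((N + 1 : ℕ) : ℝ) * d = t := by push_cast; exact hNd
    rw [this]
    simp [hU]
  -- On one step the noise increment differs from the increment of U x by minus the increment of U(y
  -- + n(a)), whose derivative U F (n(s) - n(a)) is small by uniform continuity. No bounded
  -- variation of n is used.
  have hstep (k : ℕ) (hk : k ∈ Finset.range (N + 1)) :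
      ‖U ((k + 1 : ℕ) * d) (n ((k + 1 : ℕ) * d) - n (k * d)) -
        (U ((k + 1 : ℕ) * d) (x ((k + 1 : ℕ) * d)) - U (k * d) (x (k * d)))‖ ≤
      K * (ε / (K * t + 1)) * d := by
    have hk' : (k : ℝ) + 1 ≤ N + 1 := by exact_mod_cast Finset.mem_range.1 hk
    have ha0 : 0 ≤ (k : ℝ) * d := by positivity
    have hbt : ((k + 1 : ℕ) : ℝ) * d ≤ t := by
      push_cast; rw [← hNd]; gcongr
    have hab : ((k + 1 : ℕ) : ℝ) * d = k * d + d := by push_cast; ring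
    rw [hab] at hbt ⊢
    set a : ℝ := k * d
    -- The extra term involving x - y - n vanishes for s ≥ 0, where the equation holds; keeping it
    -- makes the formula valid for every real s.
    have hder (s : ℝ) : HasDerivAt (fun s => U s (y s + n a)) (U s (F (n s - n a)) +
        U s (F (x s - y s - n s))) s := by
      have h := (hUd s).clm_apply ((hyd s).add_const (n a))
      have e : U s (F (n s - n a)) + U s (F (x s - y s - n s)) =
          (-(U s * F)) (y s + n a) + U s (F (x s)) := by
        change _ = -(U s (F (y s + n a))) + U s (F (x s))
        simp only [map_sub, map_add]
        abel
      rw [e]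
      exact h
    have hmv := norm_image_sub_le_of_norm_deriv_le_segment'
      (f := fun s => U s (y s + n a)) (C := K * (ε / (K * t + 1))) (a := a) (b := a + d)
      (fun s _ => (hder s).hasDerivWithinAt) (fun s hs => ?_) (a + d)
      (right_mem_Icc.2 (by linarith))
    · have e : U (a + d) (n (a + d) - n a) - (U (a + d) (x (a + d)) - U a (x a)) =
          -(U (a + d) (y (a + d) + n a) - U a (y a + n a)) := by
        rw [hyx (a + d) (by linarith), hyx a ha0]
        simp only [map_sub, map_add]
        abel
      rw [e, norm_neg]
      simpa using hmv
    · have hs0 : s ∈ Icc (0 : ℝ) t := ⟨by linarith [hs.1], by linarith [hs.2]⟩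
      have ha' : a ∈ Icc (0 : ℝ) t := ⟨ha0, by linarith⟩
      rw [hyx s hs0.1]
      have : y s + n s - y s - n s = 0 := by abel
      rw [this, map_zero, map_zero, add_zero]
      refine ((U s * F).le_opNorm (n s - n a)).trans ?_
      refine mul_le_mul (hK s hs0) ?_ (norm_nonneg _) hK0
      rw [← dist_eq_norm]
      refine (hηn s hs0 a ha' ?_).le
      rw [Real.dist_eq, abs_of_nonneg (by linarith [hs.1])]
      linarith [hs.2]
  rw [dist_eq_norm, ← htel, ← Finset.sum_sub_distrib]
  refine (norm_sum_le_of_le _ hstep).trans_lt ?_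
  rw [Finset.sum_const, Finset.card_range, nsmul_eq_mul]
  push_cast
  have : (N + 1) * (K * (ε / (K * t + 1)) * d) = ε * (K * t / (K * t + 1)) := by
    rw [← hNd]; ring
  rw [this]
  have : K * t / (K * t + 1) < 1 := by
    rw [div_lt_one (by positivity)]; linarith
  nlinarith

end LinearEquation

end OscHTransform

open Filter Topology

namespace OscHTransform

/-! ### Exponentials on eigenvectors and their Riemann sums. -/

section ExpEigen

variable {E : Type*} [NormedAddCommGroup E] [NormedSpace ℝ E] [CompleteSpace E]

/-- The path s ↦ e^{ls} v solves the undriven equation; with n = 0 all the approximating sums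
vanish, which identifies it with the operator exponential. -/
lemma exp_smul_apply_of_eigen {F : E →L[ℝ] E} {v : E} {l : ℝ} (h : F v = l • v) {t : ℝ}
    (ht : 0 ≤ t) : NormedSpace.exp (t • F) v = Real.exp (l * t) • v := by
  have hd (s : ℝ) : HasDerivAt (fun s : ℝ => Real.exp (l * s) • v)
      (F (Real.exp (l * s) • v)) s := by
    have h1 : HasDerivAt (fun s : ℝ => Real.exp (l * s)) (Real.exp (l * s) * l) s := by
      simpa using ((hasDerivAt_id s).const_mul l).exp
    have := h1.smul_const v
    rwa [mul_smul, ← h, ← map_smul] at this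
  have hc : Continuous fun s : ℝ => Real.exp (l * s) • v :=
    continuous_iff_continuousAt.2 fun s => (hd s).continuousAt
  have key := tendsto_sum_exp_smul F (x := fun s => Real.exp (l * s) • v) (n := fun _ => 0) hc
    continuous_const (fun s _ => ?_) ht
  · simp only [sub_self, map_zero, Finset.sum_const_zero, mul_zero, Real.exp_zero,
      one_smul] at key
    exact (sub_eq_zero.1 (tendsto_nhds_unique key tendsto_const_nhds)).symm
  · rw [intervalIntegral.integral_eq_sub_of_hasDerivAt (fun u _ => hd u)
      ((F.continuous.comp hc).intervalIntegrable _ _)]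
    simp

/-- Riemann sums of `s ↦ e^{-2 l (t - s)}` on `[0, t]`. -/
lemma tendsto_sum_exp_mul {l : ℝ} (hl : 0 < l) {t : ℝ} (ht : 0 ≤ t) :
    Tendsto (fun N : ℕ => ∑ k ∈ Finset.range (N + 1),
      Real.exp (-l * (t - (k + 1 : ℕ) * (t / (N + 1)))) ^ 2 * (t / (N + 1))) atTop
      (𝓝 ((1 - Real.exp (-l * t) ^ 2) / (2 * l))) := by
  -- The Riemann sums are the sums of `tendsto_sum_exp_smul` for the scalar equation x' = -2 l x +
  -- 1, with driving path n(s) = s.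
  set F : ℝ →L[ℝ] ℝ := (-2 * l) • ContinuousLinearMap.id ℝ ℝ with hF
  have hFx (x : ℝ) : F x = (-2 * l) • x := by simp [hF]
  set x : ℝ → ℝ := fun s => (1 - Real.exp (-2 * l * s)) / (2 * l) with hx
  have hd (s : ℝ) : HasDerivAt (fun s => x s - s) (F (x s)) s := by
    have h1 : HasDerivAt (fun s : ℝ => Real.exp (-2 * l * s))
        (Real.exp (-2 * l * s) * (-2 * l)) s := by
      simpa using ((hasDerivAt_id s).const_mul (-2 * l)).exp
    have h2 := ((h1.const_sub 1).div_const (2 * l)).sub (hasDerivAt_id s)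
    have e : F (x s) = -(Real.exp (-2 * l * s) * (-2 * l)) / (2 * l) - 1 := by
      rw [hFx, hx, smul_eq_mul]; field_simp; ring
    rw [e]; exact h2
  have hxc : Continuous x := by rw [hx]; fun_prop
  have key := tendsto_sum_exp_smul F (x := x) (n := fun s => s) hxc continuous_id
    (fun s _ => ?_) ht
  · convert key using 1
    · ext N
      refine Finset.sum_congr rfl fun k hk => ?_
      have hk' : (k : ℝ) + 1 ≤ N + 1 := by exact_mod_cast Finset.mem_range.1 hk
      have hle : ((k + 1 : ℕ) : ℝ) * (t / (N + 1)) ≤ t := by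
        push_cast
        rw [← mul_div_assoc, div_le_iff₀ (by positivity), mul_comm]
        gcongr
      have e := exp_smul_apply_of_eigen
        (hFx (((k + 1 : ℕ) : ℝ) * (t / (N + 1)) - k * (t / (N + 1)))) (sub_nonneg.2 hle)
      rw [e, smul_eq_mul, ← Real.exp_nat_mul]
      congr 1
      · congr 1; push_cast; ring
      · push_cast; ring
    · have h0 : x 0 = 0 := by simp [hx]
      have e : ((2 : ℕ) : ℝ) * (-l * t) = -2 * l * t := by push_cast; ring
      rw [h0, map_zero, sub_zero, hx, ← Real.exp_nat_mul, e]
  · rw [intervalIntegral.integral_eq_sub_of_hasDerivAt (fun u _ => hd u)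
      ((F.continuous.comp hxc).intervalIntegrable _ _)]
    ring

end ExpEigen

/-! ### Characteristic functions of weighted Brownian increments. -/

section Brownian

variable {Ω : Type*} [MeasurableSpace Ω] {P : Measure Ω}

lemma integral_exp_sum_increments {W : ℝ≥0 → Ω → ℝ} (hW : IsPreBrownianReal W P)
    {s : ℕ → ℝ≥0} (hs : Monotone s) (c : ℕ → ℝ) (N : ℕ) :
    ∫ ω, Complex.exp (((∑ k ∈ Finset.range N, c k * (W (s (k + 1)) ω - W (s k) ω) : ℝ) : ℂ) *
        Complex.I) ∂P =
      Complex.exp ((-(∑ k ∈ Finset.range N, c k ^ 2 * ((s (k + 1) : ℝ) - s k)) / 2 : ℝ) : ℂ) := by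
  have hlaw (k : ℕ) := hW.hasLaw_sub (s (k + 1)) (s k)
  have hm (k : ℕ) : AEMeasurable (fun ω => c k * (W (s (k + 1)) ω - W (s k) ω)) P :=
    (hlaw k).aemeasurable.const_mul (c k)
  have hind : iIndepFun (fun k ω => c k * (W (s (k + 1)) ω - W (s k) ω)) P :=
    (hW.hasIndepIncrements.nat hs).comp (fun k x => c k * x) fun k => measurable_const_mul (c k)
  have hind' : iIndepFun ((Finset.range N).restrict
      fun k ω => c k * (W (s (k + 1)) ω - W (s k) ω)) P :=
    iIndepFun.precomp (g := fun i : Finset.range N => (i : ℕ)) Subtype.val_injective hind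
  have hprod := iIndepFun.charFun_map_fun_finsetSum_eq_prod (s := Finset.range N)
    (fun i _ => hm i) hind'
  have h1 := congrFun hprod 1
  rw [charFun_apply, integral_map (Finset.aemeasurable_fun_sum _ fun i _ => hm i)
    (by fun_prop)] at h1
  have hinner (x : ℝ) : inner ℝ x (1 : ℝ) = x := by simp
  simp only [hinner, Finset.prod_apply] at h1
  rw [h1, ← Finset.sum_neg_distrib, Finset.sum_div, Complex.ofReal_sum, Complex.exp_sum]
  refine Finset.prod_congr rfl fun k _ => ?_
  have e : P.map (fun ω => c k * (W (s (k + 1)) ω - W (s k) ω)) =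
      (P.map (W (s (k + 1)) - W (s k))).map fun x => c k • x := by
    rw [AEMeasurable.map_map_of_aemeasurable (by fun_prop) (hlaw k).aemeasurable]
    rfl
  rw [e, (hlaw k).map_eq, charFun_map_smul, charFun_gaussianReal]
  have hle : (s k : ℝ) ≤ s (k + 1) := hs (Nat.le_succ k)
  have hd : dist (s (k + 1)) (s k) = (s (k + 1) : ℝ) - s k := by
    rw [NNReal.dist_eq, abs_of_nonneg (sub_nonneg.2 hle)]
  rw [coe_nndist]
  erw [hd]
  congr 1
  simp
  ring

lemma integral_exp_sum_increments_family {m : ℕ} {W : Fin m → ℝ≥0 → Ω → ℝ}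
    (hW : ∀ j, IsPreBrownianReal (W j) P)
    (hind : iIndepFun (fun (k : Fin m) (ω : Ω) (t : ℝ≥0) => W k t ω) P)
    {s : ℕ → ℝ≥0} (hs : Monotone s) (c : Fin m → ℕ → ℝ) (N : ℕ) :
    ∫ ω, Complex.exp (((∑ j, ∑ k ∈ Finset.range N,
        c j k * (W j (s (k + 1)) ω - W j (s k) ω) : ℝ) : ℂ) * Complex.I) ∂P =
      Complex.exp ((-(∑ j, ∑ k ∈ Finset.range N,
        c j k ^ 2 * ((s (k + 1) : ℝ) - s k)) / 2 : ℝ) : ℂ) := by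
  have hmj (j : Fin m) (u : ℝ≥0) : AEMeasurable (W j u) P := (hW j).aemeasurable u
  have hi := hind.comp (fun j (p : ℝ≥0 → ℝ) => Complex.exp (((∑ k ∈ Finset.range N,
    c j k * (p (s (k + 1)) - p (s k)) : ℝ) : ℂ) * Complex.I)) (fun j => by fun_prop)
  have h := hi.integral_fun_prod_eq_prod_integral (fun j => by
    have : AEMeasurable (fun ω => Complex.exp (((∑ k ∈ Finset.range N,
      c j k * (W j (s (k + 1)) ω - W j (s k) ω) : ℝ) : ℂ) * Complex.I)) P := by fun_prop
    exact this.aestronglyMeasurable)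
  simp only [Function.comp_apply] at h
  simp only [Complex.ofReal_sum (Finset.univ), Finset.sum_mul Finset.univ, Complex.exp_sum]
  rw [h]
  simp only [integral_exp_sum_increments (hW _) hs]
  rw [← Complex.exp_sum, ← Complex.ofReal_sum]
  congr 2
  rw [← Finset.sum_neg_distrib, Finset.sum_div]

end Brownian

end OscHTransform

open Filter Topology

namespace OscHTransform

/-! ### The Gaussian transition law of the diffusion. -/

section Diffusion

variable {Ω : Type*} [MeasurableSpace Ω] {P : Measure Ω}
  {r m : ℕ} {A R Q : Matrix (Fin r) (Fin r) ℝ} {B : Matrix (Fin r) (Fin m) ℝ}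
  {W : Fin m → ℝ≥0 → Ω → ℝ} {X : ℝ≥0 → Ω → EuclideanSpace ℝ (Fin r)}

lemma toLp_mulVec_eq_sum_smul_col (B : Matrix (Fin r) (Fin m) ℝ) (w : Fin m → ℝ) :
    (WithLp.toLp 2 (B *ᵥ w) : Euc r) = ∑ j, w j • WithLp.toLp 2 (B.col j) := by
  ext i
  simp [Matrix.mulVec, dotProduct, mul_comm]

lemma IsHDiffusion.aemeasurable_noise (h : IsHDiffusion A R Q B P W X) (j : Fin m) (u : ℝ≥0) :
    AEMeasurable (W j u) P :=
  (h.brownian j).toIsPreBrownianReal.aemeasurable u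

lemma IsHDiffusion.integral_exp_init_add_sum (h : IsHDiffusion A R Q B P W X)
    {s : ℕ → ℝ≥0} (hs : Monotone s) (η : Euc r) (c : Fin m → ℕ → ℝ) (N : ℕ) :
    ∫ ω, Complex.exp (((inner ℝ (X 0 ω) η + ∑ j, ∑ k ∈ Finset.range N,
        c j k * (W j (s (k + 1)) ω - W j (s k) ω) : ℝ) : ℂ) * Complex.I) ∂P =
      charFun (P.map (X 0)) η * Complex.exp ((-(∑ j, ∑ k ∈ Finset.range N,
        c j k ^ 2 * ((s (k + 1) : ℝ) - s k)) / 2 : ℝ) : ℂ) := by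
  have hmj := h.aemeasurable_noise
  have hm0 := h.aemeasurable 0
  have hi := h.indep_init.comp
    (φ := fun x : Euc r => Complex.exp (((inner ℝ x η : ℝ) : ℂ) * Complex.I))
    (ψ := fun p : Fin m × ℝ≥0 → ℝ => Complex.exp (((∑ j, ∑ k ∈ Finset.range N,
        c j k * (p (j, s (k + 1)) - p (j, s k)) : ℝ) : ℂ) * Complex.I))
    (by fun_prop) (by fun_prop)
  have hp := hi.integral_fun_mul_eq_mul_integral (AEMeasurable.aestronglyMeasurable
      (by exact (by fun_prop : Measurable
        (fun x : Euc r => Complex.exp (((inner ℝ x η : ℝ) : ℂ) * Complex.I))).comp_aemeasurable hm0))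
    (AEMeasurable.aestronglyMeasurable (by
      change AEMeasurable (fun ω => Complex.exp (((∑ j, ∑ k ∈ Finset.range N,
        c j k * (W j (s (k + 1)) ω - W j (s k) ω) : ℝ) : ℂ) * Complex.I)) P
      fun_prop))
  simp only [Function.comp_apply] at hp
  rw [integral_exp_sum_increments_family (fun j => (h.brownian j).toIsPreBrownianReal)
    h.indep_coord hs] at hp
  rw [charFun_apply, integral_map hm0 (by fun_prop), ← hp]
  refine integral_congr_ae (Eventually.of_forall fun ω => ?_)
  simp only
  rw [Complex.ofReal_add, add_mul, Complex.exp_add]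

/-- The characteristic function of the law of `X t`, in terms of eigenvectors `v i` of the drift
which represent the diffusion matrix. -/
theorem IsHDiffusion.charFun_map_eq [IsProbabilityMeasure P] (h : IsHDiffusion A R Q B P W X) {v : Fin r → Euc r}
    {l : Fin r → ℝ} (hl : ∀ i, 0 < l i)
    (hv : ∀ i, Matrix.toEuclideanCLM (n := Fin r) (𝕜 := ℝ) (A - R * Q) (v i) = (-l i) • v i)
    (hB : ∀ a : Euc r, ∑ j, inner ℝ (WithLp.toLp 2 (B.col j) : Euc r) a ^ 2 =
      ∑ i, inner ℝ (v i) a ^ 2) (t : ℝ≥0) (ξ : Euc r) :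
    charFun (P.map (X t)) ξ =
      charFun (P.map (X 0)) ((NormedSpace.exp ((t : ℝ) •
        Matrix.toEuclideanCLM (n := Fin r) (𝕜 := ℝ) (A - R * Q))).adjoint ξ) *
      Complex.exp ((∑ i, -((1 - Real.exp (-l i * t) ^ 2) / (2 * l i) *
        inner ℝ (v i) ξ ^ 2 / 2) : ℝ) : ℂ) := by
  set F : Euc r →L[ℝ] Euc r := Matrix.toEuclideanCLM (n := Fin r) (𝕜 := ℝ) (A - R * Q) with hF
  set b : Fin m → Euc r := fun j => WithLp.toLp 2 (B.col j) with hb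
  set U : ℕ → ℕ → Euc r →L[ℝ] Euc r := fun N k =>
    NormedSpace.exp (((t : ℝ) - (k + 1 : ℕ) * ((t : ℝ) / (N + 1))) • F) with hU
  set s : ℕ → ℕ → ℝ≥0 := fun N k => k * (t / (N + 1)) with hs
  have hsc (N k : ℕ) : (s N k : ℝ) = k * ((t : ℝ) / (N + 1)) := by simp [hs]
  have hsm (N : ℕ) : Monotone (s N) := fun i j hij => by
    simp only [hs]; gcongr
  set η := (NormedSpace.exp ((t : ℝ) • F)).adjoint ξ with hη
  set Z : ℕ → Ω → ℝ := fun N ω => inner ℝ (X 0 ω) η + ∑ j, ∑ k ∈ Finset.range (N + 1),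
    inner ℝ (U N k (b j)) ξ * (W j (s N (k + 1)) ω - W j (s N k) ω) with hZ
  have hmj := h.aemeasurable_noise
  have hm0 := h.aemeasurable 0
  -- Almost surely, the weighted increments together with the initial term converge to the component
  -- of X_t along ξ.
  have hpath : ∀ᵐ ω ∂P, Tendsto (fun N => Z N ω) atTop (𝓝 (inner ℝ (X t ω) ξ)) := by
    filter_upwards [h.continuous, h.equation, ae_all_iff.2 fun j => (h.brownian j).cont]
      with ω hc he hw
    have hn : Continuous fun u : ℝ =>
        (WithLp.toLp 2 (B *ᵥ fun k => W k u.toNNReal ω) : Euc r) := by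
      simp_rw [toLp_mulVec_eq_sum_smul_col]
      refine continuous_finsetSum _ fun j _ => ?_
      have hj : Continuous fun u : ℝ => W j u.toNNReal ω := (hw j).comp continuous_real_toNNReal
      exact hj.smul continuous_const
    have key := tendsto_sum_exp_smul F (x := fun u => X u.toNNReal ω)
      (hc.comp continuous_real_toNNReal) hn (fun u hu => by
        have := he u.toNNReal
        rw [Real.coe_toNNReal u hu] at this
        rwa [← Real.toNNReal_zero] at this) t.coe_nonneg
    have key2 := ((key.inner (tendsto_const_nhds (x := ξ))).const_add (inner ℝ (X 0 ω) η))
    have e : inner ℝ (X 0 ω) η + inner ℝ (X (t : ℝ).toNNReal ω -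
        NormedSpace.exp ((t : ℝ) • F) (X (0 : ℝ).toNNReal ω)) ξ = inner ℝ (X t ω) ξ := by
      rw [hη, ContinuousLinearMap.adjoint_inner_right, inner_sub_left]
      simp
    erw [e] at key2
    refine key2.congr fun N => ?_
    simp only [hZ, sum_inner]
    congr 1
    rw [Finset.sum_comm]
    refine Finset.sum_congr rfl fun k _ => ?_
    rw [toLp_mulVec_eq_sum_smul_col, toLp_mulVec_eq_sum_smul_col, ← Finset.sum_sub_distrib,
      map_sum, sum_inner]
    refine Finset.sum_congr rfl fun j _ => ?_
    rw [← sub_smul, map_smul, real_inner_smul_left, mul_comm, ← hsc, ← hsc, Real.toNNReal_coe,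
      Real.toNNReal_coe, hsc]
  have hint (N : ℕ) := h.integral_exp_init_add_sum (hsm N) η
    (fun j k => inner ℝ (U N k (b j)) ξ) (N + 1)
  have hvar (N : ℕ) : ∑ j, ∑ k ∈ Finset.range (N + 1),
      inner ℝ (U N k (b j)) ξ ^ 2 * ((s N (k + 1) : ℝ) - s N k) =
      ∑ i, (∑ k ∈ Finset.range (N + 1),
        Real.exp (-l i * (t - (k + 1 : ℕ) * ((t : ℝ) / (N + 1)))) ^ 2 * (t / (N + 1))) *
          inner ℝ (v i) ξ ^ 2 := by
    simp only [Finset.sum_mul]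
    rw [Finset.sum_comm, Finset.sum_comm (s := Finset.univ)]
    refine Finset.sum_congr rfl fun k hk => ?_
    rw [← Finset.sum_mul]
    have hk' : (k : ℝ) + 1 ≤ N + 1 := by exact_mod_cast Finset.mem_range.1 hk
    have hle : ((k + 1 : ℕ) : ℝ) * ((t : ℝ) / (N + 1)) ≤ t := by
      push_cast
      rw [← mul_div_assoc, div_le_iff₀ (by positivity), mul_comm]
      gcongr
    -- The columns of B may be replaced by the eigenvectors, because the variance depends only on
    -- the quadratic form of B B'; the flow is then scalar on each vector.
    have e1 : ∑ j, inner ℝ (U N k (b j)) ξ ^ 2 = ∑ i, inner ℝ (U N k (v i)) ξ ^ 2 := by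
      simp only [← ContinuousLinearMap.adjoint_inner_right]
      exact hB _
    rw [e1, Finset.sum_mul]
    refine Finset.sum_congr rfl fun i _ => ?_
    have e2 : U N k (v i) = _ := exp_smul_apply_of_eigen (hv i) (sub_nonneg.2 hle)
    rw [e2, real_inner_smul_left, hsc, hsc]
    push_cast
    ring
  have hlim1 : Tendsto (fun N => ∫ ω, Complex.exp ((Z N ω : ℂ) * Complex.I) ∂P) atTop
      (𝓝 (∫ ω, Complex.exp (((inner ℝ (X t ω) ξ : ℝ) : ℂ) * Complex.I) ∂P)) := by
    refine tendsto_integral_of_dominated_convergence (fun _ => 1) (fun N => ?_)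
      (integrable_const _) (fun N => Eventually.of_forall fun ω => ?_) ?_
    · refine AEMeasurable.aestronglyMeasurable ?_
      have : AEMeasurable (Z N) P := by
        refine AEMeasurable.add ?_ (by fun_prop)
        exact (by fun_prop : Measurable fun x : Euc r => inner ℝ x η).comp_aemeasurable hm0
      fun_prop
    · rw [Complex.norm_exp_ofReal_mul_I]
    · filter_upwards [hpath] with ω hω
      exact ((by fun_prop : Continuous fun x : ℝ =>
        Complex.exp ((x : ℂ) * Complex.I)).tendsto _).comp hω
  have hlim2 : Tendsto (fun N => ∫ ω, Complex.exp ((Z N ω : ℂ) * Complex.I) ∂P) atTop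
      (𝓝 (charFun (P.map (X 0)) η * Complex.exp ((∑ i, -((1 - Real.exp (-l i * t) ^ 2) /
        (2 * l i) * inner ℝ (v i) ξ ^ 2 / 2) : ℝ) : ℂ))) := by
    simp only [hZ, hint, hvar]
    refine Tendsto.const_mul _ ?_
    refine ((by fun_prop : Continuous fun x : ℝ => Complex.exp (x : ℂ)).tendsto _).comp ?_
    have := (tendsto_finsetSum Finset.univ fun i (_ : i ∈ Finset.univ) =>
      (tendsto_sum_exp_mul (hl i) t.coe_nonneg).mul_const (inner ℝ (v i) ξ ^ 2)).neg.div_const 2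
    convert this using 2
    rw [← Finset.sum_neg_distrib, Finset.sum_div]
    exact Finset.sum_congr rfl fun i _ => by ring
  rw [charFun_apply, integral_map (h.aemeasurable t) (by fun_prop)]
  exact tendsto_nhds_unique hlim1 hlim2

end Diffusion

end OscHTransform

open Filter Topology

namespace OscHTransform

/-! ### Positivity of the roots of the normalized Riccati equation. -/

section Riccati

variable {n : Type*} [Fintype n] [DecidableEq n]

section

open scoped MatrixOrder Matrix.Norms.L2Operator

lemma cfcSqrt_posSemidef (M : Matrix n n ℝ) : (CFC.sqrt M).PosSemidef :=
  Matrix.nonneg_iff_posSemidef.1 (CFC.sqrt_nonneg M)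

lemma cfcSqrt_mul_cfcSqrt {M : Matrix n n ℝ} (hM : M.PosSemidef) :
    CFC.sqrt M * CFC.sqrt M = M :=
  CFC.sqrt_mul_sqrt_self M hM.nonneg

lemma exists_posSemidef_mul_self {M : Matrix n n ℝ} (hM : M.PosSemidef) :
    ∃ T : Matrix n n ℝ, T.PosSemidef ∧ T * T = M :=
  ⟨CFC.sqrt M, cfcSqrt_posSemidef M, cfcSqrt_mul_cfcSqrt hM⟩

lemma posSemidef_eq_of_mul_self_eq {T T' : Matrix n n ℝ} (hT : T.PosSemidef) (hT' : T'.PosSemidef)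
    (h : T * T = T' * T') : T = T' := by
  rw [← CFC.sqrt_mul_self T hT.nonneg, ← CFC.sqrt_mul_self T' hT'.nonneg, h]

/-- Duality between controllability and observability: the transposed block matrix has trivial
kernel. Also S w = 0 implies S^{1/2} w = 0, since w·Sw = |S^{1/2} w|². -/
lemma mulVec_eq_zero_of_controllable {r : ℕ} {A S : Matrix (Fin r) (Fin r) ℝ}
    (hS : S.PosSemidef) (h : Controllable Aᵀ (CFC.sqrt S)) {v : Fin r → ℝ}
    (hv : ∀ k : ℕ, S *ᵥ (A ^ k *ᵥ v) = 0) : v = 0 := by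
  set D := CFC.sqrt S with hD
  have hDs : Dᵀ = D := (cfcSqrt_posSemidef S).isHermitian
  have hDv (k : ℕ) : D *ᵥ (A ^ k *ᵥ v) = 0 := by
    rw [← dotProduct_self_eq_zero]
    rw [Matrix.dotProduct_mulVec, ← Matrix.mulVec_transpose, hDs, Matrix.mulVec_mulVec,
      cfcSqrt_mul_cfcSqrt hS, hv k, zero_dotProduct]
  unfold Controllable at h
  rw [← Matrix.rank_transpose] at h
  set K := Matrix.of fun (i : Fin r) (p : Fin r × Fin r) => (Aᵀ ^ (p.1 : ℕ) * D) i p.2 with hK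
  have hker : LinearMap.ker Kᵀ.mulVecLin = ⊥ := by
    have := Kᵀ.mulVecLin.finrank_range_add_finrank_ker
    rw [show Module.finrank ℝ (LinearMap.range Kᵀ.mulVecLin) = r from h,
      Module.finrank_fin_fun] at this
    exact Submodule.finrank_eq_zero.1 (by omega)
  have hKv : Kᵀ.mulVecLin v = 0 := by
    ext p
    have := congrFun (hDv p.1) p.2
    rw [Matrix.mulVec_mulVec] at this
    have e : Kᵀ p = (D * A ^ (p.1 : ℕ)) p.2 := by
      ext i
      have : (Aᵀ ^ (p.1 : ℕ) * D)ᵀ = D * A ^ (p.1 : ℕ) := by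
        rw [Matrix.transpose_mul, hDs, Matrix.transpose_pow, Matrix.transpose_transpose]
      rw [← this]
      rfl
    change Kᵀ p ⬝ᵥ v = 0
    rw [e]
    exact this
  exact (LinearMap.ker_eq_bot'.1 hker) v hKv

end

/-- In normalized coordinates, the stable root of the Riccati equation is positive definite. -/
lemma posDef_of_mul_self_eq {a s q t : Matrix n n ℝ} (ha : aᵀ = a) (hs : s.PosSemidef)
    (hq : q.PosDef) (ht : t = q - a) (h : t * t = a * a + s) : t.PosDef := by
  have hqt : qᵀ = q := hq.isHermitian
  have hth : t.IsHermitian := by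
    change tᵀ = t
    rw [ht, Matrix.transpose_sub, hqt, ha]
  have hlyap : t * q + q * t = q * q + s := by
    have : s = t * t - a * a := by rw [h]; abel
    rw [this, ht]; noncomm_ring
  rw [hth.posDef_iff_eigenvalues_pos]
  intro i
  set v : n → ℝ := ⇑(hth.eigenvectorBasis i) with hv
  have hv0 : v ≠ 0 := by
    intro h0
    apply hth.eigenvectorBasis.orthonormal.ne_zero i
    ext j
    exact congrFun h0 j
  have htv : t *ᵥ v = hth.eigenvalues i • v := hth.mulVec_eigenvectorBasis i
  have hpos : 0 < v ⬝ᵥ (q *ᵥ v) := by simpa using hq.dotProduct_mulVec_pos hv0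
  have hs0 : 0 ≤ v ⬝ᵥ (s *ᵥ v) := by simpa using hs.dotProduct_mulVec_nonneg v
  have hqv : q *ᵥ v ≠ 0 := by
    intro h0
    rw [h0, dotProduct_zero] at hpos
    exact hpos.false
  have hqq : 0 < (q *ᵥ v) ⬝ᵥ (q *ᵥ v) := by
    simpa using Matrix.dotProduct_star_self_pos_iff.2 hqv
  -- At an eigenvector of t with eigenvalue λ, the Lyapunov identity reads 2λ v·qv = |qv|² + v·sv >
  -- 0, so λ > 0.
  have e1 : v ⬝ᵥ ((t * q + q * t) *ᵥ v) = 2 * hth.eigenvalues i * (v ⬝ᵥ (q *ᵥ v)) := by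
    rw [Matrix.add_mulVec, dotProduct_add, ← Matrix.mulVec_mulVec, ← Matrix.mulVec_mulVec,
      Matrix.dotProduct_mulVec v t, ← Matrix.mulVec_transpose, show tᵀ = t from hth, htv,
      Matrix.mulVec_smul, smul_dotProduct, dotProduct_smul, smul_eq_mul]
    ring
  have e2 : v ⬝ᵥ ((q * q + s) *ᵥ v) = (q *ᵥ v) ⬝ᵥ (q *ᵥ v) + v ⬝ᵥ (s *ᵥ v) := by
    rw [Matrix.add_mulVec, dotProduct_add, ← Matrix.mulVec_mulVec,
      Matrix.dotProduct_mulVec v q, ← Matrix.mulVec_transpose, hqt]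
  rw [hlyap, e2] at e1
  by_contra hle
  rw [not_lt] at hle
  nlinarith

/-- In normalized coordinates, the root of the Riccati equation is positive definite. -/
lemma posDef_add_of_mul_self_eq {a s t : Matrix n n ℝ} (ha : aᵀ = a) (hs : s.PosSemidef)
    (hobs : ∀ v : n → ℝ, (∀ k : ℕ, s *ᵥ (a ^ k *ᵥ v) = 0) → v = 0)
    (ht : t.PosSemidef) (h : t * t = a * a + s) : (a + t).PosDef := by
  set q := a + t with hq
  have htt : tᵀ = t := ht.isHermitian
  have hqt : qᵀ = q := by rw [hq, Matrix.transpose_add, htt, ha]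
  have hqh : q.IsHermitian := hqt
  have hlyap : t * q + q * t = q * q + s := by
    have : s = t * t - a * a := by rw [h]; abel
    rw [this, hq]; noncomm_ring
  have e2 (v : n → ℝ) : v ⬝ᵥ ((q * q + s) *ᵥ v) = (q *ᵥ v) ⬝ᵥ (q *ᵥ v) + v ⬝ᵥ (s *ᵥ v) := by
    rw [Matrix.add_mulVec, dotProduct_add, ← Matrix.mulVec_mulVec,
      Matrix.dotProduct_mulVec v q, ← Matrix.mulVec_transpose, hqt]
  have e1 (v : n → ℝ) : v ⬝ᵥ ((t * q + q * t) *ᵥ v) = 2 * ((q *ᵥ v) ⬝ᵥ (t *ᵥ v)) := by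
    rw [Matrix.add_mulVec, dotProduct_add, ← Matrix.mulVec_mulVec, ← Matrix.mulVec_mulVec,
      Matrix.dotProduct_mulVec v t, ← Matrix.mulVec_transpose, htt,
      Matrix.dotProduct_mulVec v q, ← Matrix.mulVec_transpose, hqt, dotProduct_comm (t *ᵥ v)]
    ring
  have hpsd : q.PosSemidef := by
    rw [hqh.posSemidef_iff_eigenvalues_nonneg]
    intro i
    set v : n → ℝ := ⇑(hqh.eigenvectorBasis i) with hv
    have hv0 : v ≠ 0 := by
      intro h0
      apply hqh.eigenvectorBasis.orthonormal.ne_zero i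
      ext j
      exact congrFun h0 j
    have hqv : q *ᵥ v = hqh.eigenvalues i • v := hqh.mulVec_eigenvectorBasis i
    have ht0 : 0 ≤ v ⬝ᵥ (t *ᵥ v) := by simpa using ht.dotProduct_mulVec_nonneg v
    have hs0 : 0 ≤ v ⬝ᵥ (s *ᵥ v) := by simpa using hs.dotProduct_mulVec_nonneg v
    have hvv : 0 < v ⬝ᵥ v := by simpa using Matrix.dotProduct_star_self_pos_iff.2 hv0
    -- At an eigenvector of q with eigenvalue λ, 2λ v·tv = λ²|v|² + v·sv; λ < 0 would make the left
    -- side nonpositive and the right side positive.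
    have key := e1 v
    rw [hlyap, e2, hqv, smul_dotProduct, smul_dotProduct, dotProduct_smul, smul_eq_mul,
      smul_eq_mul, smul_eq_mul] at key
    by_contra hneg
    have hneg' : hqh.eigenvalues i < 0 := not_le.1 hneg
    have := mul_pos (mul_pos_of_neg_of_neg hneg' hneg') hvv
    nlinarith
  rw [hpsd.posDef_iff_isUnit, ← Matrix.mulVec_injective_iff_isUnit]
  refine (injective_iff_map_eq_zero (Matrix.mulVecLin q)).2 fun v hv => ?_
  change q *ᵥ v = 0 at hv
  -- The kernel of q is annihilated by s and stable under a, because t w = -a w there; observability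
  -- then makes it trivial.
  have hker (w : n → ℝ) (hw : q *ᵥ w = 0) : s *ᵥ w = 0 ∧ q *ᵥ (a *ᵥ w) = 0 := by
    have key := e1 w
    rw [hlyap, e2, hw, zero_dotProduct, zero_dotProduct, mul_zero, zero_add] at key
    have hsw : s *ᵥ w = 0 := (hs.dotProduct_mulVec_zero_iff w).1 (by simpa using key)
    refine ⟨hsw, ?_⟩
    have h2 := congrArg (fun M : Matrix n n ℝ => M *ᵥ w) hlyap
    simp only [Matrix.add_mulVec, ← Matrix.mulVec_mulVec, hw, hsw, Matrix.mulVec_zero,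
      zero_add, add_zero] at h2
    have h3 : t *ᵥ w = -(a *ᵥ w) := by
      rw [hq, Matrix.add_mulVec] at hw
      exact eq_neg_of_add_eq_zero_right hw
    rw [h3, Matrix.mulVec_neg, neg_eq_zero] at h2
    exact h2
  have hpow (k : ℕ) : q *ᵥ (a ^ k *ᵥ v) = 0 := by
    induction k with
    | zero => simpa using hv
    | succ k ih =>
      rw [pow_succ', ← Matrix.mulVec_mulVec]
      exact (hker _ ih).2
  exact hobs v fun k => (hker _ (hpow k)).1

end Riccati

/-! ### Solution of the Riccati equation and diagonalization of the drift. -/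

section Reversible

variable {r : ℕ} {A R S Q C : Matrix (Fin r) (Fin r) ℝ}

lemma exists_posDef_mul_self (hR : R.PosDef) :
    ∃ C : Matrix (Fin r) (Fin r) ℝ, C.PosDef ∧ C * C = R := by
  obtain ⟨C, hC, hCR⟩ := exists_posSemidef_mul_self hR.posSemidef
  refine ⟨C, hC.posDef_iff_isUnit.2 ?_, hCR⟩
  have := hR.isUnit
  rw [← hCR, Matrix.isUnit_iff_isUnit_det, Matrix.det_mul] at this
  exact (Matrix.isUnit_iff_isUnit_det _).2 (isUnit_of_mul_isUnit_left this)

lemma posDef_inv_mul_cancel (hC : C.PosDef) : C⁻¹ * C = 1 :=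
  Matrix.nonsing_inv_mul _ ((Matrix.isUnit_iff_isUnit_det _).1 hC.isUnit)

lemma posDef_mul_inv_cancel (hC : C.PosDef) : C * C⁻¹ = 1 :=
  Matrix.mul_nonsing_inv _ ((Matrix.isUnit_iff_isUnit_det _).1 hC.isUnit)

lemma mul_conj_eq (hC : C.PosDef) (A : Matrix (Fin r) (Fin r) ℝ) :
    C * (C⁻¹ * A * C) = A * C := by
  rw [← mul_assoc, ← mul_assoc, posDef_mul_inv_cancel hC, one_mul]

/-- Reversibility with R = C² is precisely the symmetry of A conjugated by C. -/
lemma transpose_conj_eq (hC : C.PosDef) (hrev : A * (C * C) = C * C * Aᵀ) :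
    (C⁻¹ * A * C)ᵀ = C⁻¹ * A * C := by
  have hCt : Cᵀ = C := hC.isHermitian
  have h1 := posDef_inv_mul_cancel hC
  have h2 := posDef_mul_inv_cancel hC
  rw [Matrix.transpose_mul, Matrix.transpose_mul, Matrix.transpose_nonsing_inv, hCt]
  calc C * (Aᵀ * C⁻¹) = C⁻¹ * (C * C * Aᵀ) * C⁻¹ := by
        simp only [← mul_assoc, h1, one_mul]
    _ = C⁻¹ * A * C := by
        rw [← hrev]; simp only [mul_assoc, h2, mul_one]

lemma mul_transpose_eq_conj_mul (hC : C.PosDef) (hrev : A * (C * C) = C * C * Aᵀ) :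
    C * Aᵀ = C⁻¹ * A * C * C := by
  rw [mul_assoc, mul_assoc, hrev, ← mul_assoc, ← mul_assoc, posDef_inv_mul_cancel hC, one_mul]

/-- The Riccati equation in normalized coordinates. -/
lemma riccati_iff_mul_self_eq (hC : C.PosDef) (hrev : A * (C * C) = C * C * Aᵀ)
    (Q : Matrix (Fin r) (Fin r) ℝ) :
    Aᵀ * Q + Q * A - Q * (C * C) * Q + S = 0 ↔
      (C * Q * C - C⁻¹ * A * C) * (C * Q * C - C⁻¹ * A * C) =
        C⁻¹ * A * C * (C⁻¹ * A * C) + C * S * C := by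
  have h1 := posDef_inv_mul_cancel hC
  have h2 := posDef_mul_inv_cancel hC
  have hl := mul_transpose_eq_conj_mul hC hrev
  have hr := mul_conj_eq hC A
  set a := C⁻¹ * A * C with ha
  have e : C * (Aᵀ * Q + Q * A - Q * (C * C) * Q + S) * C =
      a * a + C * S * C - (C * Q * C - a) * (C * Q * C - a) := by
    calc C * (Aᵀ * Q + Q * A - Q * (C * C) * Q + S) * C
        = (C * Aᵀ) * Q * C + C * Q * (A * C) - C * Q * (C * C) * Q * C + C * S * C := by
          noncomm_ring
      _ = _ := by rw [hl, ← hr]; noncomm_ring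
  constructor
  · intro h
    rw [h, mul_zero, zero_mul] at e
    exact (sub_eq_zero.1 e.symm).symm
  · intro h
    rw [h, sub_self] at e
    calc Aᵀ * Q + Q * A - Q * (C * C) * Q + S
        = (C⁻¹ * C) * (Aᵀ * Q + Q * A - Q * (C * C) * Q + S) * (C * C⁻¹) := by
          rw [h1, h2, one_mul, mul_one]
      _ = C⁻¹ * (C * (Aᵀ * Q + Q * A - Q * (C * C) * Q + S) * C) * C⁻¹ := by
          simp only [mul_assoc]
      _ = 0 := by rw [e, mul_zero, zero_mul]

lemma posDef_conj_self (hC : C.PosDef) (hQ : Q.PosDef) : (C * Q * C).PosDef := by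
  have hCt : Cᴴ = C := hC.isHermitian
  have := (Matrix.IsUnit.posDef_star_right_conjugate_iff (x := Q) hC.isUnit).2 hQ
  rwa [Matrix.star_eq_conjTranspose, hCt] at this

lemma IsPosRiccatiSol.posDef_normalized (hC : C.PosDef) (hrev : A * (C * C) = C * C * Aᵀ)
    (hS : S.PosSemidef) (hQ : IsPosRiccatiSol A (C * C) S Q) :
    (C * Q * C - C⁻¹ * A * C).PosDef := by
  have hCt : Cᴴ = C := hC.isHermitian
  have hSC := hS.conjTranspose_mul_mul_same C
  rw [hCt] at hSC
  exact posDef_of_mul_self_eq (transpose_conj_eq hC hrev) hSC (posDef_conj_self hC hQ.1) rfl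
    ((riccati_iff_mul_self_eq hC hrev Q).1 hQ.2)

theorem existsUnique_isPosRiccatiSol (hS : S.PosSemidef) (hR : R.PosDef)
    (hrank : RankCondition A R S) (hrev : A * R = R * Aᵀ) : ∃! Q, IsPosRiccatiSol A R S Q := by
  obtain ⟨C, hC, rfl⟩ := exists_posDef_mul_self hR
  have hCt : Cᴴ = C := hC.isHermitian
  have h1 := posDef_inv_mul_cancel hC
  have h2 := posDef_mul_inv_cancel hC
  have hSC := hS.conjTranspose_mul_mul_same C
  rw [hCt] at hSC
  have hat := transpose_conj_eq hC hrev
  refine existsUnique_of_exists_of_unique ?_ fun Q Q' hQ hQ' => ?_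
  · set a := C⁻¹ * A * C with ha
    have hM : (a * a + C * S * C).PosSemidef := by
      refine Matrix.PosSemidef.add ?_ hSC
      have := Matrix.posSemidef_conjTranspose_mul_self a
      rwa [show aᴴ = a from hat] at this
    obtain ⟨t, ht, htt⟩ := exists_posSemidef_mul_self hM
    have hq : (a + t).PosDef := by
      refine posDef_add_of_mul_self_eq hat hSC (fun v hv => ?_) ht htt
      -- Conjugation transports observability from (A, S) to the normalized pair (a, CSC).
      have hpow (k : ℕ) : C * a ^ k = A ^ k * C := by
        induction k with
        | zero => simp
        | succ k ih => rw [pow_succ, ← mul_assoc, ih, mul_assoc, mul_conj_eq hC, pow_succ, mul_assoc]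
      have h0 : C *ᵥ v = 0 := mulVec_eq_zero_of_controllable hS hrank.2 fun k => by
        have := congrArg (fun w => C⁻¹ *ᵥ w) (hv k)
        simp only [Matrix.mulVec_mulVec, Matrix.mulVec_zero] at this
        rw [Matrix.mulVec_mulVec, Matrix.mulVec_mulVec, ← this]
        congr 1
        rw [mul_assoc S, ← hpow]
        simp only [← mul_assoc, h1, one_mul]
      have := congrArg (fun w => C⁻¹ *ᵥ w) h0
      simpa [Matrix.mulVec_mulVec, h1] using this
    have hcc : C * (C⁻¹ * (a + t) * C⁻¹) * C = a + t := by
      simp only [mul_assoc, h1, mul_one]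
      rw [← mul_assoc, h2, one_mul]
    refine ⟨C⁻¹ * (a + t) * C⁻¹, posDef_conj_self hC.inv hq, ?_⟩
    rw [riccati_iff_mul_self_eq hC hrev, hcc, add_sub_cancel_left]
    exact htt
  · have hp := hQ.posDef_normalized hC hrev hS
    have hp' := hQ'.posDef_normalized hC hrev hS
    have := posSemidef_eq_of_mul_self_eq hp.posSemidef hp'.posSemidef
      (((riccati_iff_mul_self_eq hC hrev Q).1 hQ.2).trans
        ((riccati_iff_mul_self_eq hC hrev Q').1 hQ'.2).symm)
    have e (Q : Matrix (Fin r) (Fin r) ℝ) : Q = C⁻¹ * (C * Q * C) * C⁻¹ := by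
      simp only [mul_assoc, h2, mul_one]
      rw [← mul_assoc, h1, one_mul]
    rw [e Q, e Q', sub_left_inj.1 this]

/-- The columns of `V` are a basis of eigenvectors of the drift `A - R Q`, with the negative
eigenvalues `-l i`, and `V` represents the diffusion matrix `R`. -/
structure IsDriftDiagonalization (A R Q V : Matrix (Fin r) (Fin r) ℝ) (l : Fin r → ℝ) : Prop where
  pos : ∀ i, 0 < l i
  isUnit : IsUnit V
  mul_transpose : V * Vᵀ = R
  mul_eq : (A - R * Q) * V = V * Matrix.diagonal fun i => -l i

/-- In the reversible case, the closed-loop drift is diagonalizable, with negative eigenvalues,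
in a basis which represents the diffusion matrix. -/
theorem IsPosRiccatiSol.exists_diagonalization (hS : S.PosSemidef) (hR : R.PosDef)
    (hrev : A * R = R * Aᵀ) (hQ : IsPosRiccatiSol A R S Q) :
    ∃ (V : Matrix (Fin r) (Fin r) ℝ) (l : Fin r → ℝ), IsDriftDiagonalization A R Q V l := by
  obtain ⟨C, hC, rfl⟩ := exists_posDef_mul_self hR
  have hCt : Cᵀ = C := hC.isHermitian
  have hT := hQ.posDef_normalized hC hrev hS
  have hTC : C * (C * Q * C - C⁻¹ * A * C) = -((A - C * C * Q) * C) := by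
    rw [mul_sub, mul_conj_eq hC]; noncomm_ring
  set T := C * Q * C - C⁻¹ * A * C with hTdef
  set U : Matrix (Fin r) (Fin r) ℝ := hT.isHermitian.eigenvectorUnitary.1 with hU
  have hUU : U * Uᵀ = 1 := Unitary.coe_mul_star_self hT.isHermitian.eigenvectorUnitary
  have hUU' : Uᵀ * U = 1 := Unitary.coe_star_mul_self hT.isHermitian.eigenvectorUnitary
  have hTU : T * U = U * Matrix.diagonal hT.isHermitian.eigenvalues := by
    have := hT.isHermitian.spectral_theorem
    rw [Unitary.conjStarAlgAut_apply] at this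
    change T = U * Matrix.diagonal hT.isHermitian.eigenvalues * Uᵀ at this
    conv_lhs => rw [this]
    rw [mul_assoc, hUU', mul_one]
  refine ⟨C * U, hT.isHermitian.eigenvalues, hT.eigenvalues_pos,
    hC.isUnit.mul (IsUnit.of_mul_eq_one _ hUU), ?_, ?_⟩
  · rw [Matrix.transpose_mul, hCt, mul_assoc, ← mul_assoc U, hUU, one_mul]
  · have : (A - C * C * Q) * C = -(C * T) := by rw [hTC, neg_neg]
    rw [← mul_assoc, this, neg_mul, mul_assoc, hTU, mul_assoc, ← mul_neg, ← mul_neg,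
      ← Matrix.diagonal_neg]

end Reversible

end OscHTransform

open Filter Topology

/-! ### Spectral bounds for the flow and the limiting covariance. -/

namespace OscHTransform

lemma sum_sq_inner_col {r m : ℕ} (B : Matrix (Fin r) (Fin m) ℝ) (a : Euc r) :
    ∑ j, inner ℝ (WithLp.toLp 2 (B.col j) : Euc r) a ^ 2 =
      WithLp.ofLp a ⬝ᵥ (B * Bᵀ) *ᵥ WithLp.ofLp a := by
  rw [← Matrix.mulVec_mulVec, Matrix.dotProduct_mulVec, ← Matrix.mulVec_transpose, dotProduct]
  refine Finset.sum_congr rfl fun j _ => ?_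
  rw [sq, EuclideanSpace.inner_eq_star_dotProduct]
  simp [Matrix.mulVec, dotProduct_comm]
  rfl

namespace IsDriftDiagonalization

variable {r : ℕ} {A R Q V : Matrix (Fin r) (Fin r) ℝ} {l : Fin r → ℝ}
  (h : IsDriftDiagonalization A R Q V l)
include h

lemma mul_inv_self : V * V⁻¹ = 1 :=
  Matrix.mul_nonsing_inv _ ((Matrix.isUnit_iff_isUnit_det _).1 h.isUnit)

lemma inv_mul_self : V⁻¹ * V = 1 :=
  Matrix.nonsing_inv_mul _ ((Matrix.isUnit_iff_isUnit_det _).1 h.isUnit)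

lemma expDrift_eq (s : ℝ) : expDrift A R Q s =
    V * Matrix.diagonal (fun i => Real.exp (-l i * s)) * V⁻¹ := by
  have e : s • (A - R * Q) = V * Matrix.diagonal (fun i => -l i * s) * V⁻¹ := by
    have h1 : A - R * Q = V * Matrix.diagonal (fun i => -l i) * V⁻¹ := by
      rw [← h.mul_eq, mul_assoc, h.mul_inv_self, mul_one]
    rw [h1, ← Matrix.smul_mul, ← Matrix.mul_smul, ← Matrix.diagonal_smul]
    congr 3
    ext i
    simp [mul_comm]
  rw [expDrift, e, Matrix.exp_conj _ _ h.isUnit, Matrix.exp_diagonal]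
  congr 3
  ext i
  rw [Pi.coe_exp, Real.exp_eq_exp_ℝ]

lemma expDrift_mulVec_col (s : ℝ) (i : Fin r) :
    expDrift A R Q s *ᵥ V.col i = Real.exp (-l i * s) • V.col i := by
  rw [h.expDrift_eq s, ← Matrix.mulVec_single_one, Matrix.mulVec_mulVec, mul_assoc, mul_assoc,
    h.inv_mul_self, mul_one, ← Matrix.mulVec_mulVec, Matrix.diagonal_mulVec_single,
    ← Matrix.mulVec_smul]
  congr 1
  ext j
  by_cases hj : j = i <;> simp [hj]

lemma toEuclideanCLM_expDrift_col (s : ℝ) (i : Fin r) :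
    Matrix.toEuclideanCLM (n := Fin r) (𝕜 := ℝ) (expDrift A R Q s) (WithLp.toLp 2 (V.col i)) =
      Real.exp (-l i * s) • (WithLp.toLp 2 (V.col i) : Euc r) := by
  rw [Matrix.toEuclideanCLM_toLp, h.expDrift_mulVec_col]
  rfl

lemma toEuclideanCLM_drift_col (i : Fin r) :
    Matrix.toEuclideanCLM (n := Fin r) (𝕜 := ℝ) (A - R * Q) (WithLp.toLp 2 (V.col i)) =
      (-l i) • (WithLp.toLp 2 (V.col i) : Euc r) := by
  rw [Matrix.toEuclideanCLM_toLp, ← Matrix.mulVec_single_one, Matrix.mulVec_mulVec, h.mul_eq,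
    ← Matrix.mulVec_mulVec, Matrix.diagonal_mulVec_single, ← WithLp.toLp_smul,
    ← Matrix.mulVec_smul]
  congr 2
  ext j
  by_cases hj : j = i <;> simp [hj]

lemma linearIndependent_col : LinearIndependent ℝ fun i => (WithLp.toLp 2 (V.col i) : Euc r) := by
  have h1 : LinearIndependent ℝ V.col := Matrix.linearIndependent_cols_iff_isUnit.2 h.isUnit
  exact h1.map' (WithLp.linearEquiv 2 ℝ (Fin r → ℝ)).symm.toLinearMap (LinearEquiv.ker _)

/-- The matrix and operator exponentials act alike on the columns of V, which span the space. -/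
lemma toEuclideanCLM_expDrift (s : ℝ) (hs : 0 ≤ s) :
    Matrix.toEuclideanCLM (n := Fin r) (𝕜 := ℝ) (expDrift A R Q s) =
      NormedSpace.exp (s • Matrix.toEuclideanCLM (n := Fin r) (𝕜 := ℝ) (A - R * Q)) := by
  have hsp := h.linearIndependent_col.span_eq_top_of_card_eq_finrank' (by simp)
  refine ContinuousLinearMap.coe_injective (LinearMap.ext_on_range hsp fun i => ?_)
  change Matrix.toEuclideanCLM (n := Fin r) (𝕜 := ℝ) (expDrift A R Q s) _ =
    NormedSpace.exp (s • Matrix.toEuclideanCLM (n := Fin r) (𝕜 := ℝ) (A - R * Q)) _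
  rw [h.toEuclideanCLM_expDrift_col, exp_smul_apply_of_eigen (h.toEuclideanCLM_drift_col i) hs]

lemma exp_le_specNorm (i : Fin r) (s : ℝ) :
    Real.exp (-l i * s) ≤ specNorm (expDrift A R Q s) := by
  have h0 : 0 < ‖(WithLp.toLp 2 (V.col i) : Euc r)‖ :=
    norm_pos_iff.2 (h.linearIndependent_col.ne_zero i)
  have := (Matrix.toEuclideanCLM (n := Fin r) (𝕜 := ℝ) (expDrift A R Q s)).le_opNorm
    (WithLp.toLp 2 (V.col i))
  rw [h.toEuclideanCLM_expDrift_col, norm_smul, Real.norm_eq_abs, Real.abs_exp] at this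
  exact le_of_mul_le_mul_right this h0

section

open scoped Matrix.Norms.L2Operator

lemma exists_specNorm_le : ∃ α β : ℝ, 0 < α ∧ 0 < β ∧
    ∀ s : ℝ, 0 ≤ s → specNorm (expDrift A R Q s) ≤ α * Real.exp (-β * s) := by
  obtain ⟨β, hβ, hβl⟩ : ∃ β : ℝ, 0 < β ∧ ∀ i, β ≤ l i := by
    cases isEmpty_or_nonempty (Fin r) with
    | inl _ => exact ⟨1, one_pos, fun i => isEmptyElim i⟩
    | inr _ =>
      obtain ⟨i, hi⟩ := Finite.exists_min l
      exact ⟨l i, h.pos i, hi⟩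
  -- The condition number of the eigenbasis times the slowest rate; the summand 1 keeps α positive
  -- when r = 0.
  refine ⟨‖V‖ * ‖V⁻¹‖ + 1, β, by positivity, hβ, fun s hs => ?_⟩
  change ‖expDrift A R Q s‖ ≤ _
  have hd : ‖(Matrix.diagonal fun i => Real.exp (-l i * s) : Matrix (Fin r) (Fin r) ℝ)‖ ≤
      Real.exp (-β * s) := by
    rw [Matrix.l2_opNorm_diagonal, pi_norm_le_iff_of_nonneg (Real.exp_nonneg _)]
    intro i
    rw [Real.norm_eq_abs, Real.abs_exp, Real.exp_le_exp]
    nlinarith [hβl i]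
  rw [h.expDrift_eq]
  calc _ ≤ ‖V‖ * Real.exp (-β * s) * ‖V⁻¹‖ := by
        refine (norm_mul_le _ _).trans (mul_le_mul_of_nonneg_right ?_ (norm_nonneg _))
        exact (norm_mul_le _ _).trans (mul_le_mul_of_nonneg_left hd (norm_nonneg _))
    _ ≤ (‖V‖ * ‖V⁻¹‖ + 1) * Real.exp (-β * s) := by
        nlinarith [Real.exp_nonneg (-β * s)]

lemma continuous_specNorm_expDrift : Continuous fun s => specNorm (expDrift A R Q s) := by
  change Continuous fun s => ‖expDrift A R Q s‖
  have : Continuous fun s => expDrift A R Q s := by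
    simp only [h.expDrift_eq]
    refine (continuous_const.matrix_mul (Continuous.matrix_diagonal ?_)).matrix_mul
      continuous_const
    fun_prop
  exact this.norm

end

lemma integrableOn_specNorm_sq :
    IntegrableOn (fun s : ℝ => specNorm (expDrift A R Q s) ^ 2) (Ioi 0) := by
  obtain ⟨α, β, hα, hβ, hle⟩ := h.exists_specNorm_le
  have hg : IntegrableOn (fun s : ℝ => α ^ 2 * Real.exp (-(2 * β) * s)) (Ioi 0) :=
    (exp_neg_integrableOn_Ioi 0 (by positivity : 0 < 2 * β)).const_mul _
  refine Integrable.mono' hg (h.continuous_specNorm_expDrift.pow 2).aestronglyMeasurable ?_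
  filter_upwards [ae_restrict_mem measurableSet_Ioi] with s hs
  have h0 : 0 ≤ specNorm (expDrift A R Q s) := norm_nonneg _
  rw [Real.norm_eq_abs, abs_of_nonneg (by positivity)]
  refine (pow_le_pow_left₀ h0 (hle s (le_of_lt hs)) 2).trans_eq ?_
  rw [mul_pow, ← Real.exp_nat_mul]
  congr 2
  push_cast
  ring

lemma integral_exp_sq (i : Fin r) :
    ∫ s in Ioi (0 : ℝ), Real.exp (-l i * s) ^ 2 = 1 / (2 * l i) := by
  have hl := h.pos i
  have e : (fun s : ℝ => Real.exp (-l i * s) ^ 2) = fun s => Real.exp ((-(2 * l i)) * s) := by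
    ext s
    rw [← Real.exp_nat_mul]
    congr 1
    push_cast
    ring
  rw [e, integral_exp_mul_Ioi (by linarith)]
  simp

lemma integrableOn_exp_sq (i : Fin r) :
    IntegrableOn (fun s : ℝ => Real.exp (-l i * s) ^ 2) (Ioi 0) := by
  have hl := h.pos i
  have e : (fun s : ℝ => Real.exp (-l i * s) ^ 2) = fun s => Real.exp ((-(2 * l i)) * s) := by
    ext s
    rw [← Real.exp_nat_mul]
    congr 1
    push_cast
    ring
  rw [e]
  exact integrableOn_exp_mul_Ioi (by linarith) 0

lemma one_div_le_iotaH (i : Fin r) : 1 / (2 * l i) ≤ iotaH A R Q := by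
  rw [← h.integral_exp_sq i]
  refine setIntegral_mono (h.integrableOn_exp_sq i) h.integrableOn_specNorm_sq fun s => ?_
  exact pow_le_pow_left₀ (Real.exp_nonneg _) (h.exp_le_specNorm i s) 2

/-- Each eigenvalue e^{-l_i s} is at most the spectral norm, so ι_h ≥ 1/(2 l_i); this converts
spectral decay into the rate 1/ι_h. -/
lemma exp_sq_le (i : Fin r) {t : ℝ} (ht : 0 ≤ t) :
    Real.exp (-l i * t) ^ 2 ≤ Real.exp (-t / iotaH A R Q) := by
  have hl := h.pos i
  have hi := h.one_div_le_iotaH i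
  have hpos : 0 < iotaH A R Q := lt_of_lt_of_le (by positivity) hi
  rw [← Real.exp_nat_mul, Real.exp_le_exp, neg_div]
  have : t / iotaH A R Q ≤ t * (2 * l i) := by
    rw [div_le_iff₀ hpos]
    rw [div_le_iff₀ (by positivity)] at hi
    nlinarith
  push_cast
  linarith

/-- A square root of the limiting covariance. -/
lemma covLimit_eq : covLimit A R Q =
    (V * Matrix.diagonal fun i => (√(2 * l i))⁻¹) *
      (V * Matrix.diagonal fun i => (√(2 * l i))⁻¹)ᵀ := by
  have hconj (s : ℝ) : expDrift A R Q s * R * (expDrift A R Q s)ᵀ =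
      V * Matrix.diagonal (fun i => Real.exp (-l i * s) ^ 2) * Vᵀ := by
    -- In the eigenbasis the diffusion matrix is the identity, so the integrand is diagonal.
    have h1 : V⁻¹ * R * (V⁻¹)ᵀ = 1 := by
      rw [← h.mul_transpose, ← mul_assoc, h.inv_mul_self, one_mul, ← Matrix.transpose_mul,
        h.inv_mul_self, Matrix.transpose_one]
    rw [h.expDrift_eq, Matrix.transpose_mul, Matrix.transpose_mul, Matrix.diagonal_transpose]
    calc _ = V * Matrix.diagonal (fun i => Real.exp (-l i * s)) * (V⁻¹ * R * (V⁻¹)ᵀ) *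
          (Matrix.diagonal (fun i => Real.exp (-l i * s)) * Vᵀ) := by simp only [mul_assoc]
      _ = V * (Matrix.diagonal (fun i => Real.exp (-l i * s)) *
          Matrix.diagonal (fun i => Real.exp (-l i * s))) * Vᵀ := by
        rw [h1, mul_one]; simp only [mul_assoc]
      _ = _ := by rw [Matrix.diagonal_mul_diagonal]; simp only [sq]
  have hentry (d : Fin r → ℝ) (i j : Fin r) :
      (V * Matrix.diagonal d * Vᵀ) i j = ∑ k, V i k * V j k * d k := by
    rw [Matrix.mul_apply]
    refine Finset.sum_congr rfl fun k _ => ?_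
    rw [Matrix.mul_diagonal, Matrix.transpose_apply]
    ring
  ext i j
  rw [Matrix.transpose_mul, Matrix.diagonal_transpose, mul_assoc, ← mul_assoc (Matrix.diagonal _),
    Matrix.diagonal_mul_diagonal, ← mul_assoc, hentry]
  simp only [covLimit, Matrix.of_apply, hconj, hentry]
  rw [integral_finsetSum _ fun k _ => (h.integrableOn_exp_sq k).const_mul _]
  refine Finset.sum_congr rfl fun k _ => ?_
  have hl := h.pos k
  rw [integral_const_mul, h.integral_exp_sq, ← mul_inv, Real.mul_self_sqrt (by positivity),
    one_div]

lemma posSemidef_covLimit : (covLimit A R Q).PosSemidef := by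
  rw [h.covLimit_eq]
  exact Matrix.posSemidef_self_mul_conjTranspose _

end IsDriftDiagonalization

end OscHTransform

open Filter Topology

/-! ### The limiting law and the transition kernel of the diffusion. -/

namespace OscHTransform

instance isProbabilityMeasure_etaInf {r : ℕ} (A R Q : Matrix (Fin r) (Fin r) ℝ) :
    IsProbabilityMeasure (etaInf A R Q) := by
  unfold etaInf; infer_instance

namespace IsDriftDiagonalization

variable {r : ℕ} {A R Q V : Matrix (Fin r) (Fin r) ℝ} {l : Fin r → ℝ}

/-- The eigenbasis of the drift which represents the limiting covariance. -/
noncomputable def basis (h : IsDriftDiagonalization A R Q V l) : Module.Basis (Fin r) ℝ (Euc r) :=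
  (basisOfLinearIndependentOfCardEqFinrank' _ h.linearIndependent_col (by simp)).isUnitSMul
    (w := fun i => (√(2 * l i))⁻¹) fun i => by
      have := h.pos i
      exact (isUnit_iff_ne_zero.2 (by positivity))

variable (h : IsDriftDiagonalization A R Q V l)
include h

lemma basis_apply (i : Fin r) :
    h.basis i = (√(2 * l i))⁻¹ • (WithLp.toLp 2 (V.col i) : Euc r) := by
  simp [basis, Module.Basis.isUnitSMul_apply]

lemma inner_basis_sq (i : Fin r) (ξ : Euc r) :
    inner ℝ (h.basis i) ξ ^ 2 = inner ℝ (WithLp.toLp 2 (V.col i) : Euc r) ξ ^ 2 / (2 * l i) := by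
  have := h.pos i
  rw [h.basis_apply, real_inner_smul_left, mul_pow, inv_pow, Real.sq_sqrt (by positivity)]
  field_simp

lemma charFun_etaInf (ξ : Euc r) : charFun (etaInf A R Q) ξ =
    Complex.exp ((∑ i, -(inner ℝ (h.basis i) ξ) ^ 2 / 2 : ℝ) : ℂ) := by
  have e : WithLp.ofLp ξ ⬝ᵥ (covLimit A R Q) *ᵥ WithLp.ofLp ξ = ∑ i, inner ℝ (h.basis i) ξ ^ 2 := by
    rw [h.covLimit_eq, ← sum_sq_inner_col]
    refine Finset.sum_congr rfl fun i _ => ?_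
    congr 2
    rw [h.basis_apply, ← WithLp.toLp_smul]
    congr 1
    ext j
    simp [Matrix.mul_diagonal, mul_comm]
  rw [etaInf, charFun_multivariateGaussian h.posSemidef_covLimit, e]
  congr 1
  rw [inner_zero_right, ← Finset.sum_div, Finset.sum_neg_distrib]
  push_cast
  ring

lemma etaInf_eq : etaInf A R Q = linGauss h.basis := by
  refine Measure.ext_of_charFun (funext fun ξ => ?_)
  rw [h.charFun_etaInf, charFun_linGauss]

lemma locallyDominates_etaInf : LocallyDominates (etaInf A R Q) := by
  rw [h.etaInf_eq]
  exact fun K hK => exists_volume_restrict_le_linGauss h.basis hK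

lemma etaInf_absolutelyContinuous : etaInf A R Q ≪ volume := by
  rw [h.etaInf_eq]
  exact linGauss_absolutelyContinuous h.basis

/-- The law of the noise accumulated by the `h`-process up to time `t`. -/
noncomputable def noiseLaw (h : IsDriftDiagonalization A R Q V l) (t : ℝ) : Measure (Euc r) :=
  linGauss fun i => √(1 - Real.exp (-l i * t) ^ 2) • h.basis i

instance (t : ℝ) : IsProbabilityMeasure (h.noiseLaw t) := by
  unfold noiseLaw; infer_instance

lemma exp_le_one (i : Fin r) {t : ℝ} (ht : 0 ≤ t) : Real.exp (-l i * t) ≤ 1 := by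
  rw [Real.exp_le_one_iff]
  nlinarith [h.pos i]

/-- The noise accumulated along e_i has variance 1 - e^{-2 l_i t}, exactly what e^{-2 l_i t} lacks
to restore the unit variance of the limiting law. -/
lemma isMehlerPair {t : ℝ} (ht : 0 ≤ t) :
    IsMehlerPair h.basis (fun i => Real.exp (-l i * t))
      (Matrix.toEuclideanCLM (n := Fin r) (𝕜 := ℝ) (expDrift A R Q t))
      (h.noiseLaw t) (etaInf A R Q) where
  map_eq i := by
    rw [h.basis_apply, map_smul, h.toEuclideanCLM_expDrift_col, smul_comm]
  abs_le i := by
    rw [Real.abs_exp]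
    exact h.exp_le_one i ht
  charFun_stationary := h.charFun_etaInf
  charFun_noise ξ := by
    rw [noiseLaw, charFun_linGauss]
    congr 2
    refine Finset.sum_congr rfl fun i _ => ?_
    have : Real.exp (-l i * t) ^ 2 ≤ 1 := pow_le_one₀ (Real.exp_nonneg _) (h.exp_le_one i ht)
    rw [real_inner_smul_left, mul_pow, Real.sq_sqrt (by linarith)]

theorem map_eq_affineLaw {m : ℕ} {B : Matrix (Fin r) (Fin m) ℝ}
    (hB : B * Bᵀ = R) {Ω : Type*} [MeasurableSpace Ω] {P : Measure Ω} [IsProbabilityMeasure P]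
    {W : Fin m → ℝ≥0 → Ω → ℝ} {X : ℝ≥0 → Ω → EuclideanSpace ℝ (Fin r)}
    (hX : IsHDiffusion A R Q B P W X) (t : ℝ≥0) :
    P.map (X t) = affineLaw (Matrix.toEuclideanCLM (n := Fin r) (𝕜 := ℝ) (expDrift A R Q t))
      (h.noiseLaw t) (P.map (X 0)) := by
  have := Measure.isProbabilityMeasure_map (hX.aemeasurable t)
  have := Measure.isProbabilityMeasure_map (hX.aemeasurable 0)
  refine Measure.ext_of_charFun (funext fun ξ => ?_)
  rw [charFun_affineLaw, (h.isMehlerPair t.coe_nonneg).charFun_noise,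
    hX.charFun_map_eq h.pos h.toEuclideanCLM_drift_col (fun a => ?_) t ξ,
    h.toEuclideanCLM_expDrift t t.coe_nonneg]
  · congr 3
    refine Finset.sum_congr rfl fun i _ => ?_
    rw [h.inner_basis_sq]
    ring
  · rw [sum_sq_inner_col, sum_sq_inner_col, hB, h.mul_transpose]

end IsDriftDiagonalization

end OscHTransform

theorem mainTheorem9 {r : ℕ} (A R S : Matrix (Fin r) (Fin r) ℝ)
    (hS : S.PosSemidef) (hR : R.PosDef) (hrank : OscHTransform.RankCondition A R S)
    (hrev : A * R = R * Aᵀ) :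
    (∃! Q, OscHTransform.IsPosRiccatiSol A R S Q) ∧
    ∀ Q, OscHTransform.IsPosRiccatiSol A R S Q →
      -- the parameters `(α_h, β_h)` exist, and the integral `ι_h` converges
      (∃ α β : ℝ, 0 < α ∧ 0 < β ∧
        ∀ s : ℝ, 0 ≤ s →
          OscHTransform.specNorm (OscHTransform.expDrift A R Q s) ≤ α * Real.exp (-β * s)) ∧
      IntegrableOn (fun s : ℝ => OscHTransform.specNorm (OscHTransform.expDrift A R Q s) ^ 2) (Ioi 0) ∧
      ∀ {m : ℕ} (B : Matrix (Fin r) (Fin m) ℝ), B * Bᵀ = R →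
      ∀ {Ω : Type*} [MeasurableSpace Ω] (P : Measure Ω) [IsProbabilityMeasure P]
        (W : Fin m → ℝ≥0 → Ω → ℝ) (X : ℝ≥0 → Ω → EuclideanSpace ℝ (Fin r)),
        OscHTransform.IsHDiffusion A R Q B P W X →
        ∀ t : ℝ≥0,
          (∀ α β : ℝ, 0 < α → 0 < β →
            (∀ s : ℝ, 0 ≤ s →
              OscHTransform.specNorm (OscHTransform.expDrift A R Q s) ≤ α * Real.exp (-β * s)) →
            OscHTransform.fisherInfo (P.map (X t)) (OscHTransform.etaInf A R Q) ≤
              ENNReal.ofReal (α ^ 2 * Real.exp (-2 * β * t)) *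
                OscHTransform.fisherInfo (P.map (X 0)) (OscHTransform.etaInf A R Q)) ∧
          OscHTransform.relEnt (P.map (X t)) (OscHTransform.etaInf A R Q) ≤
            ENNReal.ofReal (Real.exp (-(t : ℝ) / OscHTransform.iotaH A R Q)) *
              OscHTransform.relEnt (P.map (X 0)) (OscHTransform.etaInf A R Q) := by
  refine ⟨OscHTransform.existsUnique_isPosRiccatiSol hS hR hrank hrev, fun Q hQ => ?_⟩
  obtain ⟨V, l, h⟩ := hQ.exists_diagonalization hS hR hrev
  refine ⟨h.exists_specNorm_le, h.integrableOn_specNorm_sq, ?_⟩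
  intro m B hB Ω _ P _ W X hX t
  have := Measure.isProbabilityMeasure_map (hX.aemeasurable 0)
  have hM := h.isMehlerPair t.coe_nonneg
  rw [h.map_eq_affineLaw hB hX t]
  refine ⟨fun α β hα hβ hle => ?_, ?_⟩
  -- The exponential is invertible, so the flow is a linear isomorphism, as the change of variables
  -- for weak gradients requires.
  · obtain ⟨u, hu⟩ : IsUnit (Matrix.toEuclideanCLM (n := Fin r) (𝕜 := ℝ)
        (OscHTransform.expDrift A R Q t)) :=
      (Matrix.isUnit_exp ((t : ℝ) • (A - R * Q))).map (Matrix.toEuclideanCLM (n := Fin r) (𝕜 := ℝ))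
    set M : OscHTransform.Euc r ≃L[ℝ] OscHTransform.Euc r := ContinuousLinearEquiv.ofUnit u
    have hMu : (M : OscHTransform.Euc r →L[ℝ] OscHTransform.Euc r) =
        Matrix.toEuclideanCLM (n := Fin r) (𝕜 := ℝ) (OscHTransform.expDrift A R Q t) := hu
    have hnorm := hle t t.coe_nonneg
    rw [OscHTransform.specNorm, ← hMu] at hnorm
    rw [← hMu] at hM ⊢
    refine (hM.fisherInfo_affineLaw_le h.locallyDominates_etaInf h.etaInf_absolutelyContinuous
      (by positivity) hnorm).trans_eq ?_
    congr 2
    rw [mul_pow, ← Real.exp_nat_mul]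
    congr 2
    push_cast
    ring
  · exact hM.klDiv_affineLaw_le (Real.exp_pos _) (fun i => h.exp_sq_le i t.coe_nonneg) _
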